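/- Let $G_1$ be a finite-dimensional real Lie group whose Lie algebra is semisimple, and let $H \subseteq G_1$ be a closed subgroup such that the group $N_{G_1}(H)/H$ is abelian, where $N_{G_1}(H)$ denotes the normalizer of $H$ in $G_1$. Let $G = \mathrm{SL}_2(\mathbb R)\times G_1$ act on the homogeneous space $$G/(\{1\}\times H) = \mathrm{SL}_2(\mathbb R)\times (G_1/H)$$ by $(s,a)\cdot(t,xH) = (st, axH)$. Then $\mathrm{SL}_2(\mathbb R)\times (G_1/H)$ admits no $G$-invariant Einstein metric; that is, there is no smooth $G$-invariant Riemannian metric $g$ on it whose Ricci tensor satisfies $\mathrm{Ric}(g) = c\, g$ for some $c\in\mathbb R$. -/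

import Mathlib

open scoped Manifold ContDiff MatrixGroups Bundle

noncomputable section

/-! ### Riemannian geometry: Levi-Civita connection, curvature, Einstein metrics -/

section Riemannian

variable {E : Type*} [NormedAddCommGroup E] [NormedSpace ℝ E]
  {H : Type*} [TopologicalSpace H] (I : ModelWithCorners ℝ E H)
  (M : Type*) [TopologicalSpace M] [ChartedSpace H M] [IsManifold I ∞ M]

/-- A smooth Riemannian metric on the manifold `M`. -/
abbrev SmoothMetric :=
  Bundle.ContMDiffRiemannianMetric I ∞ E (fun x : M => TangentSpace I x)

/-- An affine connection on `M`. The value of `∇_X Y` at `x` is written `nabla Y x (X x)`. -/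
abbrev AffineConnection :=
  CovariantDerivative I E (fun x : M => TangentSpace I x)

variable {I M}

/-- The vector field `X` on `M` is smooth. -/
def IsSmoothField (X : (x : M) → TangentSpace I x) : Prop :=
  ContMDiff I I.tangent ∞ (fun x => (⟨x, X x⟩ : TangentBundle I M))

/-- `nabla` is the Levi-Civita connection of the metric `g`: it is smooth, compatible with `g`,
and torsion free. -/
def IsLeviCivita [FiniteDimensional ℝ E] (g : SmoothMetric I M)
    (nabla : AffineConnection I M) : Prop :=
  nabla.ContMDiffCovariantDerivative ∞ ∧
  (letI : Bundle.RiemannianBundle (fun x : M => TangentSpace I x) := ⟨g.toRiemannianMetric⟩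
   CovariantDerivative.IsMetricCompatible (V := fun x : M => TangentSpace I x) nabla) ∧
  nabla.torsion = 0

/-- `R(X, Y)Z = ∇_X ∇_Y Z - ∇_Y ∇_X Z - ∇_[X, Y] Z`. -/
def curvature (nabla : AffineConnection I M) (X Y Z : (x : M) → TangentSpace I x) (x : M) :
    TangentSpace I x :=
  nabla (fun y => nabla Z y (Y y)) x (X x) - nabla (fun y => nabla Z y (X y)) x (Y x)
    - nabla Z x (VectorField.mlieBracket I X Y x)

/-- `R` is the curvature tensor of `nabla`. -/
def IsCurvatureTensor (nabla : AffineConnection I M)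
    (R : (x : M) → TangentSpace I x →ₗ[ℝ] TangentSpace I x →ₗ[ℝ] TangentSpace I x →ₗ[ℝ]
      TangentSpace I x) : Prop :=
  ∀ X Y Z : (x : M) → TangentSpace I x, IsSmoothField X → IsSmoothField Y → IsSmoothField Z →
    ∀ x, R x (X x) (Y x) (Z x) = curvature nabla X Y Z x

/-- The Ricci form at a point of a curvature tensor `R`:
`Ric(v, w)` is the trace of the endomorphism `u ↦ R(u, v)w`. -/
def ricci {x : M}
    (R : TangentSpace I x →ₗ[ℝ] TangentSpace I x →ₗ[ℝ] TangentSpace I x →ₗ[ℝ] TangentSpace I x)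
    (v w : TangentSpace I x) : ℝ :=
  LinearMap.trace ℝ (TangentSpace I x) ((R.flip v).flip w)

/-- The metric `g` is Einstein: the Ricci tensor of its Levi-Civita connection satisfies
`Ric = c g` for some real constant `c`. -/
def IsEinstein [FiniteDimensional ℝ E] (g : SmoothMetric I M) : Prop :=
  ∃ nabla : AffineConnection I M, IsLeviCivita g nabla ∧
    ∃ R, IsCurvatureTensor nabla R ∧
      ∃ c : ℝ, ∀ (x : M) (v w : TangentSpace I x), ricci (R x) v w = c * g.inner x v w

/-- The map `φ` preserves the Riemannian metric `g`, i.e. `φ^* g = g`. -/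
def PreservesMetric (g : SmoothMetric I M) (φ : M → M) : Prop :=
  ∀ (x : M) (v w : TangentSpace I x),
    g.inner (φ x) (mfderiv I I φ x v) (mfderiv I I φ x w) = g.inner x v w

end Riemannian

/-! ### Lie groups -/

/-- A smooth Lie group has the finite order of smoothness that Mathlib uses to define the Lie
bracket on the tangent space at the identity. -/
instance instLieGroupMinSmoothness {E : Type*} [NormedAddCommGroup E] [NormedSpace ℝ E]
    {H : Type*} [TopologicalSpace H] {I : ModelWithCorners ℝ E H}
    {G : Type*} [TopologicalSpace G] [ChartedSpace H G] [Group G] [LieGroup I ∞ G] :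
    LieGroup I (minSmoothness ℝ 3) G :=
  LieGroup.of_le (n := ∞) (by rw [minSmoothness_of_isRCLikeNormedField]; exact WithTop.coe_le_coe.2 (le_top : (3 : ℕ∞) ≤ ⊤))

/-! ### `SL(2, ℝ)` as a three-dimensional Lie group -/

namespace SLTwo

/-- The matrix in `SL(2, ℝ)` with first row `(x, y)`, lower left entry `z`, and `x ≠ 0`
(a junk value if `x = 0`). -/
def ofCoord (p : ℝ × ℝ × ℝ) : SL(2, ℝ) :=
  if h : p.1 ≠ 0 then
    ⟨!![p.1, p.2.1; p.2.2, (1 + p.2.1 * p.2.2) / p.1], by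
      rw [Matrix.det_fin_two_of]; field_simp; ring⟩
  else 1

lemma continuous_entry (i j : Fin 2) : Continuous (fun A : SL(2, ℝ) => A i j) :=
  (continuous_apply j).comp ((continuous_apply i).comp continuous_subtype_val)

/-- The chart `A ↦ (A₀₀, A₀₁, A₁₀)` on the open set `A₀₀ ≠ 0`. -/
def chartOne : OpenPartialHomeomorph SL(2, ℝ) (ℝ × ℝ × ℝ) where
  toFun A := (A 0 0, A 0 1, A 1 0)
  invFun := ofCoord
  source := {A | A 0 0 ≠ 0}
  target := {p | p.1 ≠ 0}
  map_source' A hA := hA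
  map_target' p hp := by
    have hp' : p.1 ≠ 0 := hp
    change (ofCoord p) 0 0 ≠ 0
    simp [ofCoord, hp']
  left_inv' A hA := by
    have hA' : A 0 0 ≠ 0 := hA
    have hd := A.det_coe
    rw [Matrix.det_fin_two] at hd
    ext i j
    fin_cases i <;> fin_cases j <;> simp [ofCoord, hA']
    field_simp
    linarith
  right_inv' p hp := by
    have hp' : p.1 ≠ 0 := hp
    simp [ofCoord, hp']
  open_source := isOpen_ne.preimage (continuous_entry 0 0)
  open_target := isOpen_ne.preimage continuous_fst
  continuousOn_toFun := ((continuous_entry 0 0).prodMk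
    ((continuous_entry 0 1).prodMk (continuous_entry 1 0))).continuousOn
  continuousOn_invFun := by
    have ind : Topology.IsInducing (fun A : SL(2, ℝ) => (A : Matrix (Fin 2) (Fin 2) ℝ)) :=
      Topology.IsInducing.subtypeVal
    rw [ind.continuousOn_iff]
    have : ContinuousOn (fun p : ℝ × ℝ × ℝ =>
        !![p.1, p.2.1; p.2.2, (1 + p.2.1 * p.2.2) / p.1]) {p | p.1 ≠ 0} := by
      refine continuousOn_pi.2 fun i => continuousOn_pi.2 fun j => ?_
      fin_cases i <;> fin_cases j <;> simp <;> fun_prop (disch := simp)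
    refine this.congr fun p hp => ?_
    have hp' : p.1 ≠ 0 := hp
    simp [ofCoord, hp']

/-- The chart around `A`: the chart `chartOne` around `1`, translated by `A`. -/
def chart (A : SL(2, ℝ)) : OpenPartialHomeomorph SL(2, ℝ) (ℝ × ℝ × ℝ) :=
  (Homeomorph.mulLeft A⁻¹).toOpenPartialHomeomorph.trans chartOne

/-- `SL(2, ℝ)` as a three-dimensional manifold. -/
instance instChartedSpace : ChartedSpace (ℝ × ℝ × ℝ) SL(2, ℝ) where
  atlas := Set.range chart
  chartAt := chart
  mem_chart_source A := by
    have h : (A⁻¹ * A) 0 0 ≠ 0 := by rw [inv_mul_cancel]; simp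
    rw [chart, OpenPartialHomeomorph.trans_source]
    exact ⟨trivial, h⟩
  chart_mem_atlas A := ⟨A, rfl⟩

lemma contDiffOn_ofCoord_entry (n : ℕ∞ω) (i j : Fin 2) :
    ContDiffOn ℝ n (fun p => ofCoord p i j) {p | p.1 ≠ 0} := by
  have : ContDiffOn ℝ n (fun p : ℝ × ℝ × ℝ =>
      !![p.1, p.2.1; p.2.2, (1 + p.2.1 * p.2.2) / p.1] i j) {p | p.1 ≠ 0} := by
    fin_cases i <;> fin_cases j <;> simp <;> fun_prop (disch := simp)
  refine this.congr fun p hp => ?_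
  have hp' : p.1 ≠ 0 := hp
  simp [ofCoord, hp']

instance instIsManifold (n : ℕ∞ω) : IsManifold 𝓘(ℝ, ℝ × ℝ × ℝ) n SL(2, ℝ) := by
  apply isManifold_of_contDiffOn
  rintro _ _ ⟨A, rfl⟩ ⟨B, rfl⟩
  have key : ContDiffOn ℝ n (fun p => chart B ((chart A).symm p)) {p | p.1 ≠ 0} := by
    have e : ∀ p, chart B ((chart A).symm p) = chartOne (B⁻¹ * A * ofCoord p) := by
      intro p
      change chartOne (B⁻¹ * ((A⁻¹)⁻¹ * ofCoord p)) = _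
      rw [inv_inv, mul_assoc]
    simp only [e]
    have h : ∀ i j, ContDiffOn ℝ n (fun p => (B⁻¹ * A * ofCoord p) i j) {p | p.1 ≠ 0} := by
      intro i j
      simp only [Matrix.SpecialLinearGroup.coe_mul, Matrix.mul_apply (M := (_ * _ : Matrix _ _ _)),
        Fin.sum_univ_two]
      exact ((contDiffOn_const).mul (contDiffOn_ofCoord_entry n 0 j)).add
        ((contDiffOn_const).mul (contDiffOn_ofCoord_entry n 1 j))
    exact (h 0 0).prodMk ((h 0 1).prodMk (h 1 0))
  refine key.mono ?_
  rintro p ⟨hp, -⟩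
  have hp' : p ∈ ((chart A).symm ≫ₕ chart B).source := hp
  rw [OpenPartialHomeomorph.trans_source] at hp'
  have hq : p ∈ (chart A).target := hp'.1
  rw [chart, OpenPartialHomeomorph.trans_target] at hq
  exact hq.1

lemma contMDiff_entry (n : ℕ∞ω) (i j : Fin 2) :
    ContMDiff 𝓘(ℝ, ℝ × ℝ × ℝ) 𝓘(ℝ) n (fun A : SL(2, ℝ) => A i j) := by
  intro A
  have h : ContDiffOn ℝ n (fun p => (A * ofCoord p) i j) {p | p.1 ≠ 0} := by
    simp only [Matrix.SpecialLinearGroup.coe_mul, Matrix.mul_apply, Fin.sum_univ_two]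
    exact ((contDiffOn_const).mul (contDiffOn_ofCoord_entry n 0 j)).add
      ((contDiffOn_const).mul (contDiffOn_ofCoord_entry n 1 j))
  have hA : A ∈ (chart A).source := mem_chart_source (ℝ × ℝ × ℝ) A
  have hopen : IsOpen {p : ℝ × ℝ × ℝ | p.1 ≠ 0} := isOpen_ne.preimage continuous_fst
  have h1 : (chart A A).1 ≠ 0 := by
    rw [chart, OpenPartialHomeomorph.trans_source] at hA
    exact hA.2
  have h2 : ContMDiffAt 𝓘(ℝ, ℝ × ℝ × ℝ) 𝓘(ℝ) n
      ((fun p => (A * ofCoord p) i j) ∘ chart A) A :=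
    (h.contDiffAt (hopen.mem_nhds h1)).contMDiffAt.comp A (contMDiffAt_of_mem_maximalAtlas
      (IsManifold.chart_mem_maximalAtlas (I := 𝓘(ℝ, ℝ × ℝ × ℝ)) A) hA)
  refine h2.congr_of_eventuallyEq ?_
  filter_upwards [(chart A).open_source.mem_nhds hA] with B hB
  have e : (A⁻¹)⁻¹ * ofCoord (chart A B) = B := (chart A).left_inv hB
  rw [inv_inv] at e
  simp only [Function.comp_apply, e]

lemma contMDiff_of_entries {E H M : Type*} [NormedAddCommGroup E] [NormedSpace ℝ E]
    [TopologicalSpace H] {I : ModelWithCorners ℝ E H} [TopologicalSpace M] [ChartedSpace H M]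
    (n : ℕ∞ω) {f : M → SL(2, ℝ)}
    (hf : ∀ i j, ContMDiff I 𝓘(ℝ) n (fun x => f x i j)) :
    ContMDiff I 𝓘(ℝ, ℝ × ℝ × ℝ) n f := by
  intro x
  rw [contMDiffAt_iff_target]
  constructor
  · have ind : Topology.IsInducing (fun A : SL(2, ℝ) => (A : Matrix (Fin 2) (Fin 2) ℝ)) :=
      Topology.IsInducing.subtypeVal
    rw [ind.continuousAt_iff]
    exact continuousAt_pi.2 fun i => continuousAt_pi.2 fun j => (hf i j).continuous.continuousAt
  · have h : ∀ i j, ContMDiff I 𝓘(ℝ) n (fun y => ((f x)⁻¹ * f y) i j) := by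
      intro i j
      simp only [Matrix.SpecialLinearGroup.coe_mul, Matrix.mul_apply, Fin.sum_univ_two]
      exact (contMDiff_const.mul (hf 0 j)).add (contMDiff_const.mul (hf 1 j))
    exact ((h 0 0).prodMk_space ((h 0 1).prodMk_space (h 1 0))) x

instance instLieGroup (n : ℕ∞ω) : LieGroup 𝓘(ℝ, ℝ × ℝ × ℝ) n SL(2, ℝ) where
  contMDiff_mul := by
    apply contMDiff_of_entries
    intro i j
    simp only [Matrix.SpecialLinearGroup.coe_mul, Matrix.mul_apply, Fin.sum_univ_two]
    exact (((contMDiff_entry n i 0).comp contMDiff_fst).mul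
        ((contMDiff_entry n 0 j).comp contMDiff_snd)).add
      (((contMDiff_entry n i 1).comp contMDiff_fst).mul
        ((contMDiff_entry n 1 j).comp contMDiff_snd))
  contMDiff_inv := by
    apply contMDiff_of_entries
    intro i j
    simp only [Matrix.SpecialLinearGroup.coe_inv, Matrix.adjugate_fin_two]
    fin_cases i <;> fin_cases j <;> simp
    · exact contMDiff_entry n 1 1
    · exact (contMDiff_entry n 0 1).neg
    · exact (contMDiff_entry n 1 0).neg
    · exact contMDiff_entry n 0 0

end SLTwo

end

set_option linter.unusedSectionVars false

noncomputable section

/-! ### Related vector fields -/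

section Related

open VectorField Filter Topology

variable {E : Type*} [NormedAddCommGroup E] [NormedSpace ℝ E]
  {E' : Type*} [NormedAddCommGroup E'] [NormedSpace ℝ E']

/-- Lie brackets of related vector fields on vector spaces are related. -/
lemma fderiv_lieBracket_of_related {F : E → E'} {V W : E → E} {V' W' : E' → E'} {x : E}
    (hF : ContDiffAt ℝ 2 F x) (hV : DifferentiableAt ℝ V x) (hW : DifferentiableAt ℝ W x)
    (hV' : DifferentiableAt ℝ V' (F x)) (hW' : DifferentiableAt ℝ W' (F x))
    (hVV : ∀ᶠ y in 𝓝 x, fderiv ℝ F y (V y) = V' (F y))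
    (hWW : ∀ᶠ y in 𝓝 x, fderiv ℝ F y (W y) = W' (F y)) :
    fderiv ℝ F x (lieBracket ℝ V W x) = lieBracket ℝ V' W' (F x) := by
  have hFd : DifferentiableAt ℝ F x := hF.differentiableAt (by norm_num)
  rw [fderiv_apply_lieBracket hF (by simp) hW hV]
  have e1 : (fun y => fderiv ℝ F y (W y)) =ᶠ[𝓝 x] W' ∘ F := hWW
  have e2 : (fun y => fderiv ℝ F y (V y)) =ᶠ[𝓝 x] V' ∘ F := hVV
  rw [e1.fderiv_eq, e2.fderiv_eq, fderiv_comp x hW' hFd, fderiv_comp x hV' hFd, lieBracket]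
  simp only [ContinuousLinearMap.comp_apply, hVV.self_of_nhds, hWW.self_of_nhds]

variable {H : Type*} [TopologicalSpace H] {I : ModelWithCorners ℝ E H}
  {M : Type*} [TopologicalSpace M] [ChartedSpace H M]
  {H' : Type*} [TopologicalSpace H'] {I' : ModelWithCorners ℝ E' H'}
  {M' : Type*} [TopologicalSpace M'] [ChartedSpace H' M']

/-- The vector field `V` read in the preferred chart at `x`. -/
def chartField (V : (x : M) → TangentSpace I x) (x : M) (y : E) : E :=
  mfderiv I 𝓘(ℝ, E) (extChartAt I x) ((extChartAt I x).symm y) (V ((extChartAt I x).symm y))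

lemma chartField_apply (V : (x : M) → TangentSpace I x) (x : M) {y : E} {z : M}
    (hz : (extChartAt I x).symm y = z) :
    chartField V x y = (mfderiv I 𝓘(ℝ, E) (extChartAt I x) z (V z) : E) := by
  subst hz
  rfl

lemma chartField_eq_mpullbackWithin [IsManifold I 1 M]
    (V : (x : M) → TangentSpace I x) (x : M) {y : E} (hy : y ∈ (extChartAt I x).target) :
    mpullbackWithin 𝓘(ℝ, E) I (extChartAt I x).symm V (Set.range I) y = chartField V x y := by
  rw [mpullbackWithin_apply]
  have := ContinuousLinearMap.inverse_eq
    (mfderivWithin_extChartAt_symm_comp_mfderiv_extChartAt (I := I) hy)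
    (mfderiv_extChartAt_comp_mfderivWithin_extChartAt_symm hy)
  rw [this]
  rfl

/-- The Lie bracket at `x` is the Lie bracket of the vector fields read in the chart at `x`. -/
lemma mlieBracket_eq_lieBracket_chartField [IsManifold I 1 M] [I.Boundaryless]
    (V W : (x : M) → TangentSpace I x) (x : M) :
    mlieBracket I V W x =
      (lieBracket ℝ (chartField V x) (chartField W x) (extChartAt I x x) : E) := by
  have e : ∀ V : (x : M) → TangentSpace I x,
      (mpullbackWithin 𝓘(ℝ, E) I (extChartAt I x).symm V (Set.range I) : E → E)
        =ᶠ[𝓝 (extChartAt I x x)] chartField V x := fun V => by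
    filter_upwards [extChartAt_target_mem_nhds (I := I) x] with y hy
    exact chartField_eq_mpullbackWithin V x hy
  have h1 : mlieBracket I V W x = (mfderiv I 𝓘(ℝ, E) (extChartAt I x) x).inverse
    ((lieBracketWithin ℝ
      (mpullbackWithin 𝓘(ℝ, E) I (extChartAt I x).symm V (Set.range I))
      (mpullbackWithin 𝓘(ℝ, E) I (extChartAt I x).symm W (Set.range I))
      ((extChartAt I x).symm ⁻¹' Set.univ ∩ Set.range I)) (extChartAt I x x)) :=
    mlieBracketWithin_apply
  have h2 : lieBracketWithin ℝ
      (mpullbackWithin 𝓘(ℝ, E) I (extChartAt I x).symm V (Set.range I) : E → E)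
      (mpullbackWithin 𝓘(ℝ, E) I (extChartAt I x).symm W (Set.range I) : E → E)
      ((extChartAt I x).symm ⁻¹' Set.univ ∩ Set.range I) (extChartAt I x x) =
      lieBracket ℝ (chartField V x) (chartField W x) (extChartAt I x x) := by
    have hu : (extChartAt I x).symm ⁻¹' Set.univ ∩ Set.range I = Set.univ := by
      rw [I.range_eq_univ]; simp
    have aux : ∀ {A B A' B' : E → E} {s : Set E} {p : E}, s = Set.univ → A =ᶠ[𝓝 p] A' →
        B =ᶠ[𝓝 p] B' → lieBracketWithin ℝ A B s p = lieBracket ℝ A' B' p := by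
      intro A B A' B' s p hs hA hB
      rw [hs, lieBracketWithin_univ]
      exact hA.lieBracket_vectorField_eq hB
    exact aux hu (e V) (e W)
  rw [h1, mfderiv_extChartAt_self]
  exact (congrArg _ h2).trans (DFunLike.congr_fun (ContinuousLinearMap.inverse_id (R := ℝ) (M := E)) _)

lemma differentiableAt_chartField [IsManifold I 2 M] [I.Boundaryless] [CompleteSpace E]
    (V : (x : M) → TangentSpace I x) (x : M)
    (hV : MDifferentiableAt I I.tangent (fun y => (⟨y, V y⟩ : TangentBundle I M)) x) :
    DifferentiableAt ℝ (chartField V x) (extChartAt I x x) := by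
  have : IsManifold I 1 M := IsManifold.of_le (n := 2) (by norm_num)
  have h := (mdifferentiableWithinAt_univ.2 hV).differentiableWithinAt_mpullbackWithin_vectorField
  have hu : (extChartAt I x).symm ⁻¹' Set.univ ∩ Set.range I = Set.univ := by
    rw [I.range_eq_univ]; simp
  have h' : DifferentiableWithinAt ℝ
      (mpullbackWithin 𝓘(ℝ, E) I (extChartAt I x).symm V (Set.range I) : E → E) Set.univ
      (extChartAt I x x) := hu ▸ h
  refine (differentiableWithinAt_univ.1 h').congr_of_eventuallyEq ?_
  filter_upwards [extChartAt_target_mem_nhds (I := I) x] with y hy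
  exact (chartField_eq_mpullbackWithin V x hy).symm

/-- Lie brackets of `f`-related vector fields are `f`-related. -/
theorem mfderiv_mlieBracket_of_related [IsManifold I 2 M] [IsManifold I' 2 M'] [I.Boundaryless]
    [I'.Boundaryless] [CompleteSpace E] [CompleteSpace E'] {f : M → M'}
    {V W : (x : M) → TangentSpace I x} {V' W' : (x : M') → TangentSpace I' x} {x : M}
    (hf : ContMDiffAt I I' 2 f x)
    (hV : MDifferentiableAt I I.tangent (fun y => (⟨y, V y⟩ : TangentBundle I M)) x)
    (hW : MDifferentiableAt I I.tangent (fun y => (⟨y, W y⟩ : TangentBundle I M)) x)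
    (hV' : MDifferentiableAt I' I'.tangent (fun y => (⟨y, V' y⟩ : TangentBundle I' M')) (f x))
    (hW' : MDifferentiableAt I' I'.tangent (fun y => (⟨y, W' y⟩ : TangentBundle I' M')) (f x))
    (hVV : ∀ᶠ y in 𝓝 x, mfderiv I I' f y (V y) = V' (f y))
    (hWW : ∀ᶠ y in 𝓝 x, mfderiv I I' f y (W y) = W' (f y)) :
    mfderiv I I' f x (mlieBracket I V W x) = mlieBracket I' V' W' (f x) := by
  have : IsManifold I 1 M := IsManifold.of_le (n := 2) (by norm_num)
  have : IsManifold I' 1 M' := IsManifold.of_le (n := 2) (by norm_num)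
  set F : E → E' := extChartAt I' (f x) ∘ f ∘ (extChartAt I x).symm with hFdef
  have hφx : (extChartAt I x).symm (extChartAt I x x) = x := extChartAt_to_inv x
  have hFx : F (extChartAt I x x) = extChartAt I' (f x) (f x) := by simp [F]
  have hFs : ContDiffAt ℝ 2 F (extChartAt I x x) := by
    have := (contMDiffAt_iff.1 hf).2
    rw [I.range_eq_univ, contDiffWithinAt_univ] at this
    exact this
  have hsym : Tendsto (extChartAt I x).symm (𝓝 (extChartAt I x x)) (𝓝 x) := by
    have := continuousAt_extChartAt_symm (I := I) x
    rwa [ContinuousAt, hφx] at this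
  have hfd : ∀ᶠ y in 𝓝 x, MDifferentiableAt I I' f y := by
    filter_upwards [(contMDiffAt_iff_contMDiffAt_nhds (by simp)).1 hf] with y hy
    exact hy.mdifferentiableAt (by simp)
  have hsrc : ∀ᶠ y in 𝓝 x, f y ∈ (extChartAt I' (f x)).source :=
    hf.continuousAt.preimage_mem_nhds (extChartAt_source_mem_nhds (f x))
  have hrel : ∀ (V : (x : M) → TangentSpace I x) (V' : (x : M') → TangentSpace I' x),
      (∀ᶠ y in 𝓝 x, mfderiv I I' f y (V y) = V' (f y)) →
      ∀ᶠ y in 𝓝 (extChartAt I x x), fderiv ℝ F y (chartField V x y) =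
        chartField V' (f x) (F y) := by
    intro V V' h
    filter_upwards [hsym.eventually hfd, hsym.eventually hsrc, hsym.eventually h,
      extChartAt_target_mem_nhds (I := I) x] with y hy1 hy2 hy3 hy
    have hz : (extChartAt I x).symm y ∈ (extChartAt I x).source := (extChartAt I x).map_target hy
    have hz' : (extChartAt I' (f x)).symm (F y) = f ((extChartAt I x).symm y) :=
      (extChartAt I' (f x)).left_inv hy2
    have e0 : chartField V' (f x) (F y) = (mfderiv I' 𝓘(ℝ, E') (extChartAt I' (f x))
        (f ((extChartAt I x).symm y)) (mfderiv I I' f ((extChartAt I x).symm y)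
          (V ((extChartAt I x).symm y))) : E') := by
      rw [chartField_apply V' (f x) hz', hy3]
    rw [e0]
    let D : E →L[ℝ] E' :=
      (mfderiv I' 𝓘(ℝ, E') (extChartAt I' (f x)) (f ((extChartAt I x).symm y)) : E' →L[ℝ] E').comp
        ((mfderiv I I' f ((extChartAt I x).symm y) : E →L[ℝ] E').comp
          (mfderivWithin 𝓘(ℝ, E) I (extChartAt I x).symm (Set.range I) y : E →L[ℝ] E))
    have e1 : HasMFDerivAt 𝓘(ℝ, E) 𝓘(ℝ, E') F y D := by
      refine HasMFDerivAt.comp y (mdifferentiableAt_extChartAt ?_).hasMFDerivAt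
        (hy1.hasMFDerivAt.comp y ?_)
      · simpa using hy2
      · have := (mdifferentiableWithinAt_extChartAt_symm (I := I) hy).hasMFDerivWithinAt
        rw [I.range_eq_univ, hasMFDerivWithinAt_univ, ← I.range_eq_univ] at this
        exact this
    have e2 : fderiv ℝ F y = D := mfderiv_eq_fderiv.symm.trans e1.mfderiv
    rw [e2]
    have e3 := DFunLike.congr_fun
      (mfderivWithin_extChartAt_symm_comp_mfderiv_extChartAt (I := I) hy)
      (V ((extChartAt I x).symm y))
    exact congrArg (fun v : TangentSpace I ((extChartAt I x).symm y) => (mfderiv I' 𝓘(ℝ, E') (extChartAt I' (f x))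
      (f ((extChartAt I x).symm y))) (mfderiv I I' f ((extChartAt I x).symm y) v)) e3
  have hV'c := differentiableAt_chartField V' (f x) hV'
  have hW'c := differentiableAt_chartField W' (f x) hW'
  rw [← hFx] at hV'c hW'c
  have key := fderiv_lieBracket_of_related hFs (differentiableAt_chartField V x hV)
    (differentiableAt_chartField W x hW) hV'c hW'c (hrel V V' hVV) (hrel W W' hWW)
  rw [hFx] at key
  rw [mlieBracket_eq_lieBracket_chartField V' W', ← key, mlieBracket_eq_lieBracket_chartField V W]
  have hm : mfderiv I I' f x = (fderiv ℝ F (extChartAt I x x) : E →L[ℝ] E') := by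
    rw [(hf.mdifferentiableAt (by simp)).mfderiv, I.range_eq_univ, fderivWithin_univ]
    rfl
  rw [hm]
  rfl

end Related

section LocalSection

open Filter Topology

variable {E : Type*} [NormedAddCommGroup E] [NormedSpace ℝ E]
  {E' : Type*} [NormedAddCommGroup E'] [NormedSpace ℝ E']
  {H : Type*} [TopologicalSpace H] {I : ModelWithCorners ℝ E H} [I.Boundaryless]
  {M : Type*} [TopologicalSpace M] [ChartedSpace H M]
  {H' : Type*} [TopologicalSpace H'] {J : ModelWithCorners ℝ E' H'} [J.Boundaryless]
  {N : Type*} [TopologicalSpace N] [ChartedSpace H' N]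

/-- A submersion has smooth local sections. -/
lemma Manifold.IsSubmersionAt.exists_local_section {n : ℕ∞ω} [IsManifold I n M] [IsManifold J n N]
    {f : M → N} {x : M}
    (h : Manifold.IsSubmersionAt I J n f x) :
    ∃ σ : N → M, ContMDiffAt J I n σ (f x) ∧ σ (f x) = x ∧ ∀ᶠ y in 𝓝 (f x), f (σ y) = y := by
  obtain ⟨F, _, _, φ, ψ, hφx, hψx, hφ, hψ, hsub, e, he⟩ := h
  set z := e (φ.extend I x)
  have hx : x ∈ (φ.extend I).source := by rwa [φ.extend_source]
  have hz1 : z.1 = ψ.extend J (f x) := by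
    have := he ((φ.extend I).map_source hx)
    simp only [Function.comp_apply, (φ.extend I).left_inv hx] at this
    exact this.symm
  let ι : N → E := fun y => e.symm (ψ.extend J y, z.2)
  have hιx : ι (f x) = φ.extend I x := by
    simp only [ι, ← hz1]
    simp [z]
  have hψc : ContMDiffAt J 𝓘(ℝ, E') n (ψ.extend J) (f x) :=
    ψ.contMDiffOn_extend hψ |>.contMDiffAt (ψ.open_source.mem_nhds hψx)
  have hι : ContMDiffAt J 𝓘(ℝ, E) n ι (f x) :=
    e.symm.contDiff.contMDiff.contMDiffAt.comp (f x)
      (hψc.prodMk_space contMDiffAt_const)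
  have hopen : IsOpen (φ.extend I).target := φ.isOpen_extend_target
  have htar : (φ.extend I).target ∈ 𝓝 (ι (f x)) := by
    rw [hιx]
    exact hopen.mem_nhds ((φ.extend I).map_source hx)
  have hsymm : ContMDiffAt 𝓘(ℝ, E) I n (φ.extend I).symm (ι (f x)) := by
    have := (contMDiffOn_extend_symm hφ)
    rw [← φ.extend_target'] at this
    exact this.contMDiffAt htar
  refine ⟨(φ.extend I).symm ∘ ι, hsymm.comp (f x) hι, ?_, ?_⟩
  · simp only [Function.comp_apply, hιx]
    exact (φ.extend I).left_inv hx
  · filter_upwards [hι.continuousAt.preimage_mem_nhds htar, ψ.open_source.mem_nhds hψx] with y hy hy'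
    have h1 := he hy
    simp only [Function.comp_apply, ι, ContinuousLinearEquiv.apply_symm_apply] at h1
    have h2 : (φ.extend I).symm (ι y) ∈ φ.source := by
      have := (φ.extend I).map_target hy
      rwa [φ.extend_source] at this
    have h3 : f ((φ.extend I).symm (ι y)) ∈ ψ.source := hsub h2
    have := congrArg (ψ.extend J).symm h1
    rwa [(ψ.extend J).left_inv (by rwa [ψ.extend_source]),
      (ψ.extend J).left_inv (by rwa [ψ.extend_source])] at this

end LocalSection

/-! ### Vector fields on products, and fields attached to smooth maps of two variables -/

section TwoVariables

open VectorField Filter Topology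

variable {E : Type*} [NormedAddCommGroup E] [NormedSpace ℝ E]
  {H : Type*} [TopologicalSpace H] {I : ModelWithCorners ℝ E H}
  {M : Type*} [TopologicalSpace M] [ChartedSpace H M] [IsManifold I ∞ M]
  {E' : Type*} [NormedAddCommGroup E'] [NormedSpace ℝ E']
  {H' : Type*} [TopologicalSpace H'] {J : ModelWithCorners ℝ E' H'}
  {N : Type*} [TopologicalSpace N] [ChartedSpace H' N] [IsManifold J ∞ N]
  {E'' : Type*} [NormedAddCommGroup E''] [NormedSpace ℝ E'']
  {H'' : Type*} [TopologicalSpace H''] {K : ModelWithCorners ℝ E'' H''}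
  {Q : Type*} [TopologicalSpace Q] [ChartedSpace H'' Q] [IsManifold K ∞ Q]

/-- The chain rule, with values in the model spaces. -/
lemma mfderiv_chain {f : M → N} {g : N → Q} {h : M → Q} {x : M} {y : N} (hh : ∀ z, h z = g (f z))
    (hy : f x = y) (hg : MDifferentiableAt J K g y) (hf : MDifferentiableAt I J f x) (v : E) :
    (mfderiv I K h x v : E'') = (mfderiv J K g y (mfderiv I J f x v : E') : E'') := by
  subst hy
  obtain rfl : h = g ∘ f := funext hh
  rw [mfderiv_comp x hg hf]
  rfl

/-- The vector field `(V, W)` on a product manifold. -/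
def prodField (V : (x : M) → TangentSpace I x) (W : (x : N) → TangentSpace J x) (p : M × N) :
    TangentSpace (I.prod J) p :=
  ((V p.1, W p.2) : E × E')

lemma contMDiff_prodField {n : ℕ∞ω} {V : (x : M) → TangentSpace I x}
    {W : (x : N) → TangentSpace J x} [IsManifold I (n + 1) M] [IsManifold J (n + 1) N]
    (hV : ContMDiff I I.tangent n (fun x => (⟨x, V x⟩ : TangentBundle I M)))
    (hW : ContMDiff J J.tangent n (fun x => (⟨x, W x⟩ : TangentBundle J N))) :
    ContMDiff (I.prod J) (I.prod J).tangent n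
      (fun p => (⟨p, prodField V W p⟩ : TangentBundle (I.prod J) (M × N))) :=
  contMDiff_equivTangentBundleProd_symm.comp ((hV.comp contMDiff_fst).prodMk (hW.comp contMDiff_snd))

lemma mfderiv_fst_prodField (V : (x : M) → TangentSpace I x) (W : (x : N) → TangentSpace J x)
    (p : M × N) : mfderiv (I.prod J) I Prod.fst p (prodField V W p) = V p.1 := by
  rw [mfderiv_fst]
  rfl

lemma mfderiv_snd_prodField (V : (x : M) → TangentSpace I x) (W : (x : N) → TangentSpace J x)
    (p : M × N) : mfderiv (I.prod J) J Prod.snd p (prodField V W p) = W p.2 := by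
  rw [mfderiv_snd]
  rfl

lemma tangentSpace_prod_ext {p : M × N} {u v : TangentSpace (I.prod J) p}
    (h1 : mfderiv (I.prod J) I Prod.fst p u = mfderiv (I.prod J) I Prod.fst p v)
    (h2 : mfderiv (I.prod J) J Prod.snd p u = mfderiv (I.prod J) J Prod.snd p v) : u = v := by
  rw [mfderiv_fst] at h1
  rw [mfderiv_snd] at h2
  exact Prod.ext h1 h2

section bracket

variable [I.Boundaryless] [J.Boundaryless] [CompleteSpace E] [CompleteSpace E']

lemma mlieBracket_prodField {V V' : (x : M) → TangentSpace I x} {W W' : (x : N) → TangentSpace J x}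
    (hV : ContMDiff I I.tangent 1 (fun x => (⟨x, V x⟩ : TangentBundle I M)))
    (hW : ContMDiff J J.tangent 1 (fun x => (⟨x, W x⟩ : TangentBundle J N)))
    (hV' : ContMDiff I I.tangent 1 (fun x => (⟨x, V' x⟩ : TangentBundle I M)))
    (hW' : ContMDiff J J.tangent 1 (fun x => (⟨x, W' x⟩ : TangentBundle J N))) :
    mlieBracket (I.prod J) (prodField V W) (prodField V' W') =
      prodField (mlieBracket I V V') (mlieBracket J W W') := by
  have : IsManifold I (1 + 1) M := by rw [one_add_one_eq_two]; infer_instance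
  have : IsManifold J (1 + 1) N := by rw [one_add_one_eq_two]; infer_instance
  funext p
  have d1 := (contMDiff_prodField hV hW).mdifferentiable (by simp) p
  have d2 := (contMDiff_prodField hV' hW').mdifferentiable (by simp) p
  apply tangentSpace_prod_ext
  · rw [mfderiv_fst_prodField]
    exact mfderiv_mlieBracket_of_related contMDiffAt_fst d1 d2
      (hV.mdifferentiable (by simp) _) (hV'.mdifferentiable (by simp) _)
      (.of_forall fun y => mfderiv_fst_prodField V W y)
      (.of_forall fun y => mfderiv_fst_prodField V' W' y)
  · rw [mfderiv_snd_prodField]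
    exact mfderiv_mlieBracket_of_related contMDiffAt_snd d1 d2
      (hW.mdifferentiable (by simp) _) (hW'.mdifferentiable (by simp) _)
      (.of_forall fun y => mfderiv_snd_prodField V W y)
      (.of_forall fun y => mfderiv_snd_prodField V' W' y)

end bracket

lemma contMDiff_mfderiv_fst {Φ : M × N → Q} (hΦ : ContMDiff (I.prod J) K ∞ Φ) (m : M)
    (ξ : TangentSpace I m) :
    ContMDiff J K.tangent ∞
      (fun x => (⟨Φ (m, x), mfderiv I K (fun a => Φ (a, x)) m ξ⟩ : TangentBundle K Q)) := by
  have h1 : ContMDiff J (I.tangent.prod J.tangent) ∞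
      (fun x : N => ((⟨m, ξ⟩ : TangentBundle I M), (⟨x, 0⟩ : TangentBundle J N))) :=
    contMDiff_const.prodMk (Bundle.contMDiff_zeroSection _ _)
  have h2 := ((hΦ.contMDiff_tangentMap (m := ∞) (by simp)).comp
    (contMDiff_equivTangentBundleProd_symm (I := I) (I' := J) (M := M) (M' := N) (n := ∞))).comp h1
  refine h2.congr fun x => ?_
  have hd : MDifferentiableAt (I.prod J) K Φ (m, x) := hΦ.mdifferentiable (by simp) _
  have h3 := mfderiv_prod_eq_add_apply (v := ((ξ, 0) : E × E')) hd
  simp only [Function.comp_apply, tangentMap]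
  refine congrArg (fun v => (⟨Φ (m, x), v⟩ : TangentBundle K Q)) ?_
  refine Eq.trans ?_ h3.symm
  exact ((congrArg (_ + ·) (map_zero (mfderiv J K (fun z => Φ (m, z)) x))).trans (add_zero _)).symm

lemma contMDiff_mfderiv_snd {Φ : M × N → Q} (hΦ : ContMDiff (I.prod J) K ∞ Φ) (n : N)
    (ξ : TangentSpace J n) :
    ContMDiff I K.tangent ∞
      (fun x => (⟨Φ (x, n), mfderiv J K (fun a => Φ (x, a)) n ξ⟩ : TangentBundle K Q)) :=
  contMDiff_mfderiv_fst (Φ := fun p : N × M => Φ (p.2, p.1))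
    (hΦ.comp (contMDiff_snd.prodMk contMDiff_fst)) n ξ

end TwoVariables

/-! ### Left and right invariant vector fields on a Lie group -/

section LieGroupFields

open VectorField Filter Topology

variable {E : Type*} [NormedAddCommGroup E] [NormedSpace ℝ E] [FiniteDimensional ℝ E]
  {H : Type*} [TopologicalSpace H] {I : ModelWithCorners ℝ E H} [I.Boundaryless]
  {G : Type*} [TopologicalSpace G] [ChartedSpace H G] [Group G] [LieGroup I ∞ G]

lemma two_le_infty : (2 : ℕ∞ω) ≤ ∞ := WithTop.coe_le_coe.2 (le_top : (2 : ℕ∞) ≤ ⊤)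

/-- The right invariant vector field with value `v` at the identity. -/
def rightInvariantField (v : GroupLieAlgebra I G) (g : G) : TangentSpace I g :=
  (mfderiv I I (fun x => x * g) 1 v : E)

/-- The vector `Ad(a⁻¹) v` of the Lie algebra. -/
def adInv (v : GroupLieAlgebra I G) (a : G) : GroupLieAlgebra I G :=
  (mfderiv I I (fun x => a⁻¹ * x * a) 1 v : E)

lemma totalSpace_mk_eq {M : Type*} [TopologicalSpace M] [ChartedSpace H M] {x y : M} (h : x = y)
    (v : E) : (⟨x, v⟩ : TangentBundle I M) = ⟨y, v⟩ := by
  subst h; rfl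

lemma contMDiff_rightInvariantField (v : GroupLieAlgebra I G) :
    ContMDiff I I.tangent ∞ (fun g => (⟨g, rightInvariantField v g⟩ : TangentBundle I G)) := by
  refine (contMDiff_mfderiv_fst (contMDiff_mul I ∞ (G := G)) 1 v).congr fun x => ?_
  exact totalSpace_mk_eq (one_mul x).symm _

lemma contMDiff_leftInvariantField (v : GroupLieAlgebra I G) :
    ContMDiff I I.tangent ∞ (fun g => (⟨g, mulInvariantVectorField v g⟩ : TangentBundle I G)) := by
  refine (contMDiff_mfderiv_snd (contMDiff_mul I ∞ (G := G)) 1 v).congr fun x => ?_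
  exact totalSpace_mk_eq (mul_one x).symm _

lemma contMDiff_one_zero_field {M : Type*} [TopologicalSpace M] [ChartedSpace H M]
    [IsManifold I ∞ M] : ContMDiff I I.tangent ∞
      (fun g => (⟨g, (0 : (x : M) → TangentSpace I x) g⟩ : TangentBundle I M)) :=
  Bundle.contMDiff_zeroSection _ _

lemma mdifferentiable_leftMul (a : G) : MDifferentiable I I (fun x : G => a * x) :=
  (contMDiff_mul_left (n := ∞)).mdifferentiable (by simp)

lemma mdifferentiable_rightMul (a : G) : MDifferentiable I I (fun x : G => x * a) :=
  (contMDiff_mul_right (n := ∞)).mdifferentiable (by simp)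

lemma mdifferentiable_conj (a : G) : MDifferentiable I I (fun x : G => a⁻¹ * x * a) :=
  ((contMDiff_mul_right (n := ∞) (I := I) (a := a)).comp
    (contMDiff_mul_left (n := ∞) (a := a⁻¹))).mdifferentiable (by simp)

lemma mfderiv_mul_right_rightInvariantField (v : GroupLieAlgebra I G) (a b : G) :
    (mfderiv I I (fun x => x * b) a (rightInvariantField v a) : E) =
      rightInvariantField v (a * b) :=
  (mfderiv_chain (E := E) (E' := E) (E'' := E) (I := I) (J := I) (K := I)
    (f := fun x : G => x * a) (g := fun x => x * b) (h := fun x => x * (a * b))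
    (fun z => (mul_assoc z a b).symm) (one_mul a) (mdifferentiable_rightMul b a)
    (mdifferentiable_rightMul a 1) (v : E)).symm

lemma mfderiv_mul_left_leftInvariantField (v : GroupLieAlgebra I G) (a b : G) :
    (mfderiv I I (fun x => a * x) b (mulInvariantVectorField v b) : E) =
      mulInvariantVectorField v (a * b) :=
  (mfderiv_chain (E := E) (E' := E) (E'' := E) (I := I) (J := I) (K := I)
    (f := fun x : G => b * x) (g := fun x => a * x) (h := fun x => a * b * x)
    (fun z => mul_assoc a b z) (mul_one b) (mdifferentiable_leftMul a b)
    (mdifferentiable_leftMul b 1) (v : E)).symm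

/-- Left and right invariant vector fields commute. -/
lemma mlieBracket_right_left (v w : GroupLieAlgebra I G) :
    mlieBracket I (rightInvariantField v) (mulInvariantVectorField w) =
      (0 : (g : G) → TangentSpace I g) := by
  have : CompleteSpace E := FiniteDimensional.complete ℝ E
  have hR := (contMDiff_rightInvariantField (I := I) (G := G) v).of_le (m := 1) (by simp)
  have hL := (contMDiff_leftInvariantField (I := I) (G := G) w).of_le (m := 1) (by simp)
  have h0 := (contMDiff_one_zero_field (I := I) (M := G)).of_le (m := 1) (by simp)
  have h2 : IsManifold I (1 + 1) G := by rw [one_add_one_eq_two]; infer_instance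
  have hd : MDifferentiable (I.prod I) I (fun p : G × G => p.1 * p.2) :=
    (contMDiff_mul I ∞).mdifferentiable (by simp)
  have key : ∀ g : G, _ := fun g =>
    mfderiv_mlieBracket_of_related (f := fun p : G × G => p.1 * p.2) (x := ((1, g) : G × G))
    (V := prodField (rightInvariantField v) (0 : (g : G) → TangentSpace I g))
    (W := prodField (0 : (g : G) → TangentSpace I g) (mulInvariantVectorField w))
    (V' := rightInvariantField v) (W' := mulInvariantVectorField w)
    ((contMDiff_mul I ∞).of_le (m := 2) two_le_infty).contMDiffAt
    ((contMDiff_prodField hR h0).mdifferentiable (by simp) _)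
    ((contMDiff_prodField h0 hL).mdifferentiable (by simp) _)
    (hR.mdifferentiable (by simp) _) (hL.mdifferentiable (by simp) _)
    (.of_forall fun p => by
      refine (mfderiv_prod_eq_add_apply (hd p)).trans ?_
      refine (congrArg (_ + ·) (map_zero (mfderiv I I (fun z => p.1 * z) p.2))).trans ?_
      exact (add_zero _).trans (mfderiv_mul_right_rightInvariantField v p.1 p.2))
    (.of_forall fun p => by
      refine (mfderiv_prod_eq_add_apply (hd p)).trans ?_
      refine (congrArg (· + _) (map_zero (mfderiv I I (fun z => z * p.2) p.1))).trans ?_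
      exact (zero_add _).trans (mfderiv_mul_left_leftInvariantField w p.1 p.2))
  funext g
  have hz : mlieBracket (I.prod I)
      (prodField (rightInvariantField v) (0 : (g : G) → TangentSpace I g))
      (prodField (0 : (g : G) → TangentSpace I g) (mulInvariantVectorField w)) = 0 := by
    rw [mlieBracket_prodField hR h0 h0 hL, mlieBracket_zero_left, mlieBracket_zero_right]
    rfl
  have := key g
  rw [hz] at this
  have h3 : ∀ x, x = g → (mlieBracket I (rightInvariantField v) (mulInvariantVectorField w) x : E)
      = 0 → (mlieBracket I (rightInvariantField v) (mulInvariantVectorField w) g : E) = 0 := by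
    rintro x rfl h; exact h
  exact h3 (1 * g) (one_mul g) (this.symm.trans (map_zero _))

lemma mulInvariantVectorField_adInv (v : GroupLieAlgebra I G) (a : G) :
    mulInvariantVectorField (adInv v a) a = rightInvariantField v a :=
  (mfderiv_chain (E := E) (E' := E) (E'' := E) (I := I) (J := I) (K := I) (x := (1 : G))
    (f := fun x => a⁻¹ * x * a) (g := fun x => a * x) (h := fun x : G => x * a)
    (fun z => by group) (by group)
    (mdifferentiable_leftMul a 1) (mdifferentiable_conj a 1) (v : E)).symm

lemma adInv_one (v : GroupLieAlgebra I G) : adInv v (1 : G) = v := by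
  have : (fun x : G => (1 : G)⁻¹ * x * 1) = id := by funext x; simp
  rw [adInv, this, mfderiv_id]
  rfl

/-- The map `a ↦ Ad(a⁻¹) v`, with values in the model space. -/
def adInvE (v : GroupLieAlgebra I G) (a : G) : E := adInv v a

lemma contMDiff_adInvE (v : GroupLieAlgebra I G) : ContMDiff I 𝓘(ℝ, E) ∞ (adInvE v : G → E) := by
  have h : ContMDiff (I.prod I) I ∞ (fun p : G × G => p.1⁻¹ * p.2 * p.1) :=
    (((contMDiff_fst (I := I) (J := I) (n := ∞) (M := G) (N := G)).inv).mul
      contMDiff_snd).mul contMDiff_fst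
  have h1 : ContMDiff I I.tangent ∞ (fun a : G => (⟨1, (adInvE v a : E)⟩ : TangentBundle I G)) := by
    refine (contMDiff_mfderiv_snd h 1 v).congr fun a => ?_
    have e : (1 : G) = a⁻¹ * 1 * a := by group
    exact totalSpace_mk_eq e _
  intro a
  have h2 := (Bundle.contMDiffAt_totalSpace.1 (h1 a)).2
  refine h2.congr_of_eventuallyEq (.of_forall fun b => ?_)
  have h3 := TangentBundle.continuousLinearMapAt_trivializationAt (I := I) (x := (1 : G))
    (x₀ := (1 : G)) (mem_chart_source H 1)
  have h4 := congrArg (fun T : E →L[ℝ] E => T (adInvE v b)) (h3.trans (mfderiv_extChartAt_self (I := I) (x := (1 : G))))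
  refine Eq.trans h4.symm ?_
  have hb : (1 : G) ∈ (trivializationAt E (TangentSpace I) (1 : G)).baseSet :=
    FiberBundle.mem_baseSet_trivializationAt' (1 : G)
  exact Bundle.Trivialization.continuousLinearMapAt_apply_of_mem (R := ℝ)
    (trivializationAt E (TangentSpace I) (1 : G)) hb (adInvE v b : E)

lemma mlieBracket_sum_smul_right {M : Type*} [TopologicalSpace M] [ChartedSpace H M]
    [IsManifold I ∞ M] {ι : Type*} (s : Finset ι) (V : (x : M) → TangentSpace I x)
    (f : ι → M → ℝ) (W : ι → (x : M) → TangentSpace I x) (x : M)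
    (hf : ∀ i, MDifferentiableAt I 𝓘(ℝ) (f i) x)
    (hW : ∀ i, MDifferentiableAt I I.tangent (fun y => (⟨y, W i y⟩ : TangentBundle I M)) x) :
    (mlieBracket I V (∑ i ∈ s, f i • W i) x : E) =
      ∑ i ∈ s, (mvfderiv I (f i) x (V x) • (W i x : E) + f i x • (mlieBracket I V (W i) x : E)) := by
  have : CompleteSpace E := FiniteDimensional.complete ℝ E
  classical
  have hs : ∀ i, MDifferentiableAt I I.tangent
      (fun y => (⟨y, (f i • W i) y⟩ : TangentBundle I M)) x := fun i =>
    MDifferentiableAt.smul_section (hf i) (hW i)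
  suffices h : MDifferentiableAt I I.tangent
      (fun y => (⟨y, (∑ i ∈ s, f i • W i) y⟩ : TangentBundle I M)) x ∧
      (mlieBracket I V (∑ i ∈ s, f i • W i) x : E) =
      ∑ i ∈ s, (mvfderiv I (f i) x (V x) • (W i x : E) + f i x • (mlieBracket I V (W i) x : E))
      from h.2
  induction s using Finset.induction_on with
  | empty =>
    simp only [Finset.sum_empty]
    refine ⟨(contMDiff_one_zero_field (I := I) (M := M)).mdifferentiable (by simp) x, ?_⟩
    exact congrFun (mlieBracket_zero_right (I := I) (W := V)) x
  | insert i s hi ih =>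
    simp only [Finset.sum_insert hi]
    refine ⟨mdifferentiableAt_add_section (hs i) ih.1, ?_⟩
    refine (mlieBracket_add_right (hs i) ih.1).trans ?_
    exact congrArg₂ (fun a b : E => a + b) (mlieBracket_smul_right (hf i) (hW i)) ih.2

lemma mulInvariantVectorField_injective (a : G) {v w : GroupLieAlgebra I G}
    (h : (mulInvariantVectorField v a : E) = mulInvariantVectorField w a) : v = w := by
  have h1 : ∀ v : GroupLieAlgebra I G,
      (mfderiv I I (fun x => a⁻¹ * x) a (mulInvariantVectorField v a) : E) = v := by
    intro v
    refine (mfderiv_mul_left_leftInvariantField v a⁻¹ a).trans ?_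
    have : ∀ x : G, x = 1 → (mulInvariantVectorField v x : E) = v := by
      rintro x rfl
      have e : (fun x : G => 1 * x) = id := by funext x; simp
      have e2 : mfderiv I I (fun x : G => 1 * x) 1 = mfderiv I I id (1 : G) := by rw [e]
      exact congrArg (fun T : E →L[ℝ] E => T v) (e2.trans mfderiv_id)
    exact this _ (inv_mul_cancel a)
  exact (h1 v).symm.trans ((congrArg (fun u : E =>
    (mfderiv I I (fun x => a⁻¹ * x) a : E →L[ℝ] E) u) h).trans (h1 w))

/-- A right invariant vector field, expanded in a frame of left invariant vector fields. -/
lemma rightInvariantField_eq_sum {ι : Type*} [Fintype ι] (b : Module.Basis ι ℝ E)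
    (v : GroupLieAlgebra I G) :
    rightInvariantField v = ∑ i, (fun a => b.coord i (adInvE v a)) •
      (mulInvariantVectorField (b i : GroupLieAlgebra I G) : (a : G) → TangentSpace I a) := by
  funext a
  refine (mulInvariantVectorField_adInv v a).symm.trans ?_
  refine Eq.trans ?_ (Finset.sum_apply a _ _).symm
  have h1 : (adInvE v a : E) = ∑ i, b.coord i (adInvE v a) • b i := (b.sum_repr _).symm
  refine (congrArg (mfderiv I I (fun x => a * x) (1 : G) : E →L[ℝ] E) h1).trans ?_
  refine (map_sum (mfderiv I I (fun x => a * x) (1 : G) : E →L[ℝ] E) _ _).trans ?_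
  exact Finset.sum_congr rfl fun i _ => map_smul (mfderiv I I (fun x => a * x) (1 : G) : E →L[ℝ] E) _ _

lemma mdifferentiableAt_coord_adInvE {ι : Type*} (b : Module.Basis ι ℝ E)
    (v : GroupLieAlgebra I G) (i : ι) (a : G) :
    MDifferentiableAt I 𝓘(ℝ) (fun a => b.coord i (adInvE v a)) a :=
  ((LinearMap.toContinuousLinearMap (b.coord i)).contMDiff.comp
    (contMDiff_adInvE v)).mdifferentiable (n := ∞) (by simp) a

lemma mvfderiv_clm_comp {M : Type*} [TopologicalSpace M] [ChartedSpace H M]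
    {F F' : Type*} [NormedAddCommGroup F] [NormedSpace ℝ F] [NormedAddCommGroup F']
    [NormedSpace ℝ F'] (L : F →L[ℝ] F') {f : M → F} {x : M} (hf : MDifferentiableAt I 𝓘(ℝ, F) f x)
    (u : TangentSpace I x) :
    mvfderiv I (fun y => L (f y)) x u = L (mvfderiv I f x u) :=
  (mfderiv_comp_apply (I := I) (I' := 𝓘(ℝ, F)) (I'' := 𝓘(ℝ, F')) (g := L) x
    L.mdifferentiableAt hf u).trans
    (congrArg (fun T : F →L[ℝ] F' => T (mvfderiv I f x u)) (L.mfderiv_eq (x := f x)))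

lemma mdifferentiable_adInvE (v : GroupLieAlgebra I G) :
    MDifferentiable I 𝓘(ℝ, E) (adInvE v : G → E) :=
  (contMDiff_adInvE v).mdifferentiable (by simp)

lemma mvfderiv_coord_adInvE {ι : Type*} (b : Module.Basis ι ℝ E)
    (v : GroupLieAlgebra I G) (i : ι) (a : G) (u : TangentSpace I a) :
    mvfderiv I (fun a => b.coord i (adInvE v a)) a u = b.coord i (mvfderiv I (adInvE v) a u) :=
  mvfderiv_clm_comp (LinearMap.toContinuousLinearMap (b.coord i)) (mdifferentiable_adInvE v a) u

lemma mlieBracket_rightInvariantField_right {ι : Type*} [Fintype ι] (b : Module.Basis ι ℝ E)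
    (V : (a : G) → TangentSpace I a) (v : GroupLieAlgebra I G) (a : G) :
    (mlieBracket I V (rightInvariantField v) a : E) =
      ∑ i, (b.coord i (mvfderiv I (adInvE v) a (V a)) •
        (mulInvariantVectorField (b i : GroupLieAlgebra I G) a : E) +
        b.coord i (adInvE v a) •
          (mlieBracket I V (mulInvariantVectorField (b i : GroupLieAlgebra I G)) a : E)) := by
  rw [rightInvariantField_eq_sum b v]
  refine (mlieBracket_sum_smul_right Finset.univ V _ _ a
    (fun i => mdifferentiableAt_coord_adInvE b v i a)
    (fun i => (contMDiff_leftInvariantField _).mdifferentiable (by simp) a)).trans ?_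
  refine Finset.sum_congr rfl fun i _ => ?_
  rw [mvfderiv_coord_adInvE]

/-- The derivative of `a ↦ Ad(a⁻¹) v` along the left invariant vector field `w` is
`-[w, Ad(a⁻¹) v]`. -/
lemma mvfderiv_adInvE (v w : GroupLieAlgebra I G) (a : G) :
    mvfderiv I (adInvE v : G → E) a (mulInvariantVectorField w a) =
      (-⁅w, adInv v a⁆ : GroupLieAlgebra I G) := by
  let b : Module.Basis _ ℝ E := Module.finBasis ℝ E
  let T : E →L[ℝ] E := mfderiv I I (fun x => a * x) (1 : G)
  let B : Fin (Module.finrank ℝ E) → E :=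
    fun i => (⁅w, (b i : GroupLieAlgebra I G)⁆ : GroupLieAlgebra I G)
  let C : E := (⁅w, adInv v a⁆ : GroupLieAlgebra I G)
  set D : E := mvfderiv I (adInvE v : G → E) a (mulInvariantVectorField w a) with hD
  have h0 : (mlieBracket I (mulInvariantVectorField w) (rightInvariantField v) a : E) = 0 := by
    rw [mlieBracket_swap_apply, mlieBracket_right_left]
    exact neg_zero
  rw [mlieBracket_rightInvariantField_right b] at h0
  have h1 : ∀ i, (mlieBracket I (mulInvariantVectorField w)
      (mulInvariantVectorField (b i : GroupLieAlgebra I G)) a : E) =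
      T (B i) := fun i =>
    (congrFun (mulInvariantVector_mlieBracket w (b i : GroupLieAlgebra I G)) a).symm
  have h2 : T (∑ i, (b.coord i D • b i + b.coord i (adInvE v a) • B i)) = T 0 := by
    rw [map_zero, map_sum]
    refine (Finset.sum_congr rfl fun i _ => ?_).trans h0
    rw [map_add, map_smul, map_smul, h1]
    rfl
  have h3 := mulInvariantVectorField_injective a h2
  rw [Finset.sum_add_distrib] at h3
  have h4 : ∑ i, b.coord i D • b i = D := b.sum_repr _
  have h5 : ∑ i, b.coord i (adInvE v a) • B i = C := by
    have e : (adInv v a : GroupLieAlgebra I G) =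
      ∑ i, b.coord i (adInvE v a) • (b i : GroupLieAlgebra I G) := (b.sum_repr _).symm
    refine Eq.trans ?_ (((congrArg (fun u => ⁅w, u⁆) e).trans (lie_sum _ _ _)).symm)
    exact Finset.sum_congr rfl fun i _ => (lie_smul (M := GroupLieAlgebra I G) (b.coord i (adInvE v a)) w
      (b i : GroupLieAlgebra I G)).symm
  rw [h4, h5] at h3
  exact eq_neg_of_add_eq_zero_left h3

/-- The brackets of right invariant vector fields at the identity. -/
lemma mlieBracket_rightInvariantField_one (v w : GroupLieAlgebra I G) :
    mlieBracket I (rightInvariantField v) (rightInvariantField w) (1 : G) = -⁅v, w⁆ := by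
  let b : Module.Basis _ ℝ E := Module.finBasis ℝ E
  have hR : (rightInvariantField v (1 : G) : E) = mulInvariantVectorField v (1 : G) := by
    have e : (fun x : G => x * 1) = (fun x : G => 1 * x) := by funext x; simp
    exact congrArg (fun f : G → G => (mfderiv I I f 1 v : E)) e
  have hone : ∀ u : E, (mulInvariantVectorField (I := I) (G := G) u (1 : G) : E) = u := by
    intro u
    have e : (fun x : G => 1 * x) = id := by funext x; simp
    have e2 : mfderiv I I (fun x : G => 1 * x) 1 = mfderiv I I id (1 : G) := by rw [e]
    exact congrArg (fun T : E →L[ℝ] E => T u) (e2.trans mfderiv_id)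
  refine (mlieBracket_rightInvariantField_right b _ w 1).trans ?_
  have h1 : ∀ i, (mlieBracket I (rightInvariantField v)
      (mulInvariantVectorField (b i : GroupLieAlgebra I G)) (1 : G) : E) = 0 := fun i =>
    congrFun (mlieBracket_right_left v (b i : GroupLieAlgebra I G)) 1
  have h2 : mvfderiv I (adInvE w : G → E) 1 (rightInvariantField v 1) =
      (-⁅v, w⁆ : GroupLieAlgebra I G) := by
    refine (congrArg (mvfderiv I (adInvE w : G → E) 1) hR).trans ?_
    rw [mvfderiv_adInvE, adInv_one]
  simp only [h1, smul_zero, add_zero, hone, h2]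
  exact b.sum_repr _

end LieGroupFields

/-! ### Levi-Civita connections -/

section LeviCivita

open VectorField Filter Topology

variable {E : Type*} [NormedAddCommGroup E] [NormedSpace ℝ E] [FiniteDimensional ℝ E]
  {H : Type*} [TopologicalSpace H] {I : ModelWithCorners ℝ E H}
  {M : Type*} [TopologicalSpace M] [ChartedSpace H M] [IsManifold I ∞ M]
  {g : SmoothMetric I M} {nabla : AffineConnection I M}

lemma IsSmoothField.mdifferentiableAt {X : (x : M) → TangentSpace I x} (hX : IsSmoothField X)
    (x : M) : MDifferentiableAt I I.tangent (fun x => (⟨x, X x⟩ : TangentBundle I M)) x :=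
  ContMDiff.mdifferentiable hX (by simp) x

lemma contMDiff_inner_fields {X Y : (x : M) → TangentSpace I x} (hX : IsSmoothField X)
    (hY : IsSmoothField Y) : ContMDiff I 𝓘(ℝ) ∞ (fun y => g.inner y (X y) (Y y)) := by
  let _ : Bundle.RiemannianBundle (fun x : M => TangentSpace I x) := ⟨g.toRiemannianMetric⟩
  have : ContMDiff I 𝓘(ℝ) ∞ (fun y => inner ℝ (X y) (Y y)) := ContMDiff.inner_bundle hX hY
  exact this

namespace IsLeviCivita

lemma mvfderiv_inner (h : IsLeviCivita g nabla) {X Y : (x : M) → TangentSpace I x}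
    (hX : IsSmoothField X) (hY : IsSmoothField Y) (x : M) (Z : (x : M) → TangentSpace I x) :
    mvfderiv I (fun y => g.inner y (X y) (Y y)) x (Z x) =
      g.inner x (nabla X x (Z x)) (Y x) + g.inner x (X x) (nabla Y x (Z x)) := by
  let _ : Bundle.RiemannianBundle (fun x : M => TangentSpace I x) := ⟨g.toRiemannianMetric⟩
  exact CovariantDerivative.IsMetricCompatible.mvfderiv_inner_eq h.2.1 Z (hX.mdifferentiableAt x)
    (hY.mdifferentiableAt x)

lemma sub_eq_mlieBracket (h : IsLeviCivita g nabla) {X Y : (x : M) → TangentSpace I x}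
    (hX : IsSmoothField X) (hY : IsSmoothField Y) (x : M) :
    nabla Y x (X x) - nabla X x (Y x) = mlieBracket I X Y x :=
  (CovariantDerivative.torsion_eq_zero_iff nabla).1 h.2.2 (hX.mdifferentiableAt x) (hY.mdifferentiableAt x)

lemma isSmoothField (h : IsLeviCivita g nabla) {X Y : (x : M) → TangentSpace I x}
    (hX : IsSmoothField X) (hY : IsSmoothField Y) :
    IsSmoothField (fun y => nabla Y y (X y)) := by
  have h1 := h.1.contMDiff.contMDiff (σ := Y) (ContMDiff.contMDiffOn hY)
  exact ContMDiff.clm_bundle_apply (contMDiffOn_univ.1 h1) hX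

lemma koszul (h : IsLeviCivita g nabla) {X Y Z : (x : M) → TangentSpace I x}
    (hX : IsSmoothField X) (hY : IsSmoothField Y) (hZ : IsSmoothField Z) (x : M) :
    2 * g.inner x (nabla Y x (X x)) (Z x) =
      mvfderiv I (fun y => g.inner y (Y y) (Z y)) x (X x)
      + mvfderiv I (fun y => g.inner y (X y) (Z y)) x (Y x)
      - mvfderiv I (fun y => g.inner y (X y) (Y y)) x (Z x)
      + g.inner x (mlieBracket I X Y x) (Z x) - g.inner x (mlieBracket I X Z x) (Y x)
      - g.inner x (mlieBracket I Y Z x) (X x) := by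
  rw [h.mvfderiv_inner hY hZ x X, h.mvfderiv_inner hX hZ x Y, h.mvfderiv_inner hX hY x Z,
    ← h.sub_eq_mlieBracket hX hY, ← h.sub_eq_mlieBracket hX hZ, ← h.sub_eq_mlieBracket hY hZ]
  simp only [map_sub, _root_.sub_apply]
  rw [g.symm x (X x) (nabla Z x (Y x)), g.symm x (X x) (nabla Y x (Z x)),
    g.symm x (Y x) (nabla Z x (X x))]
  ring

end IsLeviCivita

end LeviCivita

/-! ### The Ricci curvature of an invariant metric on a homogeneous space -/

section HomogeneousRicci

open VectorField Filter Topology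

variable {E : Type*} [NormedAddCommGroup E] [NormedSpace ℝ E] [FiniteDimensional ℝ E]
  {H : Type*} [TopologicalSpace H] {I : ModelWithCorners ℝ E H} [I.Boundaryless]
  {G : Type*} [TopologicalSpace G] [ChartedSpace H G] [Group G] [LieGroup I ∞ G]
  {E' : Type*} [NormedAddCommGroup E'] [NormedSpace ℝ E'] [FiniteDimensional ℝ E']
  {H' : Type*} [TopologicalSpace H'] {J : ModelWithCorners ℝ E' H'} [J.Boundaryless]
  {M : Type*} [TopologicalSpace M] [ChartedSpace H' M] [IsManifold J ∞ M]

/-- The vector field `V` on `G` is mapped to the vector field `W` on `M` by `p`. -/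
def FieldRelated (I : ModelWithCorners ℝ E H) (J : ModelWithCorners ℝ E' H') (p : G → M)
    (V : (a : G) → TangentSpace I a) (W : (x : M) → TangentSpace J x) : Prop :=
  ∀ a, (mfderiv I J p a (V a) : E') = W (p a)

/-- The bracket of the Lie algebra of `G` as a continuous linear map in the second variable. -/
def lieCLM (X : GroupLieAlgebra I G) : E →L[ℝ] E :=
  LinearMap.toContinuousLinearMap (LieAlgebra.ad ℝ (GroupLieAlgebra I G) X : E →ₗ[ℝ] E)

lemma lieCLM_swap (X Y : GroupLieAlgebra I G) : (lieCLM X (Y : E) : E) = -lieCLM Y (X : E) :=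
  (lie_skew X Y).symm

lemma lieCLM_self (X : GroupLieAlgebra I G) : (lieCLM X (X : E) : E) = 0 := lie_self X

lemma mvfderiv_bilin (β : E →L[ℝ] E →L[ℝ] ℝ) {u v : G → E} {a : G}
    (hu : MDifferentiableAt I 𝓘(ℝ, E) u a) (hv : MDifferentiableAt I 𝓘(ℝ, E) v a)
    (w : TangentSpace I a) :
    mvfderiv I (fun a : G => β (u a) (v a)) a w =
      β (mvfderiv I u a w) (v a) + β (u a) (mvfderiv I v a w) := by
  have h3 := β.hasFDerivWithinAt_of_bilinear hu.hasMFDerivAt.2 hv.hasMFDerivAt.2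
  have hc : ContinuousAt (fun a : G => β (u a) (v a)) a :=
    ((β.continuous.continuousAt).comp hu.continuousAt).clm_apply hv.continuousAt
  have h4 : HasMFDerivAt I 𝓘(ℝ) (fun a : G => β (u a) (v a)) a _ := ⟨hc, h3⟩
  have e : ∀ f : G → E, (writtenInExtChartAt I 𝓘(ℝ, E) a f) ((extChartAt I a) a) = f a := by
    intro f
    simp [writtenInExtChartAt]
    rfl
  refine (congrArg (fun T : E →L[ℝ] ℝ => T w) h4.mfderiv).trans ?_
  simp only [e, ContinuousLinearMap.precompR_apply]
  exact add_comm _ _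

lemma mvfderiv_adInvE_bilin (β : E →L[ℝ] E →L[ℝ] ℝ) (U V W : GroupLieAlgebra I G) (a : G) :
    mvfderiv I (fun a : G => β (adInvE U a) (adInvE V a)) a (mulInvariantVectorField W a) =
      -β (lieCLM W (adInvE U a)) (adInvE V a) - β (adInvE U a) (lieCLM W (adInvE V a)) := by
  have h1 : ∀ U : GroupLieAlgebra I G,
      (mvfderiv I (adInvE U : G → E) a (mulInvariantVectorField W a) : E) =
      -(lieCLM W (adInvE U a) : E) := fun U => mvfderiv_adInvE U W a
  refine (mvfderiv_bilin β (mdifferentiable_adInvE U a) (mdifferentiable_adInvE V a) _).trans ?_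
  rw [h1, h1]
  simp only [map_neg, _root_.neg_apply]
  ring

lemma mvfderiv_adInvE_linear (ℓ : E →L[ℝ] ℝ) (V W : GroupLieAlgebra I G) (a : G) :
    mvfderiv I (fun a : G => ℓ (adInvE V a)) a (mulInvariantVectorField W a) =
      -ℓ (lieCLM W (adInvE V a)) :=
  (mvfderiv_clm_comp ℓ (mdifferentiable_adInvE V a) _).trans
    ((congrArg ℓ (mvfderiv_adInvE V W a)).trans (map_neg ℓ _))

lemma mvfderiv_pullback {p : G → M} (hp : ContMDiff I J ∞ p) {F : M → ℝ}
    (hF : ContMDiff J 𝓘(ℝ) ∞ F) (a : G) (v : TangentSpace I a) (w : TangentSpace J (p a))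
    (h : (mfderiv I J p a v : E') = w) {f : G → ℝ} (hf : ∀ a, F (p a) = f a) :
    mvfderiv J F (p a) w = mvfderiv I f a v := by
  obtain rfl : f = F ∘ p := (funext hf).symm
  refine Eq.trans ?_ (mvfderiv_comp_apply a (hF.mdifferentiable (by simp) _)
    (hp.mdifferentiable (by simp) a) v).symm
  exact congrArg (mvfderiv J F (p a)) h.symm

section orthonormal

variable {F : Type*} [AddCommGroup F] [Module ℝ F] {ι : Type*} [Fintype ι] [DecidableEq ι]
  (B : F →ₗ[ℝ] F →ₗ[ℝ] ℝ) (b : Module.Basis ι ℝ F)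

lemma repr_eq_of_orthonormal (hb : ∀ i j, B (b i) (b j) = if i = j then 1 else 0) (v : F) (i : ι) :
    b.repr v i = B v (b i) := by
  conv_rhs => rw [← b.sum_repr v, map_sum, LinearMap.sum_apply]
  simp [hb]

lemma bilin_eq_sum_of_orthonormal (hb : ∀ i j, B (b i) (b j) = if i = j then 1 else 0) (v w : F) :
    B v w = ∑ i, B v (b i) * B w (b i) := by
  conv_lhs => rw [← b.sum_repr w]
  simp only [map_sum, map_smul, smul_eq_mul, repr_eq_of_orthonormal B b hb]
  exact Finset.sum_congr rfl fun i _ => mul_comm _ _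

lemma trace_eq_sum_of_orthonormal (hb : ∀ i j, B (b i) (b j) = if i = j then 1 else 0)
    (f : F →ₗ[ℝ] F) : LinearMap.trace ℝ F f = ∑ i, B (f (b i)) (b i) := by
  rw [LinearMap.trace_eq_matrix_trace ℝ b, Matrix.trace]
  simp [LinearMap.toMatrix_apply, repr_eq_of_orthonormal B b hb]

end orthonormal

/-- The map `p : G → M` behaves like an orbit map for a Lie group of isometries: right invariant
fields on `G` descend to fields `K` on `M`, and the pull-back of the metric is left invariant. -/
structure IsOrbitMap (g : SmoothMetric J M) (p : G → M) (q : E →L[ℝ] E →L[ℝ] ℝ)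
    (K : GroupLieAlgebra I G → (x : M) → TangentSpace J x) : Prop where
  smooth : ContMDiff I J ∞ p
  inner_eq : ∀ (a : G) (U V : GroupLieAlgebra I G),
    g.inner (p a) (mfderiv I J p a (mulInvariantVectorField U a))
      (mfderiv I J p a (mulInvariantVectorField V a)) = q U V
  smooth_killing : ∀ U, IsSmoothField (K U)
  related : ∀ U, FieldRelated I J p (rightInvariantField U) (K U)

variable {g : SmoothMetric J M} {p : G → M} {q : E →L[ℝ] E →L[ℝ] ℝ}
  {K : GroupLieAlgebra I G → (x : M) → TangentSpace J x} {nabla : AffineConnection J M}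
  {X Y : GroupLieAlgebra I G} {BX BY : (x : M) → TangentSpace J x}

lemma FieldRelated.mlieBracket {V V' : (a : G) → TangentSpace I a}
    {W W' : (x : M) → TangentSpace J x} (hp : ContMDiff I J ∞ p)
    (h : FieldRelated I J p V W) (h' : FieldRelated I J p V' W')
    (hV : IsSmoothField V) (hV' : IsSmoothField V') (hW : IsSmoothField W)
    (hW' : IsSmoothField W') :
    FieldRelated I J p (VectorField.mlieBracket I V V') (VectorField.mlieBracket J W W') := by
  have : CompleteSpace E := FiniteDimensional.complete ℝ E
  have : CompleteSpace E' := FiniteDimensional.complete ℝ E'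
  exact fun a => mfderiv_mlieBracket_of_related (hp.of_le two_le_infty).contMDiffAt
    (hV.mdifferentiableAt a) (hV'.mdifferentiableAt a) (hW.mdifferentiableAt _)
    (hW'.mdifferentiableAt _) (.of_forall h) (.of_forall h')

namespace IsOrbitMap

lemma killing_apply (h : IsOrbitMap g p q K) (U : GroupLieAlgebra I G) (a : G) :
    K U (p a) = (mfderiv I J p a (mulInvariantVectorField (adInv U a) a) : E') :=
  (h.related U a).symm.trans (congrArg (fun v : E => (mfderiv I J p a v : E'))
    (mulInvariantVectorField_adInv U a).symm)

lemma mlieBracket_killing_field (h : IsOrbitMap g p q K) (U : GroupLieAlgebra I G)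
    (hBX : IsSmoothField BX) (hX : FieldRelated I J p (mulInvariantVectorField X) BX) (a : G) :
    VectorField.mlieBracket J (K U) BX (p a) = 0 := by
  have h1 := (h.related U).mlieBracket h.smooth hX (contMDiff_rightInvariantField U)
    (contMDiff_leftInvariantField X) (h.smooth_killing U) hBX a
  refine h1.symm.trans ?_
  rw [mlieBracket_right_left]
  exact map_zero (mfderiv I J p a)

lemma mlieBracket_killing_one (h : IsOrbitMap g p q K) (U V : GroupLieAlgebra I G) :
    VectorField.mlieBracket J (K U) (K V) (p 1) =
      -(mfderiv I J p 1 (⁅U, V⁆ : GroupLieAlgebra I G) : E') := by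
  have h1 := (h.related U).mlieBracket h.smooth (h.related V) (contMDiff_rightInvariantField U)
    (contMDiff_rightInvariantField V) (h.smooth_killing U) (h.smooth_killing V) 1
  refine h1.symm.trans ?_
  rw [mlieBracket_rightInvariantField_one]
  exact map_neg (mfderiv I J p 1) _

lemma mlieBracket_field_field (h : IsOrbitMap g p q K)
    (hBX : IsSmoothField BX) (hX : FieldRelated I J p (mulInvariantVectorField X) BX)
    (hBY : IsSmoothField BY) (hY : FieldRelated I J p (mulInvariantVectorField Y) BY) (a : G) :
    VectorField.mlieBracket J BX BY (p a) =
      (mfderiv I J p a (mulInvariantVectorField ⁅X, Y⁆ a) : E') := by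
  have h1 := hX.mlieBracket h.smooth hY (contMDiff_leftInvariantField X)
    (contMDiff_leftInvariantField Y) hBX hBY a
  refine h1.symm.trans ?_
  exact congrArg (fun v : E => (mfderiv I J p a v : E'))
    (congrFun (mulInvariantVector_mlieBracket X Y) a).symm

lemma inner_killing_killing (h : IsOrbitMap g p q K) (U V : GroupLieAlgebra I G) (a : G) :
    g.inner (p a) (K U (p a)) (K V (p a)) = q (adInvE U a) (adInvE V a) := by
  rw [h.killing_apply U a, h.killing_apply V a]
  exact h.inner_eq a _ _

lemma inner_field_killing (h : IsOrbitMap g p q K)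
    (hX : FieldRelated I J p (mulInvariantVectorField X) BX) (V : GroupLieAlgebra I G) (a : G) :
    g.inner (p a) (BX (p a)) (K V (p a)) = q X (adInvE V a) := by
  rw [← hX a, h.killing_apply V a]
  exact h.inner_eq a _ _

lemma inner_field_field (h : IsOrbitMap g p q K)
    (hX : FieldRelated I J p (mulInvariantVectorField X) BX)
    (hY : FieldRelated I J p (mulInvariantVectorField Y) BY) (a : G) :
    g.inner (p a) (BX (p a)) (BY (p a)) = q X Y := by
  rw [← hX a, ← hY a]
  exact h.inner_eq a _ _

/-- The derivative of `⟨B_X, B_X'⟩` type functions: pull back to `G` and differentiate there. -/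
lemma mvfderiv_bilin_killing (h : IsOrbitMap g p q K) {F : M → ℝ} (hF : ContMDiff J 𝓘(ℝ) ∞ F)
    (β : E →L[ℝ] E →L[ℝ] ℝ) {U V : GroupLieAlgebra I G}
    (hβ : ∀ a : G, F (p a) = β (adInvE U a) (adInvE V a)) (W : GroupLieAlgebra I G) (a : G)
    (w : TangentSpace J (p a)) (hw : (mfderiv I J p a (mulInvariantVectorField W a) : E') = w) :
    mvfderiv J F (p a) w =
      -β (lieCLM W (adInvE U a)) (adInvE V a) - β (adInvE U a) (lieCLM W (adInvE V a)) :=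
  (mvfderiv_pullback h.smooth hF a _ w hw hβ).trans (mvfderiv_adInvE_bilin β U V W a)

lemma mvfderiv_linear_killing (h : IsOrbitMap g p q K) {F : M → ℝ} (hF : ContMDiff J 𝓘(ℝ) ∞ F)
    (ℓ : E →L[ℝ] ℝ) {V : GroupLieAlgebra I G} (hℓ : ∀ a : G, F (p a) = ℓ (adInvE V a))
    (W : GroupLieAlgebra I G) (a : G)
    (w : TangentSpace J (p a)) (hw : (mfderiv I J p a (mulInvariantVectorField W a) : E') = w) :
    mvfderiv J F (p a) w = -ℓ (lieCLM W (adInvE V a)) :=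
  (mvfderiv_pullback h.smooth hF a _ w hw hℓ).trans (mvfderiv_adInvE_linear ℓ V W a)

lemma mvfderiv_const_killing (h : IsOrbitMap g p q K) {F : M → ℝ} (hF : ContMDiff J 𝓘(ℝ) ∞ F)
    (c : ℝ) (hc : ∀ a : G, F (p a) = c) (W : GroupLieAlgebra I G) (a : G)
    (w : TangentSpace J (p a)) (hw : (mfderiv I J p a (mulInvariantVectorField W a) : E') = w) :
    mvfderiv J F (p a) w = 0 := by
  refine (mvfderiv_pullback h.smooth hF a _ w hw hc).trans ?_
  rw [mvfderiv_const]
  rfl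

lemma killing_apply_one (h : IsOrbitMap g p q K) (U : GroupLieAlgebra I G) :
    (mfderiv I J p 1 (mulInvariantVectorField U (1 : G)) : E') = K U (p 1) := by
  rw [h.killing_apply U 1, adInv_one]

lemma mfderiv_one (p : G → M) (U : GroupLieAlgebra I G) :
    (mfderiv I J p 1 (mulInvariantVectorField U (1 : G)) : E') = mfderiv I J p 1 U := by
  have e : (fun x : G => 1 * x) = id := by funext x; simp
  have e2 : mfderiv I I (fun x : G => 1 * x) 1 = mfderiv I I id (1 : G) := by rw [e]
  exact congrArg (fun T : E →L[ℝ] E => (mfderiv I J p 1 (T U) : E')) (e2.trans mfderiv_id)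

lemma killing_apply_one' (h : IsOrbitMap g p q K) (U : GroupLieAlgebra I G) :
    (mfderiv I J p 1 U : E') = K U (p 1) :=
  (mfderiv_one p U).symm.trans (h.killing_apply_one U)

lemma inner_one (h : IsOrbitMap g p q K) (U V : GroupLieAlgebra I G) :
    g.inner (p 1) (mfderiv I J p 1 U) (mfderiv I J p 1 V) = q U V := by
  rw [← h.inner_eq 1 U V, mfderiv_one p U, mfderiv_one p V]

lemma symm_apply (h : IsOrbitMap g p q K) (U V : E) : q U V = q V U :=
  (h.inner_one U V).symm.trans ((g.symm _ _ _).trans (h.inner_one V U))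

lemma field_one (hX : FieldRelated I J p (mulInvariantVectorField X) BX) :
    (mfderiv I J p 1 X : E') = BX (p 1) :=
  (mfderiv_one p X).symm.trans (hX 1)

lemma adInvE_one (U : GroupLieAlgebra I G) : (adInvE U (1 : G) : E) = U := adInv_one U

/-- The endomorphism `u ↦ ∇_u B_X` at the base point. -/
lemma two_mul_inner_nabla_field (h : IsOrbitMap g p q K) (hg : IsLeviCivita g nabla)
    (hBX : IsSmoothField BX) (hX : FieldRelated I J p (mulInvariantVectorField X) BX)
    (U V : GroupLieAlgebra I G) :
    2 * g.inner (p 1) (nabla BX (p 1) (K U (p 1))) (K V (p 1)) =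
      -q (lieCLM X U) V - q U (lieCLM X V) - q X (lieCLM U V) := by
  have hU := h.smooth_killing U
  have hV := h.smooth_killing V
  rw [hg.koszul hU hBX hV]
  rw [h.mvfderiv_linear_killing (contMDiff_inner_fields hBX hV) (q X)
    (fun a => h.inner_field_killing hX V a) U 1 _ (h.killing_apply_one U)]
  rw [h.mvfderiv_bilin_killing (contMDiff_inner_fields hU hV) q
    (fun a => h.inner_killing_killing U V a) X 1 _ (hX 1)]
  rw [h.mvfderiv_linear_killing (contMDiff_inner_fields hU hBX) (q X)
    (fun a => (g.symm _ _ _).trans (h.inner_field_killing hX U a)) V 1 _ (h.killing_apply_one V)]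
  rw [h.mlieBracket_killing_field U hBX hX, h.mlieBracket_killing_one,
    mlieBracket_swap_apply, h.mlieBracket_killing_field V hBX hX]
  have e1 : g.inner (p 1) (-(mfderiv I J p 1 (⁅U, V⁆ : GroupLieAlgebra I G) : E')) (BX (p 1)) =
      - q X (lieCLM U V) := by
    rw [← field_one hX]
    refine (congrArg (fun T : E' →L[ℝ] ℝ => T (mfderiv I J p 1 X : E'))
      (map_neg (g.inner (p 1)) _)).trans ?_
    exact congrArg Neg.neg ((h.inner_one _ _).trans (h.symm_apply _ _))
  rw [e1]
  have e2 : q X (lieCLM V U) = -q X (lieCLM U V) := by rw [lieCLM_swap, map_neg]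
  simp only [adInvE_one, e2, map_zero, neg_zero, _root_.zero_apply]
  ring

lemma two_mul_inner_nabla_field_field (h : IsOrbitMap g p q K) (hg : IsLeviCivita g nabla)
    (hBX : IsSmoothField BX) (hX : FieldRelated I J p (mulInvariantVectorField X) BX)
    (hBY : IsSmoothField BY) (hY : FieldRelated I J p (mulInvariantVectorField Y) BY)
    (V : GroupLieAlgebra I G) (a : G) :
    2 * g.inner (p a) (nabla BY (p a) (BX (p a))) (K V (p a)) =
      -q Y (lieCLM X (adInvE V a)) - q X (lieCLM Y (adInvE V a))
        + q (lieCLM X Y) (adInvE V a) := by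
  have hV := h.smooth_killing V
  rw [hg.koszul hBX hBY hV]
  rw [h.mvfderiv_linear_killing (contMDiff_inner_fields hBY hV) (q Y)
    (fun a => h.inner_field_killing hY V a) X a _ (hX a)]
  rw [h.mvfderiv_linear_killing (contMDiff_inner_fields hBX hV) (q X)
    (fun a => h.inner_field_killing hX V a) Y a _ (hY a)]
  rw [h.mvfderiv_const_killing (contMDiff_inner_fields hBX hBY) (q X Y)
    (fun a => h.inner_field_field hX hY a) (adInv V a) a _ (h.killing_apply V a).symm]
  rw [mlieBracket_swap_apply (V := BX) (W := K V), h.mlieBracket_killing_field V hBX hX,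
    mlieBracket_swap_apply (V := BY) (W := K V), h.mlieBracket_killing_field V hBY hY,
    h.mlieBracket_field_field hBX hX hBY hY, h.killing_apply V a]
  have e1 : g.inner (p a) (mfderiv I J p a (mulInvariantVectorField ⁅X, Y⁆ a))
      (mfderiv I J p a (mulInvariantVectorField (adInv V a) a)) = q (lieCLM X Y) (adInvE V a) :=
    h.inner_eq a _ _
  refine (congrArg (fun t => _ + t - _ - _) e1).trans ?_
  simp only [map_zero, neg_zero, _root_.zero_apply]
  ring

lemma inner_nabla_killing_right (h : IsOrbitMap g p q K) (hg : IsLeviCivita g nabla)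
    (hBY : IsSmoothField BY) (hY : FieldRelated I J p (mulInvariantVectorField Y) BY)
    (U : GroupLieAlgebra I G) (a : G) :
    g.inner (p a) (nabla BY (p a) (K U (p a))) (K U (p a)) =
      -q (lieCLM Y (adInvE U a)) (adInvE U a) := by
  have hU := h.smooth_killing U
  have h1 := hg.sub_eq_mlieBracket hU hBY (p a)
  rw [h.mlieBracket_killing_field U hBY hY, sub_eq_zero] at h1
  have h2 := hg.mvfderiv_inner hU hU (p a) BY
  rw [h.mvfderiv_bilin_killing (contMDiff_inner_fields hU hU) q
    (fun a => h.inner_killing_killing U U a) Y a _ (hY a), ← h1, g.symm _ (K U (p a))] at h2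
  have h3 := h.symm_apply (lieCLM Y (adInvE U a)) (adInvE U a)
  linarith

lemma inner_nabla_killing_killing (h : IsOrbitMap g p q K) (hg : IsLeviCivita g nabla)
    (U W : GroupLieAlgebra I G) :
    g.inner (p 1) (nabla (K U) (p 1) (K U (p 1))) (K W (p 1)) = q (lieCLM W U) U := by
  have hU := h.smooth_killing U
  have hW := h.smooth_killing W
  have h1 := hg.koszul hU hU hW (p 1)
  rw [h.mvfderiv_bilin_killing (contMDiff_inner_fields hU hW) q
    (fun a => h.inner_killing_killing U W a) U 1 _ (h.killing_apply_one U),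
    h.mvfderiv_bilin_killing (contMDiff_inner_fields hU hU) q
    (fun a => h.inner_killing_killing U U a) W 1 _ (h.killing_apply_one W),
    h.mlieBracket_killing_one, h.mlieBracket_killing_one] at h1
  have e1 : g.inner (p 1) (-(mfderiv I J p 1 (⁅U, W⁆ : GroupLieAlgebra I G) : E')) (K U (p 1)) =
      - q (lieCLM U W) U := by
    rw [← h.killing_apply_one']
    refine (congrArg (fun T : E' →L[ℝ] ℝ => T (mfderiv I J p 1 U : E'))
      (map_neg (g.inner (p 1)) _)).trans ?_
    exact congrArg Neg.neg (h.inner_one _ _)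
  have e3 : g.inner (p 1) (-(mfderiv I J p 1 (⁅U, U⁆ : GroupLieAlgebra I G) : E')) (K W (p 1)) =
      0 := by
    rw [lie_self]
    refine (congrArg (fun u : E' => g.inner (p 1) (-u) (K W (p 1)))
      (map_zero (mfderiv I J p 1))).trans ?_
    refine (congrArg (fun u : E' => g.inner (p 1) u (K W (p 1))) neg_zero).trans ?_
    exact congrArg (fun T : E' →L[ℝ] ℝ => T (K W (p 1))) (map_zero (g.inner (p 1)))
  rw [e1, e3] at h1
  have k1 : q (lieCLM U U) W = 0 :=
    (congrArg (fun T : E => q T W) (lieCLM_self U)).trans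
      (congrArg (fun T : E →L[ℝ] ℝ => T W) (map_zero q))
  have k3 : q (lieCLM W U) U = -q (lieCLM U W) U :=
    (congrArg (fun T : E => q T U) (lieCLM_swap W U)).trans
      (congrArg (fun T : E →L[ℝ] ℝ => T U) (map_neg q _))
  have k4 := h.symm_apply U (lieCLM U W)
  have k5 := h.symm_apply U (lieCLM W U)
  simp only [adInvE_one] at h1
  linarith

lemma inner_curvature (h : IsOrbitMap g p q K) (hg : IsLeviCivita g nabla)
    (hBX : IsSmoothField BX) (hX : FieldRelated I J p (mulInvariantVectorField X) BX)
    (hBY : IsSmoothField BY) (hY : FieldRelated I J p (mulInvariantVectorField Y) BY)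
    (U W : GroupLieAlgebra I G) (hW : (mfderiv I J p 1 W : E') = nabla BY (p 1) (BX (p 1))) :
    g.inner (p 1) (curvature nabla (K U) BX BY (p 1)) (K U (p 1)) =
      -q (lieCLM W U) U - q (lieCLM Y (lieCLM X U)) U - q (lieCLM Y U) (lieCLM X U)
        + g.inner (p 1) (nabla BY (p 1) (K U (p 1))) (nabla BX (p 1) (K U (p 1))) := by
  have hU := h.smooth_killing U
  have hZ : IsSmoothField (fun y => nabla BY y (BX y)) := hg.isSmoothField hBX hBY
  have hT : IsSmoothField (fun y => nabla BY y (K U y)) := hg.isSmoothField hU hBY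
  -- the derivative of `⟨∇_X Y, K_U⟩` in the direction of `K_U` vanishes
  have h1 := hg.mvfderiv_inner hZ hU (p 1) (K U)
  let ℓ : E →L[ℝ] ℝ := (2⁻¹ : ℝ) • (-(q Y).comp (lieCLM X) - (q X).comp (lieCLM Y) + q (lieCLM X Y))
  have hℓ : ∀ a : G, g.inner (p a) (nabla BY (p a) (BX (p a))) (K U (p a)) = ℓ (adInvE U a) := by
    intro a
    have := h.two_mul_inner_nabla_field_field hg hBX hX hBY hY U a
    change _ = 2⁻¹ * (-q Y (lieCLM X (adInvE U a)) - q X (lieCLM Y (adInvE U a))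
      + q (lieCLM X Y) (adInvE U a))
    linarith
  rw [h.mvfderiv_linear_killing (contMDiff_inner_fields hZ hU) ℓ hℓ U 1 _ (h.killing_apply_one U),
    adInvE_one, lieCLM_self, map_zero, neg_zero] at h1
  have h2 := h.inner_nabla_killing_killing hg U W
  have hKW : nabla BY (p 1) (BX (p 1)) = K W (p 1) := hW.symm.trans (h.killing_apply_one' W)
  have h3 := g.symm (p 1) (nabla (K U) (p 1) (K U (p 1))) (K W (p 1))
  -- the derivative of `⟨∇_{K_U} Y, K_U⟩` in the direction of `X`
  have h4 := hg.mvfderiv_inner hT hU (p 1) BX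
  have h5 := h.mvfderiv_bilin_killing (contMDiff_inner_fields hT hU) (-(q.comp (lieCLM Y)))
    (fun a => h.inner_nabla_killing_right hg hBY hY U a) X 1 _ (hX 1)
  have h6 := hg.sub_eq_mlieBracket hU hBX (p 1)
  rw [h.mlieBracket_killing_field U hBX hX, sub_eq_zero] at h6
  have h7 : VectorField.mlieBracket J (K U) BX (p 1) = 0 := h.mlieBracket_killing_field U hBX hX 1
  rw [curvature, h7, map_zero, sub_zero, map_sub, _root_.sub_apply]
  rw [hKW] at h1
  rw [adInvE_one] at h5
  change _ = - -q (lieCLM Y (lieCLM X U)) U - -q (lieCLM Y U) (lieCLM X U) at h5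
  rw [← h6] at h4
  linarith

theorem ricci_eq (h : IsOrbitMap g p q K) (hg : IsLeviCivita g nabla)
    {R : (x : M) → TangentSpace J x →ₗ[ℝ] TangentSpace J x →ₗ[ℝ] TangentSpace J x →ₗ[ℝ]
      TangentSpace J x} (hR : IsCurvatureTensor nabla R)
    (hBX : IsSmoothField BX) (hX : FieldRelated I J p (mulInvariantVectorField X) BX)
    (hBY : IsSmoothField BY) (hY : FieldRelated I J p (mulInvariantVectorField Y) BY)
    {ι : Type*} [Fintype ι] [DecidableEq ι] (U : ι → E) (b : Module.Basis ι ℝ E')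
    (hU : ∀ i, mfderiv I J p 1 (U i) = b i) (hq : ∀ i j, q (U i) (U j) = if i = j then 1 else 0) :
    ∃ W : E, (∀ V : E, 2 * q W V =
        -q Y (lieCLM X V) - q X (lieCLM Y V) + q (lieCLM X Y) V) ∧
      ricci (R (p 1)) (BX (p 1)) (BY (p 1)) =
        ∑ i, (-q (lieCLM (I := I) (G := G) W (U i)) (U i) - q (lieCLM Y (lieCLM X (U i))) (U i)
          - q (lieCLM Y (U i)) (lieCLM X (U i))
          + ∑ j, ((-q (lieCLM X (U i)) (U j) - q (U i) (lieCLM X (U j))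
              - q X (lieCLM (I := I) (G := G) (U i) (U j))) / 2) *
            ((-q (lieCLM Y (U i)) (U j) - q (U i) (lieCLM Y (U j))
              - q Y (lieCLM (I := I) (G := G) (U i) (U j))) / 2)) := by
  let T : E →L[ℝ] E' := mfderiv I J p 1
  have hTU : ∀ i, T (U i) = b i := hU
  let Z : E' := nabla BY (p 1) (BX (p 1))
  let B : E' →ₗ[ℝ] E' →ₗ[ℝ] ℝ := (g.inner (p 1)).toBilinForm
  have hBq : ∀ u v : E, B (T u) (T v) = q u v := fun u v => h.inner_one u v
  have hB : ∀ i j, B (b i) (b j) = if i = j then 1 else 0 := fun i j => by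
    rw [← hTU, ← hTU, hBq, hq]
  have hKb : ∀ i, K (U i) (p 1) = b i := fun i => (h.killing_apply_one' (U i)).symm.trans (hU i)
  let W : E := ∑ i, b.repr Z i • U i
  have hTW : T W = Z := by
    rw [map_sum]
    simp only [map_smul, hTU]
    exact b.sum_repr Z
  refine ⟨W, fun V => ?_, ?_⟩
  · have h1 := h.two_mul_inner_nabla_field_field hg hBX hX hBY hY V 1
    have h2 := h1.trans (congrArg (fun v : E => -q Y (lieCLM X v) - q X (lieCLM Y v)
      + q (lieCLM X Y) v) (adInvE_one (I := I) (G := G) V))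
    rw [← h2, ← hBq, hTW]
    exact congrArg (fun v : E' => 2 * B Z v) (h.killing_apply_one' V)
  · refine (trace_eq_sum_of_orthonormal B b hB _).trans (Finset.sum_congr rfl fun i _ => ?_)
    have h1 := h.inner_curvature hg hBX hX hBY hY (U i) W hTW
    replace h1 := (congrArg (fun c : E' => g.inner (p 1) c (K (U i) (p 1)))
      (hR (K (U i)) BX BY (h.smooth_killing _) hBX hBY (p 1))).trans h1
    have h2 : B (((R (p 1)).flip (BX (p 1))).flip (BY (p 1)) (b i)) (b i) =
      g.inner (p 1) (R (p 1) (K (U i) (p 1)) (BX (p 1)) (BY (p 1))) (K (U i) (p 1)) :=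
      congrArg (fun v : E' => g.inner (p 1) (R (p 1) v (BX (p 1)) (BY (p 1))) v) (hKb i).symm
    refine (h2.trans h1).trans ?_
    congr 1
    have h3 := bilin_eq_sum_of_orthonormal B b hB (nabla BY (p 1) (K (U i) (p 1)) : E')
      (nabla BX (p 1) (K (U i) (p 1)) : E')
    refine h3.trans (Finset.sum_congr rfl fun j _ => ?_)
    have h4 := h.two_mul_inner_nabla_field hg hBX hX (U i) (U j)
    have h5 := h.two_mul_inner_nabla_field hg hBY hY (U i) (U j)
    have h6 : ∀ v : E', B v (b j) = g.inner (p 1) v (K (U j) (p 1)) :=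
      fun v => congrArg (fun u : E' => B v u) (hKb j).symm
    exact (congrArg₂ (fun s t : ℝ => s * t)
      ((h6 _).trans ((eq_div_iff two_ne_zero).2 ((mul_comm _ _).trans h5)))
      ((h6 _).trans ((eq_div_iff two_ne_zero).2 ((mul_comm _ _).trans h4)))).trans (mul_comm _ _)

end IsOrbitMap

end HomogeneousRicci

/-! ### Traces and degenerate inner products -/

section DegenerateForms

variable {V : Type*} [AddCommGroup V] [Module ℝ V] [FiniteDimensional ℝ V]
  {ι : Type*} [Fintype ι]

/-- If `q` has radical `h` and `U` is an orthonormal basis of `V` modulo `h`, then the trace of a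
map preserving `h` is the sum of its trace on `h` and its trace modulo `h`. -/
lemma trace_eq_trace_restrict_add (q : V →ₗ[ℝ] V →ₗ[ℝ] ℝ) (h : Submodule ℝ V) (U : ι → V)
    (hq : ∀ x ∈ h, ∀ y, q x y = 0) (hU : ∀ v, v - ∑ i, q v (U i) • U i ∈ h)
    (f : V →ₗ[ℝ] V) (hf : ∀ x ∈ h, f x ∈ h) :
    LinearMap.trace ℝ V f = LinearMap.trace ℝ h (f.restrict hf) + ∑ i, q (f (U i)) (U i) := by
  let ℓ : ι → V →ₗ[ℝ] ℝ := fun i => q.flip (U i)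
  let P : V →ₗ[ℝ] V := ∑ i, (ℓ i).smulRight (U i)
  have hP : ∀ v, P v = ∑ i, q v (U i) • U i := fun v => by
    simp [P, ℓ, LinearMap.sum_apply]
  let Q : V →ₗ[ℝ] h := (LinearMap.id - P).codRestrict h fun v => by
    simpa [hP] using hU v
  have h1 : f = f ∘ₗ P + h.subtype ∘ₗ ((f.restrict hf) ∘ₗ Q) := by
    ext v
    simp [Q]
  have h2 : LinearMap.trace ℝ V (f ∘ₗ P) = ∑ i, q (f (U i)) (U i) := by
    have : f ∘ₗ P = ∑ i, (ℓ i).smulRight (f (U i)) := by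
      ext v
      simp [P, LinearMap.sum_apply]
    rw [this, map_sum]
    refine Finset.sum_congr rfl fun i _ => ?_
    rw [LinearMap.trace_smulRight]
    rfl
  have h3 : (f.restrict hf ∘ₗ Q) ∘ₗ h.subtype = f.restrict hf := by
    ext x
    have : (Q x : V) = x := by
      simp [Q, hP, hq x x.2]
    simp [this]
  conv_lhs => rw [h1]
  rw [map_add, h2, LinearMap.trace_comp_comm', h3, add_comm]

/-- A positive semidefinite form has an orthonormal basis modulo its radical. -/
lemma exists_orthonormal_mod_radical (q : V →ₗ[ℝ] V →ₗ[ℝ] ℝ) (hs : ∀ x y, q x y = q y x)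
    (hp : ∀ x, 0 ≤ q x x) :
    ∃ (n : ℕ) (U : Fin n → V), ∀ v w, q (v - ∑ i, q v (U i) • U i) w = 0 := by
  obtain ⟨b, hb⟩ := LinearMap.BilinForm.exists_orthogonal_basis (B := q) ⟨hs⟩
  have hb' : ∀ i j, i ≠ j → q (b i) (b j) = 0 := fun i j hij => hb hij
  refine ⟨Module.finrank ℝ V, fun i => (Real.sqrt (q (b i) (b i)))⁻¹ • b i, fun v w => ?_⟩
  have key : ∀ j w, q (b j - ∑ i, q (b j) ((Real.sqrt (q (b i) (b i)))⁻¹ • b i) •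
      ((Real.sqrt (q (b i) (b i)))⁻¹ • b i)) w = 0 := by
    intro j w
    rw [Finset.sum_eq_single j]
    · have h0 : q (b j) (b j) = 0 → ∀ k, q (b j) (b k) = 0 := by
        intro h k
        by_cases hjk : j = k
        · rwa [← hjk]
        · exact hb' j k hjk
      by_cases hz : q (b j) (b j) = 0
      · have h1 : q (b j) = 0 := b.ext fun k => by simpa using h0 hz k
        simp [h1]
      · have hpos : 0 < q (b j) (b j) := lt_of_le_of_ne (hp _) (Ne.symm hz)
        have hsq : (Real.sqrt (q (b j) (b j))) * Real.sqrt (q (b j) (b j)) = q (b j) (b j) :=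
          Real.mul_self_sqrt hpos.le
        have hne := (Real.sqrt_pos.2 hpos).ne'
        have : b j - q (b j) ((Real.sqrt (q (b j) (b j)))⁻¹ • b j) •
            ((Real.sqrt (q (b j) (b j)))⁻¹ • b j) = 0 := by
          rw [map_smul, smul_eq_mul, smul_smul]
          have : (Real.sqrt (q (b j) (b j)))⁻¹ * q (b j) (b j) * (Real.sqrt (q (b j) (b j)))⁻¹ = 1 := by
            field_simp
            nlinarith
          rw [this, one_smul, sub_self]
        rw [this]; simp
    · intro i _ hij
      rw [map_smul, hb' j i (Ne.symm hij)]
      simp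
    · simp
  have : (q.flip w) ∘ₗ (LinearMap.id - ∑ i, (q.flip ((Real.sqrt (q (b i) (b i)))⁻¹ • b i)).smulRight
      ((Real.sqrt (q (b i) (b i)))⁻¹ • b i)) = 0 := by
    refine b.ext fun j => ?_
    simpa [LinearMap.sum_apply] using key j w
  simpa [LinearMap.sum_apply] using LinearMap.congr_fun this v

/-- A map that is skew for a positive semidefinite form, and preserves the radical, has the same
trace as its restriction to the radical. -/
lemma trace_eq_trace_restrict_of_skew (q : V →ₗ[ℝ] V →ₗ[ℝ] ℝ) (hs : ∀ x y, q x y = q y x)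
    (hp : ∀ x, 0 ≤ q x x) (h : Submodule ℝ V) (hh : ∀ x, x ∈ h ↔ ∀ y, q x y = 0)
    (f : V →ₗ[ℝ] V) (hf : ∀ x ∈ h, f x ∈ h) (hskew : ∀ x y, q (f x) y + q x (f y) = 0) :
    LinearMap.trace ℝ V f = LinearMap.trace ℝ h (f.restrict hf) := by
  obtain ⟨n, U, hU⟩ := exists_orthonormal_mod_radical q hs hp
  rw [trace_eq_trace_restrict_add q h U (fun x hx => (hh x).1 hx) (fun v => (hh _).2 (hU v)) f hf,
    add_eq_left]
  refine Finset.sum_eq_zero fun i _ => ?_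
  have := hskew (U i) (U i)
  rw [hs (U i)] at this
  linarith

end DegenerateForms

/-! ### Lie algebras with a degenerate inner product -/

section LieForms

variable {L : Type*} [LieRing L] [LieAlgebra ℝ L] [FiniteDimensional ℝ L]
  {ι : Type*} [Fintype ι] [DecidableEq ι]

/-- `q` is an inner product on `L` modulo its radical, invariant under the radical, with
orthonormal basis `U`. -/
structure IsInvariantForm (q : L →ₗ[ℝ] L →ₗ[ℝ] ℝ) (U : ι → L) : Prop where
  symm : ∀ x y, q x y = q y x
  orthonormal : ∀ i j, q (U i) (U j) = if i = j then 1 else 0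
  span : ∀ v w, q (v - ∑ i, q v (U i) • U i) w = 0
  inv : ∀ x, (∀ y, q x y = 0) → ∀ u v, q ⁅x, u⁆ v + q u ⁅x, v⁆ = 0

/-- `Z` normalizes the radical of `q`. -/
def NormalizesRadical (q : L →ₗ[ℝ] L →ₗ[ℝ] ℝ) (Z : L) : Prop :=
  ∀ x, (∀ y, q x y = 0) → ∀ y, q ⁅Z, x⁆ y = 0

variable {q : L →ₗ[ℝ] L →ₗ[ℝ] ℝ} {U : ι → L}

namespace IsInvariantForm

lemma expand (h : IsInvariantForm q U) (v w : L) : q v w = ∑ i, q v (U i) * q (U i) w := by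
  have := h.span v w
  rw [map_sub, LinearMap.sub_apply, sub_eq_zero] at this
  rw [this]
  simp [map_sum, LinearMap.sum_apply]

lemma nonneg (h : IsInvariantForm q U) (v : L) : 0 ≤ q v v := by
  rw [h.expand]
  exact Finset.sum_nonneg fun i _ => by rw [h.symm (U i)]; exact mul_self_nonneg _

lemma eq_zero_of_self (h : IsInvariantForm q U) {v : L} (hv : q v v = 0) (w : L) : q v w = 0 := by
  rw [h.expand] at hv ⊢
  have h1 : ∀ i, q v (U i) = 0 := by
    intro i
    have := (Finset.sum_eq_zero_iff_of_nonneg fun i _ => by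
      rw [h.symm (U i)]; exact mul_self_nonneg _).1 hv i (Finset.mem_univ i)
    rw [h.symm (U i)] at this
    exact mul_self_eq_zero.1 this
  simp [h1]

lemma apply_lie_radical (h : IsInvariantForm q U) {x : L} (hx : ∀ y, q x y = 0) {Z : L}
    (hZ : NormalizesRadical q Z) (v : L) : q Z ⁅x, v⁆ = 0 := by
  have h1 := h.inv x hx Z v
  have h2 := hZ x hx v
  rw [← lie_skew, map_neg, LinearMap.neg_apply, neg_eq_zero] at h2
  linarith

end IsInvariantForm

lemma trace_toEnd_eq_zero_of_perfect
    (hperf : Submodule.span ℝ {m : L | ∃ x y : L, ⁅x, y⁆ = m} = ⊤)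
    {M : Type*} [AddCommGroup M] [Module ℝ M] [LieRingModule L M] [LieModule ℝ L M] (Z : L) :
    LinearMap.trace ℝ M (LieModule.toEnd ℝ L M Z) = 0 := by
  have hZ : Z ∈ Submodule.span ℝ {m : L | ∃ x y : L, ⁅x, y⁆ = m} := hperf ▸ Submodule.mem_top
  induction hZ using Submodule.span_induction with
  | mem x hx =>
    obtain ⟨a, b, rfl⟩ := hx
    have : LieModule.toEnd ℝ L M ⁅a, b⁆ = LieModule.toEnd ℝ L M a * LieModule.toEnd ℝ L M b
        - LieModule.toEnd ℝ L M b * LieModule.toEnd ℝ L M a := by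
      ext m
      simp
    rw [this, map_sub, LinearMap.trace_mul_comm, sub_self]
  | zero => simp
  | add x y _ _ hx hy => rw [map_add, map_add, hx, hy, add_zero]
  | smul a x _ hx => rw [map_smul, map_smul, hx, smul_zero]

namespace IsInvariantForm

/-- The radical of an invariant form. -/
def radical (q : L →ₗ[ℝ] L →ₗ[ℝ] ℝ) : Submodule ℝ L := LinearMap.ker q

lemma mem_radical {x : L} : x ∈ radical q ↔ ∀ y, q x y = 0 := by
  rw [radical, LinearMap.mem_ker]
  exact ⟨fun h y => by rw [h]; rfl, fun h => LinearMap.ext h⟩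

lemma normalizesRadical_of_radical (h : IsInvariantForm q U) {x : L} (hx : ∀ y, q x y = 0) :
    NormalizesRadical q x := by
  intro y hy v
  have := h.inv x hx y v
  rwa [hy, add_zero] at this

/-- The elements of the radical whose adjoint action has values in the radical. -/
def core (h : IsInvariantForm q U) : LieIdeal ℝ L where
  carrier := {x | (∀ y, q x y = 0) ∧ ∀ u y, q ⁅x, u⁆ y = 0}
  zero_mem' := by simp
  add_mem' := by
    rintro a b ⟨ha, ha'⟩ ⟨hb, hb'⟩
    exact ⟨fun y => by simp [ha, hb], fun u y => by simp [ha', hb']⟩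
  smul_mem' := by
    rintro c a ⟨ha, ha'⟩
    exact ⟨fun y => by simp [ha], fun u y => by simp [ha']⟩
  lie_mem := by
    rintro Y X ⟨hX, hX'⟩
    have hYX : ∀ v, q ⁅Y, X⁆ v = 0 := fun v => by
      rw [← lie_skew, map_neg, LinearMap.neg_apply, hX', neg_zero]
    refine ⟨hYX, ?_⟩
    have hYX' : ∀ Y v, q ⁅Y, X⁆ v = 0 := fun Y v => by
      rw [← lie_skew, map_neg, LinearMap.neg_apply, hX', neg_zero]
    -- `t Y Z V` is symmetric in the first two and skew in the last two variables
    have h1 : ∀ Y Z V, q ⁅⁅Y, X⁆, Z⁆ V = q ⁅⁅Z, X⁆, Y⁆ V := by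
      intro Y Z V
      have e : ⁅⁅Y, X⁆, Z⁆ = ⁅⁅Z, X⁆, Y⁆ - ⁅X, ⁅Y, Z⁆⁆ := by
        have s1 : ⁅X, Z⁆ = -⁅Z, X⁆ := (lie_skew X Z).symm
        have s2 : ⁅Y, ⁅Z, X⁆⁆ = -⁅⁅Z, X⁆, Y⁆ := (lie_skew Y ⁅Z, X⁆).symm
        rw [lie_lie, s1, lie_neg, s2, neg_neg]
      rw [e, map_sub, LinearMap.sub_apply, hX', sub_zero]
    have h2 : ∀ Y Z V : L, q ⁅⁅Y, X⁆, Z⁆ V = -q ⁅⁅Y, X⁆, V⁆ Z := by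
      intro Y Z V
      have := h.inv _ (hYX' Y) Z V
      rw [h.symm Z] at this
      linarith
    intro u v
    have e1 := h1 Y u v
    have e2 := h2 u Y v
    have e3 := h1 u v Y
    have e4 := h2 v u Y
    have e5 := h1 v Y u
    have e6 := h2 Y v u
    linarith

lemma apply_of_normalizes (h : IsInvariantForm q U) (f : L →ₗ[ℝ] L)
    (hf : ∀ x, (∀ y, q x y = 0) → ∀ y, q (f x) y = 0) (v w : L) :
    q (f v) w = ∑ i, q v (U i) * q (f (U i)) w := by
  have h1 := hf _ (h.span v) w
  rw [map_sub, map_sub, LinearMap.sub_apply, sub_eq_zero] at h1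
  rw [h1]
  simp [map_sum, LinearMap.sum_apply]

lemma sum_comp_comm (h : IsInvariantForm q U) (f g : L →ₗ[ℝ] L)
    (hf : ∀ x, (∀ y, q x y = 0) → ∀ y, q (f x) y = 0)
    (hg : ∀ x, (∀ y, q x y = 0) → ∀ y, q (g x) y = 0) :
    ∑ i, q (f (g (U i))) (U i) = ∑ i, q (g (f (U i))) (U i) := by
  have h1 : ∀ i, q (f (g (U i))) (U i) = ∑ k, q (g (U i)) (U k) * q (f (U k)) (U i) :=
    fun i => h.apply_of_normalizes f hf _ _
  have h2 : ∀ i, q (g (f (U i))) (U i) = ∑ k, q (f (U i)) (U k) * q (g (U k)) (U i) :=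
    fun i => h.apply_of_normalizes g hg _ _
  simp only [h1, h2]
  rw [Finset.sum_comm]
  simp only [mul_comm]

/-- The form `(x, y) ↦ -tr(ad x ad y)` on the radical, where the trace is taken modulo the
radical. -/
def radicalForm (q : L →ₗ[ℝ] L →ₗ[ℝ] ℝ) (U : ι → L) :
    radical q →ₗ[ℝ] radical q →ₗ[ℝ] ℝ :=
  LinearMap.mk₂ ℝ (fun x y => ∑ i, q ⁅(x : L), U i⁆ ⁅(y : L), U i⁆)
    (fun x x' y => by simp [Finset.sum_add_distrib])
    (fun c x y => by simp [Finset.mul_sum])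
    (fun x y y' => by simp [Finset.sum_add_distrib])
    (fun c x y => by simp [Finset.mul_sum])

lemma radicalForm_apply (x y : radical q) :
    radicalForm q U x y = ∑ i, q ⁅(x : L), U i⁆ ⁅(y : L), U i⁆ := rfl

lemma radicalForm_eq (h : IsInvariantForm q U) (x y : radical q) :
    radicalForm q U x y = -∑ i, q ⁅(y : L), ⁅(x : L), U i⁆⁆ (U i) := by
  rw [radicalForm_apply, ← Finset.sum_neg_distrib]
  refine Finset.sum_congr rfl fun i _ => ?_
  have := h.inv y (mem_radical.1 y.2) ⁅(x : L), U i⁆ (U i)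
  linarith

lemma radicalForm_radical (h : IsInvariantForm q U) (x : radical q) :
    (x : L) ∈ h.core ↔ ∀ y, radicalForm q U x y = 0 := by
  constructor
  · rintro ⟨-, hx⟩ y
    simp [radicalForm_apply, hx]
  · intro hx
    refine ⟨mem_radical.1 x.2, fun u w => ?_⟩
    have h1 := hx x
    rw [radicalForm_apply, Finset.sum_eq_zero_iff_of_nonneg fun i _ => h.nonneg _] at h1
    have h2 := h.apply_of_normalizes (LieAlgebra.ad ℝ L x)
      (h.normalizesRadical_of_radical (mem_radical.1 x.2)) u w
    refine h2.trans (Finset.sum_eq_zero fun i _ => ?_)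
    rw [LieAlgebra.ad_apply, h.eq_zero_of_self (h1 i (Finset.mem_univ i)), mul_zero]

lemma radicalForm_skew (h : IsInvariantForm q U) {Z : L} (hZ : NormalizesRadical q Z)
    (x y x' y' : radical q) (hx : (x' : L) = ⁅Z, (x : L)⁆) (hy : (y' : L) = ⁅Z, (y : L)⁆) :
    radicalForm q U x' y + radicalForm q U x y' = 0 := by
  have e1 := h.sum_comp_comm (LieAlgebra.ad ℝ L Z) (LieAlgebra.ad ℝ L y ∘ₗ LieAlgebra.ad ℝ L x) hZ
    (fun u hu => h.normalizesRadical_of_radical (mem_radical.1 y.2) _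
      (h.normalizesRadical_of_radical (mem_radical.1 x.2) _ hu))
  simp only [LinearMap.comp_apply, LieAlgebra.ad_apply] at e1
  rw [h.radicalForm_eq, h.radicalForm_eq, hx, hy, ← neg_add, neg_eq_zero,
    ← Finset.sum_add_distrib, ← sub_eq_zero.2 e1, ← Finset.sum_sub_distrib]
  refine Finset.sum_congr rfl fun i _ => ?_
  simp only [lie_lie, lie_sub, map_sub, LinearMap.sub_apply]
  ring

/-- Elements normalizing the radical act with trace zero modulo the radical, if the Lie algebra is
perfect. -/
theorem sum_lie_eq_zero (h : IsInvariantForm q U)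
    (hperf : Submodule.span ℝ {m : L | ∃ x y : L, ⁅x, y⁆ = m} = ⊤) {Z : L}
    (hZ : NormalizesRadical q Z) : ∑ i, q ⁅Z, U i⁆ (U i) = 0 := by
  have hZ' : ∀ x ∈ radical q, LieAlgebra.ad ℝ L Z x ∈ radical q := fun x hx =>
    mem_radical.2 (hZ x (mem_radical.1 hx))
  have h1 := trace_eq_trace_restrict_add q (radical q) U (fun x hx => mem_radical.1 hx)
    (fun v => mem_radical.2 (h.span v)) (LieAlgebra.ad ℝ L Z) hZ'
  have h0 : LinearMap.trace ℝ L (LieAlgebra.ad ℝ L Z) = 0 :=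
    trace_toEnd_eq_zero_of_perfect hperf (M := L) Z
  let k : Submodule ℝ (radical q) := Submodule.comap (radical q).subtype h.core.toSubmodule
  let f := (LieAlgebra.ad ℝ L Z).restrict hZ'
  have hk : ∀ x ∈ k, f x ∈ k := fun x hx => h.core.lie_mem (x := Z) hx
  have h2 := trace_eq_trace_restrict_of_skew (radicalForm q U)
    (fun x y => Finset.sum_congr rfl fun i _ => h.symm _ _)
    (fun x => Finset.sum_nonneg fun i _ => h.nonneg _) k
    (fun x => h.radicalForm_radical x) f hk (fun x y => h.radicalForm_skew hZ x y _ _ rfl rfl)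
  have hle : h.core.toSubmodule ≤ radical q := fun x hx => mem_radical.2 hx.1
  have h3 : LinearMap.trace ℝ k (f.restrict hk) = 0 := by
    let e := Submodule.comapSubtypeEquivOfLe hle
    rw [← LinearMap.trace_conj' _ e]
    have : e.conj (f.restrict hk) = LieModule.toEnd ℝ L h.core Z := by
      ext x
      rfl
    rw [this]
    exact trace_toEnd_eq_zero_of_perfect hperf (M := h.core) Z
  change _ = LinearMap.trace ℝ (radical q) f + _ at h1
  rw [h0, h2, h3, zero_add] at h1
  exact h1.symm

end IsInvariantForm

end LieForms

/-! ### The algebraic Ricci curvature -/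

section AlgebraicRicci

variable {L : Type*} [LieRing L] [LieAlgebra ℝ L] [FiniteDimensional ℝ L]
  {ι : Type*} [Fintype ι] [DecidableEq ι]

/-- The coefficients of the endomorphism `u ↦ ∇_u X` for an invariant vector field `X`. -/
def connCoeff (q : L →ₗ[ℝ] L →ₗ[ℝ] ℝ) (U : ι → L) (X : L) (i j : ι) : ℝ :=
  (-q ⁅X, U i⁆ (U j) - q (U i) ⁅X, U j⁆ - q X ⁅U i, U j⁆) / 2

/-- The number `r` is the Ricci curvature of the invariant vector fields `X` and `Y`. -/
def HasRicci (q : L →ₗ[ℝ] L →ₗ[ℝ] ℝ) (U : ι → L) (X Y : L) (r : ℝ) : Prop :=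
  ∃ W : L, (∀ v, 2 * q W v = -q Y ⁅X, v⁆ - q X ⁅Y, v⁆ + q ⁅X, Y⁆ v) ∧
    r = ∑ i, (-q ⁅W, U i⁆ (U i) - q ⁅Y, ⁅X, U i⁆⁆ (U i) - q ⁅Y, U i⁆ ⁅X, U i⁆
      + ∑ j, connCoeff q U X i j * connCoeff q U Y i j)

variable {q : L →ₗ[ℝ] L →ₗ[ℝ] ℝ} {U : ι → L} {X Y : L}

lemma HasRicci.eq (h : IsInvariantForm q U)
    (hperf : Submodule.span ℝ {m : L | ∃ x y : L, ⁅x, y⁆ = m} = ⊤)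
    (hX : NormalizesRadical q X) (hY : NormalizesRadical q Y) {r : ℝ} (hr : HasRicci q U X Y r) :
    r = -∑ i, ∑ j, connCoeff q U X i j * connCoeff q U Y j i := by
  obtain ⟨W, hW, rfl⟩ := hr
  have hWn : NormalizesRadical q W := by
    intro x hx y
    rw [← lie_skew, map_neg, LinearMap.neg_apply]
    have h1 := h.inv x hx W y
    have h2 := hW ⁅x, y⁆
    have h3 : ∀ A B : L, NormalizesRadical q A → NormalizesRadical q B → ∀ y, q A ⁅B, ⁅x, y⁆⁆ = 0 := by
      intro A B hA hB y
      have e : ⁅B, ⁅x, y⁆⁆ = ⁅⁅B, x⁆, y⁆ + ⁅x, ⁅B, y⁆⁆ := leibniz_lie B x y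
      rw [e, map_add, h.apply_lie_radical (hB x hx) hA, h.apply_lie_radical hx hA, add_zero]
    have hXY : NormalizesRadical q ⁅X, Y⁆ := by
      intro z hz w
      rw [lie_lie, map_sub, LinearMap.sub_apply, hX _ (hY z hz), hY _ (hX z hz), sub_zero]
    rw [h3 Y X hY hX, h3 X Y hX hY, h.apply_lie_radical hx hXY] at h2
    linarith
  have h1 := h.sum_lie_eq_zero hperf hWn
  have h2 : ∀ i, q ⁅Y, ⁅X, U i⁆⁆ (U i) = ∑ j, q ⁅X, U i⁆ (U j) * q ⁅Y, U j⁆ (U i) := fun i =>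
    h.apply_of_normalizes (LieAlgebra.ad ℝ L Y) hY _ _
  have h3 : ∀ i, q ⁅Y, U i⁆ ⁅X, U i⁆ = ∑ j, q ⁅X, U i⁆ (U j) * q ⁅Y, U i⁆ (U j) := fun i => by
    rw [h.expand]
    exact Finset.sum_congr rfl fun j _ => by rw [h.symm (U j), mul_comm]
  simp only [Finset.sum_add_distrib, Finset.sum_sub_distrib, Finset.sum_neg_distrib, h1, h2, h3,
    neg_zero, zero_sub]
  have e1 : ∀ i j, connCoeff q U X i j * connCoeff q U Y i j
      + connCoeff q U X i j * connCoeff q U Y j i = (q ⁅X, U i⁆ (U j) + q ⁅X, U j⁆ (U i)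
        + q X ⁅U i, U j⁆) * (q ⁅Y, U i⁆ (U j) + q ⁅Y, U j⁆ (U i)) / 2 := by
    intro i j
    have a1 : ⁅U j, U i⁆ = -⁅U i, U j⁆ := (lie_skew _ _).symm
    simp only [connCoeff, a1, map_neg, h.symm (U i) ⁅_, U j⁆, h.symm (U j) ⁅_, U i⁆]
    ring
  have e2 : ∑ i, ∑ j, (q ⁅X, U j⁆ (U i) + q X ⁅U i, U j⁆) *
      (q ⁅Y, U i⁆ (U j) + q ⁅Y, U j⁆ (U i)) = ∑ i, ∑ j, q ⁅X, U i⁆ (U j) *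
      (q ⁅Y, U i⁆ (U j) + q ⁅Y, U j⁆ (U i)) := by
    have e3 : ∑ i, ∑ j, q X ⁅U i, U j⁆ * (q ⁅Y, U i⁆ (U j) + q ⁅Y, U j⁆ (U i)) = 0 := by
      have : ∑ i, ∑ j, q X ⁅U i, U j⁆ * (q ⁅Y, U i⁆ (U j) + q ⁅Y, U j⁆ (U i)) =
          -∑ i, ∑ j, q X ⁅U i, U j⁆ * (q ⁅Y, U i⁆ (U j) + q ⁅Y, U j⁆ (U i)) := by
        conv_lhs => rw [Finset.sum_comm]
        rw [← Finset.sum_neg_distrib]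
        refine Finset.sum_congr rfl fun i _ => ?_
        rw [← Finset.sum_neg_distrib]
        refine Finset.sum_congr rfl fun j _ => ?_
        have a1 : ⁅U j, U i⁆ = -⁅U i, U j⁆ := (lie_skew _ _).symm
        rw [a1, map_neg]
        ring
      linarith
    simp only [add_mul _ _ (_ + _), Finset.sum_add_distrib]
    rw [e3, add_zero, Finset.sum_comm]
    refine Finset.sum_congr rfl fun i _ => Finset.sum_congr rfl fun j _ => ?_
    rw [add_comm (q ⁅Y, U j⁆ (U i))]
  have e4 : ∑ i, ∑ j, connCoeff q U X i j * connCoeff q U Y i j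
      + ∑ i, ∑ j, connCoeff q U X i j * connCoeff q U Y j i =
      ∑ i, ∑ j, q ⁅X, U i⁆ (U j) * q ⁅Y, U j⁆ (U i) + ∑ i, ∑ j, q ⁅X, U i⁆ (U j) * q ⁅Y, U i⁆ (U j) := by
    have e5 : ∀ i j, connCoeff q U X i j * connCoeff q U Y i j
      + connCoeff q U X i j * connCoeff q U Y j i =
      2⁻¹ * ((q ⁅X, U i⁆ (U j)) * (q ⁅Y, U i⁆ (U j) + q ⁅Y, U j⁆ (U i))) +
      2⁻¹ * ((q ⁅X, U j⁆ (U i) + q X ⁅U i, U j⁆) * (q ⁅Y, U i⁆ (U j) + q ⁅Y, U j⁆ (U i))) := by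
      intro i j; rw [e1]; ring
    have e6 : ∑ i, ∑ j, (connCoeff q U X i j * connCoeff q U Y i j
      + connCoeff q U X i j * connCoeff q U Y j i) = ∑ i, ∑ j, q ⁅X, U i⁆ (U j) *
      (q ⁅Y, U i⁆ (U j) + q ⁅Y, U j⁆ (U i)) := by
      simp only [e5]
      simp only [Finset.sum_add_distrib, ← Finset.mul_sum]
      rw [e2]
      ring
    simp only [mul_add, Finset.sum_add_distrib] at e6
    linarith
  linarith

end AlgebraicRicci

/-! ### Lie algebras with a three-dimensional factor -/

section SplitFrame

variable {L : Type*} [LieRing L] [LieAlgebra ℝ L] [FiniteDimensional ℝ L]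
  {J : Type*} [Fintype J] [DecidableEq J]

/-- The vectors `e` span an ideal of `L` with complementary ideal `ker κ`, and together with the
vectors `V j + ∑ k, ψ j k • e k` they are an orthonormal basis for `q` modulo its radical, which
lies in `ker κ`. -/
structure IsSplitFrame (q : L →ₗ[ℝ] L →ₗ[ℝ] ℝ) (e : Fin 3 → L) (V : J → L)
    (ψ : J → Fin 3 → ℝ) (κ : L →ₗ[ℝ] (Fin 3 → ℝ)) : Prop where
  form : IsInvariantForm q (Sum.elim e (fun j => V j + ∑ k, ψ j k • e k))
  coord_e : ∀ k, κ (e k) = Pi.single k 1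
  coord_V : ∀ j, κ (V j) = 0
  coord_radical : ∀ x, (∀ y, q x y = 0) → κ x = 0
  coord_lie : ∀ u v : L, κ v = 0 → κ ⁅u, v⁆ = 0
  lie_eq_zero : ∀ (k : Fin 3) (v : L), κ v = 0 → ⁅e k, v⁆ = 0
  lie_e : ∀ i j, ⁅e i, e j⁆ = ∑ k, κ ⁅e i, e j⁆ k • e k

namespace IsSplitFrame

variable {q : L →ₗ[ℝ] L →ₗ[ℝ] ℝ} {e : Fin 3 → L} {V : J → L} {ψ : J → Fin 3 → ℝ}
  {κ : L →ₗ[ℝ] (Fin 3 → ℝ)}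

/-- The component of the frame vector with index `j` in the three-dimensional factor. -/
def tilt (e : Fin 3 → L) (ψ : J → Fin 3 → ℝ) (j : J) : L := ∑ k, ψ j k • e k

/-- The vectors `Y k = ∑ j, ψ j k • (V j + ∑ l, ψ j l • e l)`. -/
def dualVec (e : Fin 3 → L) (V : J → L) (ψ : J → Fin 3 → ℝ) (k : Fin 3) : L :=
  ∑ j, ψ j k • (V j + tilt e ψ j)

lemma q_e_e (h : IsSplitFrame q e V ψ κ) (k l : Fin 3) : q (e k) (e l) = if k = l then 1 else 0 := by
  have := h.form.orthonormal (Sum.inl k) (Sum.inl l)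
  simpa using this

lemma q_e_f (h : IsSplitFrame q e V ψ κ) (k : Fin 3) (j : J) : q (e k) (V j + tilt e ψ j) = 0 := by
  have := h.form.orthonormal (Sum.inl k) (Sum.inr j)
  simpa [tilt] using this

lemma q_f_e (h : IsSplitFrame q e V ψ κ) (k : Fin 3) (j : J) : q (V j + tilt e ψ j) (e k) = 0 := by
  rw [h.form.symm, h.q_e_f]

lemma q_lie_e_f (h : IsSplitFrame q e V ψ κ) (k l : Fin 3) (j : J) :
    q ⁅e k, e l⁆ (V j + tilt e ψ j) = 0 := by
  rw [h.lie_e]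
  simp [LinearMap.sum_apply, h.q_e_f]

lemma q_lie_tilt_f (h : IsSplitFrame q e V ψ κ) (k : Fin 3) (i j : J) :
    q ⁅e k, tilt e ψ i⁆ (V j + tilt e ψ j) = 0 := by
  simp only [tilt, lie_sum, lie_smul, map_sum, map_smul, LinearMap.sum_apply, LinearMap.smul_apply]
  refine Finset.sum_eq_zero fun l _ => ?_
  have := h.q_lie_e_f k l j
  rw [tilt] at this
  rw [this, smul_zero]

lemma lie_e_f (h : IsSplitFrame q e V ψ κ) (k : Fin 3) (j : J) :
    ⁅e k, V j + tilt e ψ j⁆ = ⁅e k, tilt e ψ j⁆ := by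
  rw [lie_add, h.lie_eq_zero k _ (h.coord_V j), zero_add]

lemma lie_f_f (h : IsSplitFrame q e V ψ κ) (i j : J) :
    ⁅V i + tilt e ψ i, V j + tilt e ψ j⁆ = ⁅V i, V j⁆ + ⁅tilt e ψ i, tilt e ψ j⁆ := by
  have h1 : ∀ i j, ⁅tilt e ψ i, V j⁆ = 0 := fun i j => by
    simp [tilt, sum_lie, h.lie_eq_zero _ _ (h.coord_V j)]
  have h2 : ⁅V i, tilt e ψ j⁆ = 0 := by rw [← lie_skew, h1, neg_zero]
  rw [add_lie, lie_add, lie_add, h1, h2, add_zero, zero_add]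

lemma q_dualVec_e (h : IsSplitFrame q e V ψ κ) (k l : Fin 3) : q (dualVec e V ψ k) (e l) = 0 := by
  simp only [dualVec, map_sum, map_smul, LinearMap.sum_apply, LinearMap.smul_apply, h.q_f_e,
    smul_zero, Finset.sum_const_zero]

lemma q_dualVec_lie_e (h : IsSplitFrame q e V ψ κ) (k l m : Fin 3) :
    q (dualVec e V ψ k) ⁅e l, e m⁆ = 0 := by
  rw [h.lie_e]
  simp [h.q_dualVec_e]

lemma q_dualVec_lie_tilt (h : IsSplitFrame q e V ψ κ) (k l : Fin 3) (j : J) :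
    q (dualVec e V ψ k) ⁅e l, tilt e ψ j⁆ = 0 := by
  simp [tilt, lie_sum, h.q_dualVec_lie_e]

lemma q_dualVec_of_coord_eq_zero (h : IsSplitFrame q e V ψ κ) (k : Fin 3) {u : L} (hu : κ u = 0) :
    q (dualVec e V ψ k) u = -q (e k) u := by
  have h1 := congrFun (h.coord_radical _ (h.form.span u)) k
  have h3 : ∀ (a : Fin 3 → ℝ) k, ∑ l, a l * (Pi.single l (1 : ℝ) : Fin 3 → ℝ) k = a k := by
    intro a k; simp [Pi.single_apply]
  simp only [map_sub, map_sum, map_smul, Fintype.sum_sum_type, Sum.elim_inl, Sum.elim_inr, hu,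
    Pi.sub_apply, Pi.add_apply, Finset.sum_apply, Pi.smul_apply, smul_eq_mul, h.coord_e, map_add,
    h.coord_V, Pi.zero_apply, zero_add, zero_sub, h3] at h1
  simp only [dualVec, map_sum, map_smul, LinearMap.sum_apply, LinearMap.smul_apply, smul_eq_mul,
    map_add, LinearMap.add_apply, tilt, h.form.symm _ u]
  have h4 : ∑ j, ψ j k * (q u (V j) + ∑ l, ψ j l * q u (e l)) =
      ∑ j, (q u (V j) + ∑ l, ψ j l * q u (e l)) * ψ j k :=
    Finset.sum_congr rfl fun j _ => mul_comm _ _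
  linarith

lemma normalizes_e (h : IsSplitFrame q e V ψ κ) (k : Fin 3) : NormalizesRadical q (e k) := by
  intro x hx y
  rw [h.lie_eq_zero k x (h.coord_radical x hx)]
  simp

lemma normalizes_dualVec (h : IsSplitFrame q e V ψ κ) (k : Fin 3) :
    NormalizesRadical q (dualVec e V ψ k) := by
  intro x hx y
  have hκ := h.coord_radical x hx
  have hxy : κ ⁅x, y⁆ = 0 := by
    rw [← lie_skew, map_neg, h.coord_lie _ _ hκ, neg_zero]
  have h1 := h.form.inv x hx (dualVec e V ψ k) y
  have h2 := h.form.inv x hx (e k) y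
  have h3 : ⁅x, e k⁆ = 0 := by rw [← lie_skew, h.lie_eq_zero k x hκ, neg_zero]
  rw [h.q_dualVec_of_coord_eq_zero k hxy] at h1
  rw [h3, map_zero, LinearMap.zero_apply, zero_add] at h2
  rw [← lie_skew, map_neg, LinearMap.neg_apply]
  linarith

/-- The matrix of `ad (tilt j)` on the three-dimensional factor. -/
def tiltAd (q : L →ₗ[ℝ] L →ₗ[ℝ] ℝ) (e : Fin 3 → L) (ψ : J → Fin 3 → ℝ) (j : J) (k l : Fin 3) : ℝ :=
  q (e k) ⁅tilt e ψ j, e l⁆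

lemma tiltAd_eq (j : J) (k l : Fin 3) :
    tiltAd q e ψ j k l = ∑ m, ψ j m * q (e k) ⁅e m, e l⁆ := by
  simp [tiltAd, tilt, sum_lie]

lemma q_lie_tilt (j : J) (k l : Fin 3) :
    q (e k) ⁅e l, tilt e ψ j⁆ = -tiltAd q e ψ j k l := by
  rw [tiltAd, ← lie_skew, map_neg]

lemma q_tilt_tilt (i j : J) (l : Fin 3) :
    q (e l) ⁅tilt e ψ i, tilt e ψ j⁆ = -∑ k, ψ i k * tiltAd q e ψ j l k := by
  conv_lhs => rw [tilt, sum_lie]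
  simp [q_lie_tilt]

/-- The frame of an `IsSplitFrame`. -/
abbrev frame (e : Fin 3 → L) (V : J → L) (ψ : J → Fin 3 → ℝ) : Fin 3 ⊕ J → L :=
  Sum.elim e (fun j => V j + tilt e ψ j)

lemma connCoeff_e_ef (h : IsSplitFrame q e V ψ κ) (k l : Fin 3) (j : J) :
    connCoeff q (frame e V ψ) (e k) (Sum.inl l) (Sum.inr j) =
      (tiltAd q e ψ j l k + tiltAd q e ψ j k l) / 2 := by
  simp only [connCoeff, Sum.elim_inl, Sum.elim_inr, h.q_lie_e_f, h.lie_e_f, q_lie_tilt]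
  ring

lemma connCoeff_e_fe (h : IsSplitFrame q e V ψ κ) (k l : Fin 3) (j : J) :
    connCoeff q (frame e V ψ) (e k) (Sum.inr j) (Sum.inl l) =
      (tiltAd q e ψ j l k - tiltAd q e ψ j k l) / 2 := by
  simp only [connCoeff, Sum.elim_inl, Sum.elim_inr, h.form.symm (V j + _), h.q_lie_e_f, h.lie_e_f]
  rw [← lie_skew (V j + _), h.lie_e_f, map_neg, q_lie_tilt, h.form.symm _ (e l), q_lie_tilt]
  ring

lemma connCoeff_e_ff (h : IsSplitFrame q e V ψ κ) (k : Fin 3) (i j : J) :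
    connCoeff q (frame e V ψ) (e k) (Sum.inr i) (Sum.inr j) =
      -(q (e k) ⁅V i, V j⁆ + q (e k) ⁅tilt e ψ i, tilt e ψ j⁆) / 2 := by
  simp only [connCoeff, Sum.elim_inr, h.lie_e_f, h.q_lie_tilt_f, h.lie_f_f,
    h.form.symm (V i + _), map_add (q (e k))]
  ring

lemma lie_dualVec_e (h : IsSplitFrame q e V ψ κ) (k l : Fin 3) :
    ⁅dualVec e V ψ k, e l⁆ = ∑ j, ψ j k • ⁅tilt e ψ j, e l⁆ := by
  rw [dualVec, sum_lie]
  refine Finset.sum_congr rfl fun j _ => ?_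
  rw [smul_lie, ← lie_skew, h.lie_e_f, lie_skew]

lemma connCoeff_dualVec_ee (h : IsSplitFrame q e V ψ κ) (k l m : Fin 3) :
    connCoeff q (frame e V ψ) (dualVec e V ψ k) (Sum.inl l) (Sum.inl m) =
      -(∑ j, ψ j k * (tiltAd q e ψ j m l + tiltAd q e ψ j l m)) / 2 := by
  simp only [connCoeff, Sum.elim_inl, h.q_dualVec_lie_e, h.lie_dualVec_e, h.form.symm _ (e m)]
  simp only [map_sum, map_smul, smul_eq_mul, mul_add, Finset.sum_add_distrib, tiltAd]
  ring

lemma lie_dualVec_f (h : IsSplitFrame q e V ψ κ) (k : Fin 3) (j : J) :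
    ⁅dualVec e V ψ k, V j + tilt e ψ j⁆ =
      ∑ i, ψ i k • (⁅V i, V j⁆ + ⁅tilt e ψ i, tilt e ψ j⁆) := by
  rw [dualVec, sum_lie]
  refine Finset.sum_congr rfl fun i _ => ?_
  rw [smul_lie, h.lie_f_f]

lemma q_lie_dualVec_e_f (h : IsSplitFrame q e V ψ κ) (k l : Fin 3) (j : J) :
    q ⁅dualVec e V ψ k, e l⁆ (V j + tilt e ψ j) = 0 := by
  rw [h.lie_dualVec_e]
  simp only [map_sum, map_smul, LinearMap.sum_apply, LinearMap.smul_apply]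
  refine Finset.sum_eq_zero fun i _ => ?_
  rw [← lie_skew, map_neg, LinearMap.neg_apply, h.q_lie_tilt_f, neg_zero, smul_zero]

lemma connCoeff_dualVec_ef (h : IsSplitFrame q e V ψ κ) (k l : Fin 3) (j : J) :
    connCoeff q (frame e V ψ) (dualVec e V ψ k) (Sum.inl l) (Sum.inr j) =
      -(∑ i, ψ i k * (q (e l) ⁅V i, V j⁆ + q (e l) ⁅tilt e ψ i, tilt e ψ j⁆)) / 2 := by
  simp only [connCoeff, Sum.elim_inl, Sum.elim_inr, h.q_lie_dualVec_e_f, h.lie_e_f,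
    h.q_dualVec_lie_tilt, h.lie_dualVec_f]
  simp only [map_sum, map_smul, smul_eq_mul, map_add]
  ring

lemma connCoeff_dualVec_fe (h : IsSplitFrame q e V ψ κ) (k l : Fin 3) (j : J) :
    connCoeff q (frame e V ψ) (dualVec e V ψ k) (Sum.inr j) (Sum.inl l) =
      -(∑ i, ψ i k * (q (e l) ⁅V i, V j⁆ + q (e l) ⁅tilt e ψ i, tilt e ψ j⁆)) / 2 := by
  simp only [connCoeff, Sum.elim_inl, Sum.elim_inr, h.form.symm (V j + _), h.q_lie_dualVec_e_f]
  rw [← lie_skew (V j + _), h.lie_e_f, map_neg, h.q_dualVec_lie_tilt, h.lie_dualVec_f,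
    h.form.symm _ (e l)]
  simp only [map_sum, map_smul, smul_eq_mul, map_add]
  ring

lemma connCoeff_dualVec_ff (h : IsSplitFrame q e V ψ κ) (k : Fin 3) (i j : J) :
    connCoeff q (frame e V ψ) (dualVec e V ψ k) (Sum.inr i) (Sum.inr j)
      - connCoeff q (frame e V ψ) (dualVec e V ψ k) (Sum.inr j) (Sum.inr i) =
      q (e k) ⁅V i, V j⁆ := by
  have h2 : ∀ i j, q (dualVec e V ψ k) ⁅tilt e ψ i, tilt e ψ j⁆ = 0 := by
    intro i j
    conv_lhs => rw [tilt, sum_lie]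
    simp [h.q_dualVec_lie_tilt]
  have h1 : ∀ i j, q (dualVec e V ψ k) ⁅V i + tilt e ψ i, V j + tilt e ψ j⁆ =
      -q (e k) ⁅V i, V j⁆ := by
    intro i j
    rw [h.lie_f_f, map_add, h2, add_zero]
    exact h.q_dualVec_of_coord_eq_zero k (h.coord_lie _ _ (h.coord_V j))
  have h3 : ⁅V j, V i⁆ = -⁅V i, V j⁆ := (lie_skew _ _).symm
  simp only [connCoeff, Sum.elim_inr, h1, h3, map_neg, h.form.symm (V j + _) ⁅_, _⁆,
    h.form.symm (V i + _) ⁅_, _⁆]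
  ring

end IsSplitFrame

end SplitFrame

/-! ### The Ricci curvature obstruction -/

section RicciObstruction

/-- If the adjugate of `tr(n) / 2 - n` is scalar, for a symmetric matrix `n` of size three, then `n`
is singular or scalar. -/
lemma det_eq_zero_or_scalar_of_adjugate {a b c f g h γ : ℝ}
    (h1 : ((a + c - b) / 2) * ((a + b - c) / 2) - h ^ 2 = γ)
    (h2 : ((b + c - a) / 2) * ((a + b - c) / 2) - g ^ 2 = γ)
    (h3 : ((b + c - a) / 2) * ((a + c - b) / 2) - f ^ 2 = γ)
    (h4 : f * ((a + b - c) / 2) + g * h = 0) (h5 : g * ((a + c - b) / 2) + f * h = 0)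
    (h6 : h * ((b + c - a) / 2) + f * g = 0) :
    a * (b * c - h ^ 2) - f * (f * c - g * h) + g * (f * h - b * g) = 0 ∨
      (f = 0 ∧ g = 0 ∧ h = 0 ∧ a = b ∧ b = c) := by
  by_cases hγ : γ = 0
  · left
    subst hγ
    linear_combination ((a + b + c) / 2) * (h1 + h2 + h3) - ((b + c - a) / 2) * h1
      + f * h4 + g * h5
  · right
    have k1 : γ * f = 0 := by linear_combination (-f) * h1 + ((a+c-b)/2) * h4 - h * h5
    have k2 : γ * g = 0 := by linear_combination (-g) * h1 + ((a+b-c)/2) * h5 - h * h4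
    have k3 : γ * h = 0 := by linear_combination (-h) * h2 + ((a+b-c)/2) * h6 - g * h4
    have k4 : γ * (a - b) = 0 := by
      linear_combination ((b+c-a)/2) * h1 - ((a+c-b)/2) * h2 - g * h5 + h * h6
    have k5 : γ * (b - c) = 0 := by
      linear_combination ((a+c-b)/2) * h2 - ((a+b-c)/2) * h3 - f * h4 + g * h5
    simp only [mul_eq_zero, hγ, false_or, sub_eq_zero] at k1 k2 k3 k4 k5
    exact ⟨k1, k2, k3, k4, k5⟩

/-- The structure constants of a three-dimensional unimodular metric Lie algebra with constant Ricci
curvature are degenerate or totally skew. -/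
lemma det_eq_zero_or_scalar (C : Fin 3 → Fin 3 → Fin 3 → ℝ) (hCs : ∀ i j k, C j i k = -C i j k)
    (htr : ∀ k, ∑ j, C k j j = 0) (c : ℝ)
    (hric : ∀ k l, c * (if k = l then 1 else 0) = -∑ i, ∑ j,
      (-C k i j - C k j i - C i j k) / 2 * ((-C l j i - C l i j - C j i l) / 2)) :
    (∃ v : Fin 3 → ℝ, v ≠ 0 ∧ ∀ i j, ∑ k, v k * C i j k = 0) ∨
      ∀ x y : Fin 3 → ℝ, ∑ k, ∑ j, ∑ i, y k * (y j * (x i * C i j k)) = 0 := by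
  have hC0 : ∀ i k, C i i k = 0 := fun i k => by linarith [hCs i i k]
  obtain ⟨M, hM⟩ : ∃ M : Fin 3 → Fin 3 → ℝ, ∀ k, C 1 2 k = M 0 k ∧ C 2 0 k = M 1 k ∧ C 0 1 k = M 2 k :=
    ⟨![C 1 2, C 2 0, C 0 1], fun k => ⟨rfl, rfl, rfl⟩⟩
  have c12 : ∀ k, C 1 2 k = M 0 k := fun k => (hM k).1
  have c20 : ∀ k, C 2 0 k = M 1 k := fun k => (hM k).2.1
  have c01 : ∀ k, C 0 1 k = M 2 k := fun k => (hM k).2.2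
  have c21 : ∀ k, C 2 1 k = -M 0 k := fun k => by rw [hCs 1 2, c12]
  have c02 : ∀ k, C 0 2 k = -M 1 k := fun k => by rw [hCs 2 0, c20]
  have c10 : ∀ k, C 1 0 k = -M 2 k := fun k => by rw [hCs 0 1, c01]
  have t0 := htr 0
  have t1 := htr 1
  have t2 := htr 2
  have r00 := hric 0 0
  have r11 := hric 1 1
  have r22 := hric 2 2
  have r01 := hric 0 1
  have r02 := hric 0 2
  have r12 := hric 1 2
  simp only [Fin.sum_univ_three, hC0, c12, c20, c01, c21, c02, c10] at t0 t1 t2 r00 r11 r22 r01 r02 r12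
  have s1 : M 1 0 = M 0 1 := by linarith
  have s2 : M 2 0 = M 0 2 := by linarith
  have s3 : M 2 1 = M 1 2 := by linarith
  simp only [s1, s2, s3, Fin.isValue, reduceIte, show (0 : Fin 3) ≠ 1 by decide,
    show (0 : Fin 3) ≠ 2 by decide, show (1 : Fin 3) ≠ 2 by decide] at r00 r11 r22 r01 r02 r12
  have key := det_eq_zero_or_scalar_of_adjugate (a := M 0 0) (b := M 1 1) (c := M 2 2)
    (f := M 0 1) (g := M 0 2) (h := M 1 2) (γ := c / 2)
    (by linear_combination (-1 / 2) * r00) (by linear_combination (-1 / 2) * r11)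
    (by linear_combination (-1 / 2) * r22) (by linear_combination (-1 / 2) * r01)
    (by linear_combination (-1 / 2) * r02) (by linear_combination (-1 / 2) * r12)
  clear r00 r11 r22 r01 r02 r12 t0 t1 t2 hric htr
  rcases key with hdet | ⟨z1, z2, z3, z4, z5⟩
  · left
    have hdet' : (Matrix.of M).det = 0 := by
      rw [Matrix.det_fin_three]
      simp only [Matrix.of_apply, s1, s2, s3]
      linarith
    obtain ⟨v, hv, hv'⟩ := Matrix.exists_mulVec_eq_zero_iff.2 hdet'
    have hv'' : ∀ i, ∑ k, v k * M i k = 0 := fun i => by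
      have := congrFun hv' i
      simp only [Matrix.mulVec, dotProduct, Matrix.of_apply, Pi.zero_apply] at this
      simpa only [mul_comm] using this
    refine ⟨v, hv, fun i j => ?_⟩
    fin_cases i <;> fin_cases j <;>
      simp only [Fin.zero_eta, Fin.mk_one, Fin.reduceFinMk, hC0, c12, c20, c01, c21, c02, c10,
        mul_neg, mul_zero, Finset.sum_neg_distrib, hv'', neg_zero, Finset.sum_const_zero]
  · right
    intro x y
    simp only [Fin.sum_univ_three, hC0, c12, c20, c01, c21, c02, c10, s1, s2, s3, z1, z2, z3, z4, z5]
    ring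

lemma sum_rotate {J : Type*} [Fintype J] (F : Fin 3 → Fin 3 → Fin 3 → J → ℝ) :
    ∑ k, ∑ l, ∑ m, ∑ j, F k l m j = ∑ j, ∑ l, ∑ m, ∑ k, F k l m j := by
  simp only [Fin.sum_univ_three, Finset.sum_add_distrib]
  ring

variable {L : Type*} [LieRing L] [LieAlgebra ℝ L] [FiniteDimensional ℝ L]
  {J : Type*} [Fintype J] [DecidableEq J]

namespace IsSplitFrame

variable {q : L →ₗ[ℝ] L →ₗ[ℝ] ℝ} {e : Fin 3 → L} {V : J → L} {ψ : J → Fin 3 → ℝ}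
  {κ : L →ₗ[ℝ] (Fin 3 → ℝ)}

lemma sum_connCoeff_ee (h : IsSplitFrame q e V ψ κ) :
    ∑ k, ∑ l, ∑ m, connCoeff q (frame e V ψ) (e k) (Sum.inl l) (Sum.inl m) *
      connCoeff q (frame e V ψ) (dualVec e V ψ k) (Sum.inl m) (Sum.inl l) =
    ∑ j, ∑ l, ∑ m, (tiltAd q e ψ j l m + tiltAd q e ψ j m l) ^ 2 / 4 := by
  have h1 : ∀ k l m, connCoeff q (frame e V ψ) (e k) (Sum.inl l) (Sum.inl m) *
      connCoeff q (frame e V ψ) (dualVec e V ψ k) (Sum.inl m) (Sum.inl l) =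
      ∑ j, (ψ j k * q (e m) ⁅e k, e l⁆ + ψ j k * q (e l) ⁅e k, e m⁆ + ψ j k * q (e k) ⁅e l, e m⁆)
        * (tiltAd q e ψ j l m + tiltAd q e ψ j m l) / 4 := by
    intro k l m
    rw [h.connCoeff_dualVec_ee, connCoeff, neg_div, mul_neg, mul_div_assoc', ← neg_div,
      Finset.mul_sum, ← Finset.sum_neg_distrib, Finset.sum_div]
    refine Finset.sum_congr rfl fun j _ => ?_
    simp only [Sum.elim_inl, h.form.symm ⁅e k, e l⁆]
    ring
  simp only [h1]
  rw [sum_rotate]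
  refine Finset.sum_congr rfl fun j _ => ?_
  simp only [← Finset.sum_div, ← Finset.sum_mul, Finset.sum_add_distrib, ← tiltAd_eq]
  have h2 : ∀ l m, ∑ k, ψ j k * q (e k) ⁅e m, e l⁆ = -∑ k, ψ j k * q (e k) ⁅e l, e m⁆ := by
    intro l m
    rw [← Finset.sum_neg_distrib]
    refine Finset.sum_congr rfl fun k _ => ?_
    rw [← lie_skew, map_neg]
    ring
  have h3 : ∀ l, ∑ k, ψ j k * q (e k) ⁅e l, e l⁆ = 0 := by simp
  congr 1
  generalize hN : (fun l m => ∑ k, ψ j k * q (e k) ⁅e l, e m⁆) = N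
  have hN' : ∀ l m, ∑ k, ψ j k * q (e k) ⁅e l, e m⁆ = N l m := fun l m => by rw [← hN]
  simp only [hN'] at h2 h3 ⊢
  simp only [Fin.sum_univ_three, h3, h2 1 0, h2 2 0, h2 2 1]
  simp only [h2 0 1, h2 0 2, h2 1 2]
  ring

lemma sum_connCoeff_ef (h : IsSplitFrame q e V ψ κ) :
    ∑ k, ∑ l, ∑ j, (connCoeff q (frame e V ψ) (e k) (Sum.inl l) (Sum.inr j) *
      connCoeff q (frame e V ψ) (dualVec e V ψ k) (Sum.inr j) (Sum.inl l) +
      connCoeff q (frame e V ψ) (e k) (Sum.inr j) (Sum.inl l) *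
      connCoeff q (frame e V ψ) (dualVec e V ψ k) (Sum.inl l) (Sum.inr j)) =
    ∑ l, ∑ i, ∑ j, (q (e l) ⁅V i, V j⁆ + q (e l) ⁅tilt e ψ i, tilt e ψ j⁆) *
      q (e l) ⁅tilt e ψ i, tilt e ψ j⁆ / 2 := by
  have h1 : ∀ k l j, connCoeff q (frame e V ψ) (e k) (Sum.inl l) (Sum.inr j) *
      connCoeff q (frame e V ψ) (dualVec e V ψ k) (Sum.inr j) (Sum.inl l) +
      connCoeff q (frame e V ψ) (e k) (Sum.inr j) (Sum.inl l) *
      connCoeff q (frame e V ψ) (dualVec e V ψ k) (Sum.inl l) (Sum.inr j) =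
      ∑ i, (q (e l) ⁅V i, V j⁆ + q (e l) ⁅tilt e ψ i, tilt e ψ j⁆) *
        (-(ψ i k * tiltAd q e ψ j l k)) / 2 := by
    intro k l j
    rw [h.connCoeff_e_ef, h.connCoeff_e_fe, h.connCoeff_dualVec_ef, h.connCoeff_dualVec_fe,
      ← add_mul, ← add_div, mul_div_assoc', ← Finset.sum_neg_distrib, Finset.mul_sum,
      Finset.sum_div]
    refine Finset.sum_congr rfl fun i _ => ?_
    ring
  simp only [h1]
  rw [Finset.sum_comm]
  refine Finset.sum_congr rfl fun l _ => ?_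
  have h2 : ∀ i j, q (e l) ⁅tilt e ψ i, tilt e ψ j⁆ = ∑ k, -(ψ i k * tiltAd q e ψ j l k) :=
    fun i j => by rw [q_tilt_tilt, Finset.sum_neg_distrib]
  have h3 : ∀ i j, (q (e l) ⁅V i, V j⁆ + q (e l) ⁅tilt e ψ i, tilt e ψ j⁆) *
      q (e l) ⁅tilt e ψ i, tilt e ψ j⁆ / 2 = ∑ k, (q (e l) ⁅V i, V j⁆ +
        q (e l) ⁅tilt e ψ i, tilt e ψ j⁆) * (-(ψ i k * tiltAd q e ψ j l k)) / 2 := by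
    intro i j
    rw [← Finset.sum_div, ← Finset.mul_sum, ← h2]
  simp only [h3]
  rw [Finset.sum_comm]
  conv_rhs => rw [Finset.sum_comm]
  refine Finset.sum_congr rfl fun j _ => Finset.sum_comm

lemma sum_connCoeff_ff (h : IsSplitFrame q e V ψ κ) (k : Fin 3) :
    ∑ i, ∑ j, connCoeff q (frame e V ψ) (e k) (Sum.inr i) (Sum.inr j) *
      connCoeff q (frame e V ψ) (dualVec e V ψ k) (Sum.inr j) (Sum.inr i) =
    ∑ i, ∑ j, (q (e k) ⁅V i, V j⁆ + q (e k) ⁅tilt e ψ i, tilt e ψ j⁆) *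
      q (e k) ⁅V i, V j⁆ / 4 := by
  have h1 : ∑ i, ∑ j, connCoeff q (frame e V ψ) (e k) (Sum.inr i) (Sum.inr j) *
      connCoeff q (frame e V ψ) (dualVec e V ψ k) (Sum.inr j) (Sum.inr i) =
      -∑ i, ∑ j, connCoeff q (frame e V ψ) (e k) (Sum.inr i) (Sum.inr j) *
      connCoeff q (frame e V ψ) (dualVec e V ψ k) (Sum.inr i) (Sum.inr j) := by
    conv_lhs => rw [Finset.sum_comm]
    rw [← Finset.sum_neg_distrib]
    refine Finset.sum_congr rfl fun i _ => ?_
    rw [← Finset.sum_neg_distrib]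
    refine Finset.sum_congr rfl fun j _ => ?_
    have e1 : ⁅V j, V i⁆ = -⁅V i, V j⁆ := (lie_skew _ _).symm
    have e2 : ⁅tilt e ψ j, tilt e ψ i⁆ = -⁅tilt e ψ i, tilt e ψ j⁆ := (lie_skew _ _).symm
    rw [h.connCoeff_e_ff, h.connCoeff_e_ff, e1, e2, map_neg, map_neg]
    ring
  have h2 : ∑ i, ∑ j, connCoeff q (frame e V ψ) (e k) (Sum.inr i) (Sum.inr j) *
      connCoeff q (frame e V ψ) (dualVec e V ψ k) (Sum.inr j) (Sum.inr i) =
      2⁻¹ * (∑ i, ∑ j, connCoeff q (frame e V ψ) (e k) (Sum.inr i) (Sum.inr j) *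
      connCoeff q (frame e V ψ) (dualVec e V ψ k) (Sum.inr j) (Sum.inr i) -
      ∑ i, ∑ j, connCoeff q (frame e V ψ) (e k) (Sum.inr i) (Sum.inr j) *
      connCoeff q (frame e V ψ) (dualVec e V ψ k) (Sum.inr i) (Sum.inr j)) := by linarith
  rw [h2]
  simp only [← Finset.sum_sub_distrib, Finset.mul_sum]
  refine Finset.sum_congr rfl fun i _ => Finset.sum_congr rfl fun j _ => ?_
  have e1 : ⁅V j, V i⁆ = -⁅V i, V j⁆ := (lie_skew _ _).symm
  rw [← mul_sub, h.connCoeff_dualVec_ff, h.connCoeff_e_ff, e1, map_neg]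
  ring

lemma sum_bracket_mul (hb : ∀ m n w, q ⁅∑ j, ψ j m • V j, ∑ j, ψ j n • V j⁆ w = 0)
    (hs : ∀ x y, q x y = q y x) (l : Fin 3) :
    ∑ i, ∑ j, q (e l) ⁅V i, V j⁆ * q (e l) ⁅tilt e ψ i, tilt e ψ j⁆ = 0 := by
  have h1 : ∀ i j, q (e l) ⁅tilt e ψ i, tilt e ψ j⁆ =
      ∑ m, ∑ n, ψ i m * ψ j n * q (e l) ⁅e m, e n⁆ := by
    intro i j
    simp only [tilt, sum_lie, lie_sum, smul_lie, lie_smul, map_sum, map_smul, smul_eq_mul,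
      Finset.mul_sum, mul_assoc]
    rw [Finset.sum_comm]
    exact Finset.sum_congr rfl fun x _ => Finset.sum_congr rfl fun y _ => mul_left_comm _ _ _
  have h2 : ∀ m n, ∑ i, ∑ j, ψ i m * ψ j n * q (e l) ⁅V i, V j⁆ = 0 := by
    intro m n
    rw [← hb m n (e l), hs]
    simp only [sum_lie, lie_sum, smul_lie, lie_smul, map_sum, map_smul, smul_eq_mul,
      Finset.mul_sum, mul_assoc]
    rw [Finset.sum_comm]
    exact Finset.sum_congr rfl fun x _ => Finset.sum_congr rfl fun y _ => mul_left_comm _ _ _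
  have h3 : ∑ i, ∑ j, q (e l) ⁅V i, V j⁆ * q (e l) ⁅tilt e ψ i, tilt e ψ j⁆ =
      ∑ m, ∑ n, q (e l) ⁅e m, e n⁆ * ∑ i, ∑ j, ψ i m * ψ j n * q (e l) ⁅V i, V j⁆ := by
    simp only [h1, Fin.sum_univ_three, Finset.mul_sum, ← Finset.sum_add_distrib]
    refine Finset.sum_congr rfl fun i _ => Finset.sum_congr rfl fun j _ => ?_
    ring
  rw [h3]
  simp [h2]

lemma sum_eq_zero_imp {α β γ : Type*} [Fintype α] [Fintype β] [Fintype γ] {F : α → β → γ → ℝ}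
    (hF : ∀ a b c, 0 ≤ F a b c) (h : ∑ a, ∑ b, ∑ c, F a b c = 0) (a : α) (b : β) (c : γ) :
    F a b c = 0 := by
  have h1 : ∀ a b, 0 ≤ ∑ c, F a b c := fun a b => Finset.sum_nonneg fun c _ => hF a b c
  have h2 : ∀ a, 0 ≤ ∑ b, ∑ c, F a b c := fun a => Finset.sum_nonneg fun b _ => h1 a b
  have h3 := (Finset.sum_eq_zero_iff_of_nonneg fun a _ => h2 a).1 h a (Finset.mem_univ a)
  have h4 := (Finset.sum_eq_zero_iff_of_nonneg fun b _ => h1 a b).1 h3 b (Finset.mem_univ b)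
  exact (Finset.sum_eq_zero_iff_of_nonneg fun c _ => hF a b c).1 h4 c (Finset.mem_univ c)

/-- If the Ricci curvature of `e k` and `dualVec k` vanishes, then the tilts act by skew maps on the
three-dimensional factor, and the brackets of the remaining frame vectors are orthogonal to it. -/
lemma rigid (h : IsSplitFrame q e V ψ κ)
    (hb : ∀ m n w, q ⁅∑ j, ψ j m • V j, ∑ j, ψ j n • V j⁆ w = 0)
    (hR : ∀ k, ∑ i, ∑ j, connCoeff q (frame e V ψ) (e k) i j *
      connCoeff q (frame e V ψ) (dualVec e V ψ k) j i = 0) :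
    (∀ j k l, tiltAd q e ψ j k l + tiltAd q e ψ j l k = 0) ∧
    (∀ k i j, q (e k) ⁅V i, V j⁆ + q (e k) ⁅tilt e ψ i, tilt e ψ j⁆ = 0) := by
  have h0 : ∑ k, ∑ i, ∑ j, connCoeff q (frame e V ψ) (e k) i j *
      connCoeff q (frame e V ψ) (dualVec e V ψ k) j i = 0 := Finset.sum_eq_zero fun k _ => hR k
  have h1 := h.sum_connCoeff_ee
  have h2 := h.sum_connCoeff_ef
  have h3 := Finset.sum_congr rfl fun k (_ : k ∈ (Finset.univ : Finset (Fin 3))) =>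
    h.sum_connCoeff_ff k
  have h4 : ∑ l, ∑ i, ∑ j, q (e l) ⁅V i, V j⁆ * q (e l) ⁅tilt e ψ i, tilt e ψ j⁆ = 0 :=
    Finset.sum_eq_zero fun l _ => sum_bracket_mul hb h.form.symm l
  simp only [Finset.sum_add_distrib] at h2
  rw [Finset.sum_congr rfl fun k (_ : k ∈ (Finset.univ : Finset (Fin 3))) =>
    Finset.sum_comm (f := fun l j => connCoeff q (frame e V ψ) (e k) (Sum.inr j) (Sum.inl l) *
      connCoeff q (frame e V ψ) (dualVec e V ψ k) (Sum.inl l) (Sum.inr j))] at h2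
  simp only [Fintype.sum_sum_type, Finset.sum_add_distrib] at h0
  have h5 : ∑ l, ∑ i, ∑ j, ((q (e l) ⁅V i, V j⁆ + q (e l) ⁅tilt e ψ i, tilt e ψ j⁆) *
      q (e l) ⁅tilt e ψ i, tilt e ψ j⁆ / 2) + ∑ l, ∑ i, ∑ j, ((q (e l) ⁅V i, V j⁆ +
      q (e l) ⁅tilt e ψ i, tilt e ψ j⁆) * q (e l) ⁅V i, V j⁆ / 4) =
      ∑ l, ∑ i, ∑ j, (q (e l) ⁅V i, V j⁆ ^ 2 / 4 + q (e l) ⁅tilt e ψ i, tilt e ψ j⁆ ^ 2 / 2) := by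
    have : ∀ l i j, (q (e l) ⁅V i, V j⁆ ^ 2 / 4 + q (e l) ⁅tilt e ψ i, tilt e ψ j⁆ ^ 2 / 2) =
      (q (e l) ⁅V i, V j⁆ + q (e l) ⁅tilt e ψ i, tilt e ψ j⁆) *
      q (e l) ⁅tilt e ψ i, tilt e ψ j⁆ / 2 + (q (e l) ⁅V i, V j⁆ +
      q (e l) ⁅tilt e ψ i, tilt e ψ j⁆) * q (e l) ⁅V i, V j⁆ / 4 -
      (3 / 4) * (q (e l) ⁅V i, V j⁆ * q (e l) ⁅tilt e ψ i, tilt e ψ j⁆) := by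
      intro l i j; ring
    simp only [this, Finset.sum_sub_distrib, Finset.sum_add_distrib, ← Finset.mul_sum, h4]
    ring
  have p1 : ∀ j l m, 0 ≤ (tiltAd q e ψ j l m + tiltAd q e ψ j m l) ^ 2 / 4 := fun j l m => by
    positivity
  have p2 : ∀ l i j, 0 ≤ q (e l) ⁅V i, V j⁆ ^ 2 / 4 +
      q (e l) ⁅tilt e ψ i, tilt e ψ j⁆ ^ 2 / 2 := fun l i j => by positivity
  have n1 : 0 ≤ ∑ j, ∑ l, ∑ m, (tiltAd q e ψ j l m + tiltAd q e ψ j m l) ^ 2 / 4 :=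
    Finset.sum_nonneg fun j _ => Finset.sum_nonneg fun l _ => Finset.sum_nonneg fun m _ => p1 j l m
  have n2 : 0 ≤ ∑ l, ∑ i, ∑ j, (q (e l) ⁅V i, V j⁆ ^ 2 / 4 +
      q (e l) ⁅tilt e ψ i, tilt e ψ j⁆ ^ 2 / 2) :=
    Finset.sum_nonneg fun j _ => Finset.sum_nonneg fun l _ => Finset.sum_nonneg fun m _ => p2 j l m
  constructor
  · intro j k l
    have := sum_eq_zero_imp p1 (by linarith) j k l
    have h6 : (tiltAd q e ψ j k l + tiltAd q e ψ j l k) ^ 2 = 0 := by linarith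
    exact pow_eq_zero_iff (two_ne_zero) |>.1 h6
  · intro k i j
    have := sum_eq_zero_imp p2 (by linarith) k i j
    have a1 : q (e k) ⁅V i, V j⁆ ^ 2 = 0 := by
      nlinarith [sq_nonneg (q (e k) ⁅V i, V j⁆), sq_nonneg (q (e k) ⁅tilt e ψ i, tilt e ψ j⁆)]
    have a2 : q (e k) ⁅tilt e ψ i, tilt e ψ j⁆ ^ 2 = 0 := by
      nlinarith [sq_nonneg (q (e k) ⁅V i, V j⁆), sq_nonneg (q (e k) ⁅tilt e ψ i, tilt e ψ j⁆)]
    rw [pow_eq_zero_iff two_ne_zero] at a1 a2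
    rw [a1, a2, add_zero]

lemma q_e_lie_e (h : IsSplitFrame q e V ψ κ) (i j k : Fin 3) : q (e k) ⁅e i, e j⁆ = κ ⁅e i, e j⁆ k := by
  rw [h.lie_e]
  simp [h.q_e_e, h.coord_e, Pi.single_apply]

/-- The adjoint action on the three-dimensional factor is trace free. -/
lemma sum_coord_lie_eq_zero (h : IsSplitFrame q e V ψ κ)
    (hperf : Submodule.span ℝ {m : L | ∃ x y : L, ⁅x, y⁆ = m} = ⊤) (k : Fin 3) :
    ∑ j, q (e j) ⁅e k, e j⁆ = 0 := by
  have hform : IsInvariantForm q (frame e V ψ) := h.form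
  have h1 := hform.sum_lie_eq_zero hperf (h.normalizes_e k)
  simp only [Fintype.sum_sum_type, Sum.elim_inl, Sum.elim_inr] at h1
  have h2 : ∀ j, q ⁅e k, V j + tilt e ψ j⁆ (V j + tilt e ψ j) = 0 := fun j => by
    rw [h.lie_e_f, h.q_lie_tilt_f]
  simp only [h2, Finset.sum_const_zero, add_zero] at h1
  simpa only [h.form.symm _ (e _)] using h1

/-- There is no Einstein metric: the Ricci curvatures cannot all be proportional to the metric. -/
theorem not_einstein (h : IsSplitFrame q e V ψ κ)
    (hperf : Submodule.span ℝ {m : L | ∃ x y : L, ⁅x, y⁆ = m} = ⊤)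
    (hb : ∀ m n w, q ⁅∑ j, ψ j m • V j, ∑ j, ψ j n • V j⁆ w = 0)
    (hperf' : ∀ v : Fin 3 → ℝ, (∀ i j, ∑ k, v k * κ ⁅e i, e j⁆ k = 0) → v = 0)
    (hroot : ∃ x y : Fin 3 → ℝ, y ≠ 0 ∧ ⁅∑ i, x i • e i, ∑ i, y i • e i⁆ = (2 : ℝ) • ∑ i, y i • e i)
    (c : ℝ) (hR : ∀ k, HasRicci q (frame e V ψ) (e k) (dualVec e V ψ k) (c * q (e k) (dualVec e V ψ k)))
    (hR' : ∀ k l, HasRicci q (frame e V ψ) (e k) (e l) (c * q (e k) (e l))) : False := by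
  have hform : IsInvariantForm q (frame e V ψ) := h.form
  obtain ⟨hD, hd⟩ := h.rigid hb fun k => by
    have := (hR k).eq hform hperf (h.normalizes_e k) (h.normalizes_dualVec k)
    rw [h.form.symm, h.q_dualVec_e, mul_zero] at this
    linarith
  have hric : ∀ k l, c * (if k = l then 1 else 0) =
      -∑ i, ∑ j, connCoeff q (frame e V ψ) (e k) (Sum.inl i) (Sum.inl j) *
      connCoeff q (frame e V ψ) (e l) (Sum.inl j) (Sum.inl i) := by
    intro k l
    have := (hR' k l).eq hform hperf (h.normalizes_e k) (h.normalizes_e l)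
    rw [h.q_e_e] at this
    simpa only [Fintype.sum_sum_type, h.connCoeff_e_ef, h.connCoeff_e_ff, hD, hd, neg_zero,
      zero_div, zero_mul, mul_zero, Finset.sum_const_zero, add_zero] using this
  have htr := h.sum_coord_lie_eq_zero hperf
  set C : Fin 3 → Fin 3 → Fin 3 → ℝ := fun i j k => q (e k) ⁅e i, e j⁆ with hC
  have hCs : ∀ i j k, C j i k = -C i j k := fun i j k => by
    simp only [hC]
    rw [← lie_skew, map_neg]
  have hC0 : ∀ i k, C i i k = 0 := fun i k => by simp [hC]
  have hcc : ∀ k i j, connCoeff q (frame e V ψ) (e k) (Sum.inl i) (Sum.inl j) =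
      (-C k i j - C k j i - C i j k) / 2 := by
    intro k i j
    simp only [connCoeff, Sum.elim_inl, hC, h.form.symm _ (e j)]
  simp only [hcc] at hric
  rcases det_eq_zero_or_scalar C hCs htr c hric with ⟨v, hv, hv'⟩ | hz
  · refine hv (hperf' v fun i j => ?_)
    simp only [← h.q_e_lie_e]
    exact hv' i j
  · obtain ⟨x, y, hy, hxy⟩ := hroot
    have e1 := congrArg (q (∑ i, y i • e i)) hxy
    have e2 : q (∑ i, y i • e i) (∑ i, y i • e i) = y 0 ^ 2 + y 1 ^ 2 + y 2 ^ 2 := by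
      simp [Fin.sum_univ_three, h.q_e_e]
      ring
    have e3 : q (∑ i, y i • e i) ⁅∑ i, x i • e i, ∑ i, y i • e i⁆ =
        ∑ k, ∑ j, ∑ i, y k * (y j * (x i * C i j k)) := by
      have e4 : ∀ k, q (e k) ⁅∑ i, x i • e i, ∑ i, y i • e i⁆ =
          ∑ j, ∑ i, y j * (x i * C i j k) := fun k => by
        simp only [sum_lie, lie_sum, smul_lie, lie_smul, map_sum, map_smul, smul_eq_mul, hC]
        simp only [Finset.mul_sum]
      rw [map_sum, LinearMap.sum_apply]
      refine Finset.sum_congr rfl fun k _ => ?_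
      rw [map_smul, LinearMap.smul_apply, e4, smul_eq_mul, Finset.mul_sum]
      simp only [Finset.mul_sum]
    rw [map_smul, e2, e3, hz, smul_eq_mul] at e1
    have e4 : y 0 ^ 2 + y 1 ^ 2 + y 2 ^ 2 = 0 := by linarith
    have y0 : y 0 = 0 := by nlinarith [sq_nonneg (y 0), sq_nonneg (y 1), sq_nonneg (y 2)]
    have y1 : y 1 = 0 := by nlinarith [sq_nonneg (y 0), sq_nonneg (y 1), sq_nonneg (y 2)]
    have y2 : y 2 = 0 := by nlinarith [sq_nonneg (y 0), sq_nonneg (y 1), sq_nonneg (y 2)]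
    apply hy
    funext i
    fin_cases i
    exacts [y0, y1, y2]

end IsSplitFrame

end RicciObstruction

/-! ### Orbit maps of smooth transitive actions -/

section OrbitMaps

open VectorField Filter Topology

variable {E : Type*} [NormedAddCommGroup E] [NormedSpace ℝ E] [FiniteDimensional ℝ E]
  {H : Type*} [TopologicalSpace H] {I : ModelWithCorners ℝ E H} [I.Boundaryless]
  {G : Type*} [TopologicalSpace G] [ChartedSpace H G] [Group G] [LieGroup I ∞ G]
  {E' : Type*} [NormedAddCommGroup E'] [NormedSpace ℝ E'] [FiniteDimensional ℝ E']
  {H' : Type*} [TopologicalSpace H'] {J : ModelWithCorners ℝ E' H'} [J.Boundaryless]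
  {M : Type*} [TopologicalSpace M] [ChartedSpace H' M] [IsManifold J ∞ M]

/-- The map `p : G → M` is the orbit map of a transitive action `τ` of `G` on `M`, and it is a
submersion (stated as the existence of smooth local sections). -/
structure IsHomogeneousMap (I : ModelWithCorners ℝ E H) (J : ModelWithCorners ℝ E' H')
    (τ : G → M → M) (p : G → M) : Prop where
  smooth : ContMDiff I J ∞ p
  surjective : Function.Surjective p
  act : ∀ a b, τ a (p b) = p (a * b)
  exists_section : ∀ a, ∃ σ : M → G, ContMDiffAt J I ∞ σ (p a) ∧ σ (p a) = a ∧
    ∀ᶠ y in 𝓝 (p a), p (σ y) = y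

namespace IsHomogeneousMap

variable {τ : G → M → M} {p : G → M}

lemma contMDiff_act (h : IsHomogeneousMap I J τ p) :
    ContMDiff (I.prod J) J ∞ (fun z : G × M => τ z.1 z.2) := by
  rintro ⟨a, x⟩
  obtain ⟨b, rfl⟩ := h.surjective x
  obtain ⟨σ, hσ, hσb, hσp⟩ := h.exists_section b
  have h1 : ContMDiffAt (I.prod J) J ∞ (fun z : G × M => p (z.1 * σ z.2)) (a, p b) := by
    refine h.smooth.contMDiffAt.comp _ (contMDiffAt_fst.mul ?_)
    exact ContMDiffAt.comp (a, p b) (g := σ) hσ contMDiffAt_snd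
  refine h1.congr_of_eventuallyEq ?_
  filter_upwards [continuous_snd.continuousAt.eventually hσp] with z hz
  rw [← h.act, hz]

lemma one_act (h : IsHomogeneousMap I J τ p) (x : M) : τ 1 x = x := by
  obtain ⟨b, rfl⟩ := h.surjective x
  rw [h.act, one_mul]

lemma contMDiff_act_left (h : IsHomogeneousMap I J τ p) (a : G) : ContMDiff J J ∞ (τ a) :=
  h.contMDiff_act.comp (contMDiff_const.prodMk contMDiff_id)

lemma mdifferentiable (h : IsHomogeneousMap I J τ p) : MDifferentiable I J p :=
  h.smooth.mdifferentiable (by simp)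

lemma mdifferentiable_act (h : IsHomogeneousMap I J τ p) (a : G) : MDifferentiable J J (τ a) :=
  (h.contMDiff_act_left a).mdifferentiable (by simp)

/-- The fundamental vector field of the action `τ` associated to `U`. -/
def fundamentalField (τ : G → M → M) (U : GroupLieAlgebra I G) (x : M) : TangentSpace J x :=
  (mfderiv I J (fun a => τ a x) 1 U : E')

lemma isSmoothField_fundamentalField (h : IsHomogeneousMap I J τ p) (U : GroupLieAlgebra I G) :
    IsSmoothField (I := J) (fundamentalField τ U : (x : M) → TangentSpace J x) := by
  refine (contMDiff_mfderiv_fst h.contMDiff_act 1 U).congr fun x => ?_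
  exact totalSpace_mk_eq (h.one_act x).symm _

lemma related_fundamentalField (h : IsHomogeneousMap I J τ p) (U : GroupLieAlgebra I G) :
    FieldRelated I J p (rightInvariantField U) (fundamentalField τ U) := fun a =>
  (mfderiv_chain (E := E) (E' := E) (E'' := E') (I := I) (J := I) (K := J) (x := (1 : G))
    (f := fun x => x * a) (g := p) (h := fun x => τ x (p a)) (fun z => h.act z a) (one_mul a)
    (h.mdifferentiable a) (mdifferentiable_rightMul a 1) (U : E)).symm

lemma mfderiv_leftInvariant (h : IsHomogeneousMap I J τ p) (X : GroupLieAlgebra I G) (a b : G) :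
    (mfderiv I J p (a * b) (mulInvariantVectorField X (a * b)) : E') =
      mfderiv J J (τ a) (p b) (mfderiv I J p b (mulInvariantVectorField X b) : E') := by
  have h1 := mfderiv_chain (E := E) (E' := E) (E'' := E') (I := I) (J := I) (K := J) (x := b)
    (f := fun x => a * x) (g := p) (h := fun x => p (a * x)) (fun z => rfl) rfl
    (h.mdifferentiable (a * b)) (mdifferentiable_leftMul a b) (mulInvariantVectorField X b : E)
  have h2 := mfderiv_chain (E := E) (E' := E') (E'' := E') (I := I) (J := J) (K := J) (x := b)
    (f := p) (g := τ a) (h := fun x => p (a * x)) (fun z => (h.act a z).symm) rfl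
    (h.mdifferentiable_act a (p b)) (h.mdifferentiable b) (mulInvariantVectorField X b : E)
  refine Eq.trans ?_ (h1.symm.trans h2)
  exact congrArg (fun v : E => (mfderiv I J p (a * b) v : E'))
    (mfderiv_mul_left_leftInvariantField X a b).symm

/-- The form induced on the Lie algebra of `G` by a metric on `M`. -/
def pullbackForm (g : SmoothMetric J M) (p : G → M) : E →L[ℝ] E →L[ℝ] ℝ :=
  let T : E →L[ℝ] E' := mfderiv I J p 1
  let B : E' →L[ℝ] E' →L[ℝ] ℝ := g.inner (p 1)
  B.bilinearComp T T

lemma pullbackForm_apply (g : SmoothMetric J M) (p : G → M) (U V : GroupLieAlgebra I G) :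
    pullbackForm (I := I) g p U V = g.inner (p 1) (mfderiv I J p 1 U) (mfderiv I J p 1 V) := rfl

lemma inner_eq_pullbackForm (h : IsHomogeneousMap I J τ p) {g : SmoothMetric J M}
    (hg : ∀ a, PreservesMetric g (τ a)) (a : G) (U V : GroupLieAlgebra I G) :
    g.inner (p a) (mfderiv I J p a (mulInvariantVectorField U a))
      (mfderiv I J p a (mulInvariantVectorField V a)) = pullbackForm (I := I) g p U V := by
  have h1 := h.mfderiv_leftInvariant U a 1
  have h2 := h.mfderiv_leftInvariant V a 1
  rw [IsOrbitMap.mfderiv_one] at h1 h2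
  have h3 := hg a (p 1) (mfderiv I J p 1 U) (mfderiv I J p 1 V)
  rw [pullbackForm_apply, ← h3]
  have key : ∀ b : G, b = a → ∀ x : M, x = p a → ∀ v w : E',
      (mfderiv I J p b (mulInvariantVectorField U b) : E') = v →
      (mfderiv I J p b (mulInvariantVectorField V b) : E') = w →
      g.inner (p a) (mfderiv I J p a (mulInvariantVectorField U a))
      (mfderiv I J p a (mulInvariantVectorField V a)) = g.inner x v w := by
    rintro b rfl x rfl v w rfl rfl
    rfl
  exact key (a * 1) (mul_one a) _ ((h.act a 1).trans (by rw [mul_one])) _ _ h1 h2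

theorem isOrbitMap (h : IsHomogeneousMap I J τ p) {g : SmoothMetric J M}
    (hg : ∀ a, PreservesMetric g (τ a)) :
    IsOrbitMap (I := I) g p (pullbackForm (I := I) g p) (fundamentalField τ) where
  smooth := h.smooth
  inner_eq := h.inner_eq_pullbackForm hg
  smooth_killing := h.isSmoothField_fundamentalField
  related := h.related_fundamentalField

/-- The projection to `M` of the element `X` of the Lie algebra is fixed by the stabilizer. -/
def IsFixed (I : ModelWithCorners ℝ E H) (J : ModelWithCorners ℝ E' H') [LieGroup I ∞ G]
    (p : G → M) (X : GroupLieAlgebra I G) : Prop :=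
  ∀ s, p s = p 1 → (mfderiv I J p s (mulInvariantVectorField X s) : E') = mfderiv I J p 1 X

lemma IsFixed.mfderiv_eq {X : GroupLieAlgebra I G} (hX : IsFixed I J p X)
    (h : IsHomogeneousMap I J τ p) {a b : G} (hab : p a = p b) :
    (mfderiv I J p a (mulInvariantVectorField X a) : E') =
      mfderiv I J p b (mulInvariantVectorField X b) := by
  have hs : p (a⁻¹ * b) = p 1 := by rw [← h.act, ← hab, h.act, inv_mul_cancel]
  have h1 := h.mfderiv_leftInvariant X a (a⁻¹ * b)
  have h2 := h.mfderiv_leftInvariant X a 1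
  have h3 := hX _ hs
  rw [← IsOrbitMap.mfderiv_one] at h3
  have key : ∀ (c d : G) (x : M), c = b → d = a → x = p 1 → ∀ v : E',
      (mfderiv I J p c (mulInvariantVectorField X c) : E') = mfderiv J J (τ a) x v →
      (mfderiv I J p d (mulInvariantVectorField X d) : E') = mfderiv J J (τ a) (p 1) v →
      (mfderiv I J p a (mulInvariantVectorField X a) : E') =
        mfderiv I J p b (mulInvariantVectorField X b) := by
    rintro c d x rfl rfl rfl v h1 h2
    exact h2.trans h1.symm
  refine key _ _ _ (mul_inv_cancel_left a b) (mul_one a) hs _ (h1.trans ?_) h2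
  exact congrArg (fun v : E' => (mfderiv J J (τ a) (p (a⁻¹ * b)) v : E')) h3

/-- The vector field on `M` invariant under the action, induced by a fixed vector. -/
def invariantField (h : IsHomogeneousMap I J τ p) (X : GroupLieAlgebra I G) (x : M) :
    TangentSpace J x :=
  (mfderiv I J p (Function.surjInv h.surjective x)
    (mulInvariantVectorField X (Function.surjInv h.surjective x)) : E')

lemma related_invariantField (h : IsHomogeneousMap I J τ p) {X : GroupLieAlgebra I G}
    (hX : IsFixed I J p X) :
    FieldRelated I J p (mulInvariantVectorField X) (h.invariantField X) := fun a =>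
  hX.mfderiv_eq h (Function.surjInv_eq h.surjective (p a)).symm

lemma isSmoothField_invariantField (h : IsHomogeneousMap I J τ p) {X : GroupLieAlgebra I G}
    (hX : IsFixed I J p X) : IsSmoothField (h.invariantField X) := by
  intro x
  obtain ⟨a, rfl⟩ := h.surjective x
  obtain ⟨σ, hσ, hσa, hσp⟩ := h.exists_section a
  have h2 : ContMDiff I J.tangent ∞
      (fun b => (⟨p b, mfderiv I J p b (mulInvariantVectorField X b)⟩ : TangentBundle J M)) :=
    (h.smooth.contMDiff_tangentMap (m := ∞) (by simp)).comp (contMDiff_leftInvariantField X)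
  have h3 : ContMDiffAt J J.tangent ∞ (fun y => (⟨p (σ y),
      mfderiv I J p (σ y) (mulInvariantVectorField X (σ y))⟩ : TangentBundle J M)) (p a) :=
    ContMDiffAt.comp (p a) (g := fun b => (⟨p b, mfderiv I J p b (mulInvariantVectorField X b)⟩ :
      TangentBundle J M)) (h2 (σ (p a))) hσ
  refine h3.congr_of_eventuallyEq ?_
  filter_upwards [hσp] with y hy
  have h4 := h.related_invariantField hX (σ y)
  have key : ∀ z : M, z = y → ∀ v : E', v = h.invariantField X z →
    (⟨y, h.invariantField X y⟩ : TangentBundle J M) = ⟨z, v⟩ := by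
    rintro z rfl v rfl
    rfl
  exact key _ hy _ h4

lemma mfderiv_adInv_of_stabilizer (h : IsHomogeneousMap I J τ p) (X : GroupLieAlgebra I G) {s : G}
    (hs : p s = p 1) : (mfderiv I J p s (mulInvariantVectorField (adInv X s) s) : E') =
      mfderiv I J p 1 X := by
  have h1 := h.related_fundamentalField X s
  have h2 := h.related_fundamentalField X 1
  rw [← mulInvariantVectorField_adInv] at h1
  rw [← mulInvariantVectorField_adInv, adInv_one, IsOrbitMap.mfderiv_one] at h2
  refine h1.trans (Eq.trans ?_ h2.symm)
  rw [hs]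

/-- A vector of the Lie algebra which is centralized by the stabilizer is fixed. -/
lemma isFixed_of_adInv (h : IsHomogeneousMap I J τ p) {X : GroupLieAlgebra I G}
    (hX : ∀ s, p s = p 1 → adInv X s = X) : IsFixed I J p X := fun s hs => by
  rw [← h.mfderiv_adInv_of_stabilizer X hs, hX s hs]

end IsHomogeneousMap

end OrbitMaps

/-! ### Brackets of vectors fixed by the stabilizer -/

section FixedBrackets

open VectorField Filter Topology

variable {E : Type*} [NormedAddCommGroup E] [NormedSpace ℝ E] [FiniteDimensional ℝ E]
  {H : Type*} [TopologicalSpace H] {I : ModelWithCorners ℝ E H} [I.Boundaryless]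
  {G : Type*} [TopologicalSpace G] [ChartedSpace H G] [Group G] [LieGroup I ∞ G]
  {E' : Type*} [NormedAddCommGroup E'] [NormedSpace ℝ E'] [FiniteDimensional ℝ E']
  {H' : Type*} [TopologicalSpace H'] {J : ModelWithCorners ℝ E' H'} [J.Boundaryless]
  {M : Type*} [TopologicalSpace M] [ChartedSpace H' M] [IsManifold J ∞ M]

section related

variable {M₁ : Type*} [TopologicalSpace M₁] [ChartedSpace H M₁]

/-- The image of an integral curve under a map relating two vector fields. -/
lemma IsMIntegralCurveOn.comp_related {γ : ℝ → M₁} {V : (a : M₁) → TangentSpace I a}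
    {W : (x : M) → TangentSpace J x} {p : M₁ → M} {s : Set ℝ} (hγ : IsMIntegralCurveOn γ V s)
    (hp : MDifferentiable I J p) (h : FieldRelated I J p V W) :
    IsMIntegralCurveOn (p ∘ γ) W s := by
  intro t ht
  have h1 := (hp (γ t)).hasMFDerivAt.comp_hasMFDerivWithinAt t (hγ t ht)
  have h2 : ((mfderiv I J p (γ t) : E →L[ℝ] E').comp ((1 : ℝ →L[ℝ] ℝ).smulRight (V (γ t) : E)) :
      ℝ →L[ℝ] E') = (1 : ℝ →L[ℝ] ℝ).smulRight (W (p (γ t)) : E') := by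
    ext
    exact (congrArg (fun v : E => (mfderiv I J p (γ t) v : E')) (one_smul ℝ (V (γ t) : E))).trans
      ((h (γ t)).trans (one_smul ℝ (W (p (γ t)) : E')).symm)
  exact h2 ▸ h1

end related

lemma mulInvariantVectorField_one (X : GroupLieAlgebra I G) :
    (mulInvariantVectorField X (1 : G) : E) = X := by
  have e : (fun x : G => 1 * x) = id := by funext x; simp
  have e2 : mfderiv I I (fun x : G => 1 * x) 1 = mfderiv I I id (1 : G) := by rw [e]
  exact congrArg (fun T : E →L[ℝ] E => T X) (e2.trans mfderiv_id)

lemma fieldRelated_mulLeft (X : GroupLieAlgebra I G) (a : G) :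
    FieldRelated I I (fun x => a * x) (mulInvariantVectorField X)
      (mulInvariantVectorField X : (a : G) → TangentSpace I a) :=
  fun b => mfderiv_mul_left_leftInvariantField X a b

namespace IsHomogeneousMap

variable {τ : G → M → M} {p : G → M}

lemma fieldRelated_act (h : IsHomogeneousMap I J τ p) {X : GroupLieAlgebra I G}
    (hX : IsFixed I J p X) (a : G) :
    FieldRelated J J (τ a) (h.invariantField X) (h.invariantField X) := by
  intro x
  obtain ⟨b, rfl⟩ := h.surjective x
  have h1 := h.mfderiv_leftInvariant X a b
  have h2 := h.related_invariantField hX b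
  have h3 := h.related_invariantField hX (a * b)
  rw [h2, h3] at h1
  rw [h.act]
  exact h1.symm

/-- The element `n` normalizes the stabilizer of the base point. -/
def NormalizesStabilizer (p : G → M) (n : G) : Prop :=
  ∀ s, p s = p 1 → p (s * n) = p n ∧ p (s * n⁻¹) = p n⁻¹

/-- A vector fixed by the stabilizer is the velocity of a curve in the normalizer. -/
lemma exists_curve [T2Space G] [T2Space M] (h : IsHomogeneousMap I J τ p)
    {X : GroupLieAlgebra I G} (hX : IsFixed I J p X) :
    ∃ n : ℝ → G, n 0 = 1 ∧ MDifferentiableAt 𝓘(ℝ) I n 0 ∧ (mfderiv 𝓘(ℝ) I n 0 (1 : ℝ) : E) = X ∧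
      ∀ᶠ t in 𝓝 0, NormalizesStabilizer p (n t) := by
  have : CompleteSpace E := FiniteDimensional.complete ℝ E
  have : IsManifold I 1 G := IsManifold.of_le (n := ∞) (by simp)
  have : IsManifold J 1 M := IsManifold.of_le (n := ∞) (by simp)
  have hL : ContMDiff I I.tangent 1
      (fun g => (⟨g, mulInvariantVectorField X g⟩ : TangentBundle I G)) :=
    (contMDiff_leftInvariantField X).of_le (by simp)
  have hB : ContMDiff J J.tangent 1 (fun x => (⟨x, h.invariantField X x⟩ : TangentBundle J M)) :=
    ContMDiff.of_le (n := ∞) (h.isSmoothField_invariantField hX) (by simp)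
  obtain ⟨n, hn0, hn⟩ := exists_isMIntegralCurveAt_of_contMDiffAt_boundaryless (t₀ := 0)
    (hL.contMDiffAt (x := 1))
  have hd := hn.hasMFDerivAt
  obtain ⟨ε, hε, hn⟩ := isMIntegralCurveAt_iff'.1 hn
  rw [Real.ball_eq_Ioo, zero_sub, zero_add] at hn
  have h0 : (0 : ℝ) ∈ Set.Ioo (-ε) ε := ⟨by linarith, hε⟩
  have hfix : ∀ s, p s = p 1 → ∀ t ∈ Set.Ioo (-ε) ε, p (s * n t) = p (n t) := by
    intro s hs
    have c1 := hn.comp_related h.mdifferentiable (h.related_invariantField hX)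
    have c2 := c1.comp_related (h.mdifferentiable_act s) (h.fieldRelated_act hX s)
    have c3 := isMIntegralCurveOn_Ioo_eqOn_of_contMDiff_boundaryless h0 hB c2 c1 (by
      simp only [Function.comp_apply, hn0, h.act, mul_one, hs])
    intro t ht
    have := c3 ht
    simpa only [Function.comp_apply, h.act] using this
  have hinv : ∀ t ∈ Set.Ioo (-(ε / 2)) (ε / 2), (n t)⁻¹ = n (-t) := by
    intro t ht
    have c1 := (hn.comp_add t).comp_related (mdifferentiable_leftMul (n t)⁻¹)
      (fieldRelated_mulLeft X (n t)⁻¹)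
    have c2 := c1.mono (s' := Set.Ioo (-(ε / 2)) (ε / 2)) (fun s hs => by
      simp only [Set.mem_ofPred_eq, Set.mem_Ioo] at hs ht ⊢
      constructor <;> linarith)
    have c3 := hn.mono (s' := Set.Ioo (-(ε / 2)) (ε / 2)) (fun s hs => by
      simp only [Set.mem_Ioo] at hs ⊢
      constructor <;> linarith)
    have c4 := isMIntegralCurveOn_Ioo_eqOn_of_contMDiff_boundaryless
      (show (0 : ℝ) ∈ Set.Ioo (-(ε / 2)) (ε / 2) from ⟨by linarith, by linarith⟩) hL c2 c3 (by
      simp [hn0])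
    have c5 := c4 (show -t ∈ Set.Ioo (-(ε / 2)) (ε / 2) from ⟨by linarith [ht.2], by linarith [ht.1]⟩)
    simpa [hn0] using c5
  refine ⟨n, hn0, hd.mdifferentiableAt, ?_, ?_⟩
  · rw [hd.mfderiv]
    have e : (mulInvariantVectorField X (n 0) : E) = X := by
      rw [hn0]
      exact mulInvariantVectorField_one X
    exact (one_smul ℝ (mulInvariantVectorField X (n 0) : E)).trans e
  · filter_upwards [Ioo_mem_nhds (show -(ε / 2) < (0 : ℝ) by linarith) (show 0 < ε / 2 by linarith)]
      with t ht s hs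
    refine ⟨hfix s hs t ⟨by linarith [ht.1], by linarith [ht.2]⟩, ?_⟩
    rw [hinv t ht]
    exact hfix s hs (-t) ⟨by linarith [ht.2], by linarith [ht.1]⟩

/-- If the normalizer of the stabilizer is abelian modulo the stabilizer, then the bracket of two
fixed vectors is tangent to the stabilizer. -/
theorem mfderiv_lie_eq_zero [T2Space G] [T2Space M] (h : IsHomogeneousMap I J τ p)
    (hN : ∀ n m, NormalizesStabilizer p n → NormalizesStabilizer p m → p (n * m) = p (m * n))
    {X Y : GroupLieAlgebra I G} (hX : IsFixed I J p X) (hY : IsFixed I J p Y) :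
    (mfderiv I J p 1 (⁅X, Y⁆ : GroupLieAlgebra I G) : E') = 0 := by
  obtain ⟨n, hn0, hnd, hn', hn⟩ := h.exists_curve hX
  obtain ⟨m, hm0, hmd, hm', hm⟩ := h.exists_curve hY
  let T : E →L[ℝ] E' := mfderiv I J p 1
  have hpm : ∀ a, NormalizesStabilizer p a → T (adInvE Y a) = T Y := by
    intro a ha
    have e1 : (fun s => p (a⁻¹ * m s * a)) =ᶠ[𝓝 0] fun s => p (m s) := by
      filter_upwards [hm] with s hs
      rw [mul_assoc, ← h.act, hN _ _ hs ha, h.act, inv_mul_cancel_left]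
    have hc : MDifferentiable I J (fun x => p (a⁻¹ * x * a)) :=
      h.mdifferentiable.comp (mdifferentiable_conj a)
    have d1 := mfderiv_chain (E := ℝ) (E' := E) (E'' := E') (I := 𝓘(ℝ)) (J := I) (K := J)
      (x := (0 : ℝ)) (f := m) (g := p) (h := fun s => p (m s)) (fun _ => rfl) hm0
      (h.mdifferentiable 1) hmd (1 : ℝ)
    have d2 := mfderiv_chain (E := ℝ) (E' := E) (E'' := E') (I := 𝓘(ℝ)) (J := I) (K := J)
      (x := (0 : ℝ)) (f := m) (g := fun x => p (a⁻¹ * x * a)) (h := fun s => p (a⁻¹ * m s * a))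
      (fun _ => rfl) hm0 (hc 1) hmd (1 : ℝ)
    have d3 := mfderiv_chain (E := E) (E' := E) (E'' := E') (I := I) (J := I) (K := J)
      (x := (1 : G)) (f := fun x => a⁻¹ * x * a) (g := p) (h := fun x => p (a⁻¹ * x * a))
      (fun _ => rfl) (by group) (h.mdifferentiable 1) (mdifferentiable_conj a 1) (Y : E)
    have d4 : (mfderiv 𝓘(ℝ) J (fun s => p (a⁻¹ * m s * a)) 0 (1 : ℝ) : E') =
        mfderiv 𝓘(ℝ) J (fun s => p (m s)) 0 (1 : ℝ) :=
      congrArg (fun S : ℝ →L[ℝ] E' => S 1) e1.mfderiv_eq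
    have d5 : (mfderiv I J (fun x => p (a⁻¹ * x * a)) 1 (mfderiv 𝓘(ℝ) I m 0 (1 : ℝ) : E) : E') =
        mfderiv I J (fun x => p (a⁻¹ * x * a)) 1 Y :=
      congrArg (fun v : E => (mfderiv I J (fun x => p (a⁻¹ * x * a)) 1 v : E')) hm'
    have d6 : (mfderiv I J p 1 (mfderiv 𝓘(ℝ) I m 0 (1 : ℝ) : E) : E') = mfderiv I J p 1 Y :=
      congrArg (fun v : E => (mfderiv I J p 1 v : E')) hm'
    exact d3.symm.trans (d5.symm.trans (d2.symm.trans (d4.trans (d1.trans d6))))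
  have e2 : (fun t => T (adInvE Y (n t))) =ᶠ[𝓝 0] fun _ => T Y := by
    filter_upwards [hn] with t ht using hpm _ ht
  have e3 := congrArg (fun S : ℝ →L[ℝ] E' => S 1) (e2.mfderiv_eq (I := 𝓘(ℝ)) (I' := 𝓘(ℝ, E')))
  rw [mfderiv_const] at e3
  have e4 := mfderiv_chain (E := ℝ) (E' := E) (E'' := E') (I := 𝓘(ℝ)) (J := I) (K := 𝓘(ℝ, E'))
      (x := (0 : ℝ)) (f := n) (g := fun a => T (adInvE Y a)) (h := fun t => T (adInvE Y (n t)))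
      (fun _ => rfl) hn0
      ((T.contDiff.contMDiff.comp (contMDiff_adInvE Y)).mdifferentiable (n := ∞) (by simp) 1) hnd
      (1 : ℝ)
  have e5 : (mfderiv I 𝓘(ℝ, E') (fun a => T (adInvE Y a)) 1 (mfderiv 𝓘(ℝ) I n 0 (1 : ℝ) : E) : E') =
      mvfderiv I (fun a => T (adInvE Y a)) 1 (mulInvariantVectorField X (1 : G)) :=
    congrArg (fun v : E => (mfderiv I 𝓘(ℝ, E') (fun a => T (adInvE Y a)) 1 v : E'))
      (hn'.trans (mulInvariantVectorField_one X).symm)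
  have e6 : mvfderiv I (fun a => T (adInvE Y a)) 1 (mulInvariantVectorField X (1 : G)) =
      T (-⁅X, adInv Y 1⁆ : GroupLieAlgebra I G) :=
    (mvfderiv_clm_comp T (mdifferentiable_adInvE Y 1) _).trans
      (congrArg T (mvfderiv_adInvE Y X 1))
  have e7 : T (-⁅X, adInv Y 1⁆ : GroupLieAlgebra I G) = 0 :=
    e6.symm.trans (e5.symm.trans (e4.symm.trans e3))
  rw [adInv_one] at e7
  exact neg_eq_zero.1 ((map_neg T _).symm.trans e7)

end IsHomogeneousMap

end FixedBrackets

/-! ### The Lie algebra of a product, and of `SL(2, ℝ)` -/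

section ProductLieAlgebra

open VectorField

variable {E : Type*} [NormedAddCommGroup E] [NormedSpace ℝ E] [FiniteDimensional ℝ E]
  {H : Type*} [TopologicalSpace H] {I : ModelWithCorners ℝ E H} [I.Boundaryless]
  {G : Type*} [TopologicalSpace G] [ChartedSpace H G] [Group G] [LieGroup I ∞ G]
  {E' : Type*} [NormedAddCommGroup E'] [NormedSpace ℝ E'] [FiniteDimensional ℝ E']
  {H' : Type*} [TopologicalSpace H'] {I' : ModelWithCorners ℝ E' H'} [I'.Boundaryless]
  {G' : Type*} [TopologicalSpace G'] [ChartedSpace H' G'] [Group G'] [LieGroup I' ∞ G']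

/-- An element of the Lie algebra of a product of Lie groups. -/
def GroupLieAlgebra.pair (u : GroupLieAlgebra I G) (v : GroupLieAlgebra I' G') :
    GroupLieAlgebra (I.prod I') (G × G') := ((u, v) : E × E')

lemma GroupLieAlgebra.mulInvariantVectorField_pair (u : GroupLieAlgebra I G)
    (v : GroupLieAlgebra I' G') :
    mulInvariantVectorField (GroupLieAlgebra.pair u v) =
      prodField (mulInvariantVectorField u : (a : G) → TangentSpace I a)
        (mulInvariantVectorField v : (a : G') → TangentSpace I' a) := by
  funext a
  have h := mfderiv_prodMap (p := (1 : G × G')) (mdifferentiable_leftMul (I := I) a.1 1)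
    (mdifferentiable_leftMul (I := I') a.2 1)
  exact congrArg (fun T : E × E' →L[ℝ] E × E' => T (u, v)) h

lemma GroupLieAlgebra.pair_lie_pair (u u' : GroupLieAlgebra I G) (v v' : GroupLieAlgebra I' G') :
    ⁅GroupLieAlgebra.pair u v, GroupLieAlgebra.pair u' v'⁆ =
      GroupLieAlgebra.pair ⁅u, u'⁆ ⁅v, v'⁆ := by
  have : CompleteSpace E := FiniteDimensional.complete ℝ E
  have : CompleteSpace E' := FiniteDimensional.complete ℝ E'
  have hL := fun u : GroupLieAlgebra I G => (contMDiff_leftInvariantField u).of_le (m := 1) (by simp)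
  have hL' := fun u : GroupLieAlgebra I' G' =>
    (contMDiff_leftInvariantField u).of_le (m := 1) (by simp)
  rw [GroupLieAlgebra.bracket_def, GroupLieAlgebra.mulInvariantVectorField_pair,
    GroupLieAlgebra.mulInvariantVectorField_pair,
    mlieBracket_prodField (hL u) (hL' v) (hL u') (hL' v')]
  rfl

end ProductLieAlgebra

lemma LieAlgebra.IsSemisimple.span_lie_eq_top {L : Type*} [LieRing L] [LieAlgebra ℝ L]
    (h : LieAlgebra.IsSemisimple ℝ L) : Submodule.span ℝ {m : L | ∃ x y : L, ⁅x, y⁆ = m} = ⊤ := by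
  have h1 : ⁅(⊤ : LieIdeal ℝ L), (⊤ : LieIdeal ℝ L)⁆ = ⊤ := by
    refine eq_top_iff.2 (h.sSup_atoms_eq_top.symm.le.trans (sSup_le fun K hK => ?_))
    have h2 : ⁅K, K⁆ = K := by
      refine (hK.le_iff.1 (LieSubmodule.lie_le_right K K)).resolve_left fun h3 => ?_
      exact h.non_abelian_of_isAtom K hK ((LieSubmodule.lie_abelian_iff_lie_self_eq_bot K).2 h3)
    rw [← h2]
    exact LieSubmodule.mono_lie le_top le_top
  have h3 := congrArg LieSubmodule.toSubmodule h1
  rw [LieSubmodule.lieIdeal_oper_eq_linear_span] at h3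
  rw [← LieSubmodule.top_toSubmodule (R := ℝ) (L := L) (M := L), ← h3]
  congr 1
  ext m
  constructor
  · rintro ⟨x, y, rfl⟩
    exact ⟨⟨x, trivial⟩, ⟨y, trivial⟩, rfl⟩
  · rintro ⟨x, y, rfl⟩
    exact ⟨x, y, rfl⟩

lemma mlieBracket_linear {F : Type*} [NormedAddCommGroup F] [NormedSpace ℝ F] (S T : F →L[ℝ] F)
    (x : F) : (VectorField.mlieBracket 𝓘(ℝ, F) (fun y : F => (S y : TangentSpace 𝓘(ℝ, F) y))
      (fun y : F => (T y : TangentSpace 𝓘(ℝ, F) y)) x : F) = T (S x) - S (T x) := by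
  have h0 : ∀ V W : (y : F) → TangentSpace 𝓘(ℝ, F) y,
      VectorField.mlieBracket 𝓘(ℝ, F) V W = VectorField.lieBracket ℝ V W := fun V W => by
    rw [← VectorField.mlieBracketWithin_univ, VectorField.mlieBracketWithin_eq_lieBracketWithin]
    exact VectorField.lieBracketWithin_univ
  have h : VectorField.lieBracket ℝ S T x = T (S x) - S (T x) := by
    rw [VectorField.lieBracket, S.fderiv, T.fderiv]
  exact (congrFun (h0 _ _) x).trans h

namespace SLTwo

open VectorField

/-- The entries of a matrix in `SL(2, ℝ)`. -/
def entries (A : SL(2, ℝ)) : Fin 2 → Fin 2 → ℝ := fun i j => A i j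

lemma contMDiff_entries : ContMDiff 𝓘(ℝ, ℝ × ℝ × ℝ) 𝓘(ℝ, Fin 2 → Fin 2 → ℝ) ∞ entries :=
  contMDiff_pi_space.2 fun i => contMDiff_pi_space.2 fun j => contMDiff_entry ∞ i j

/-- The matrix of an element of the Lie algebra of `SL(2, ℝ)`. -/
def toMatrix (X : GroupLieAlgebra 𝓘(ℝ, ℝ × ℝ × ℝ) SL(2, ℝ)) : Matrix (Fin 2) (Fin 2) ℝ :=
  (mfderiv 𝓘(ℝ, ℝ × ℝ × ℝ) 𝓘(ℝ, Fin 2 → Fin 2 → ℝ) entries 1 X : Fin 2 → Fin 2 → ℝ)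

/-- Multiplication by a matrix on the right. -/
def mulRightCLM (B : Matrix (Fin 2) (Fin 2) ℝ) :
    (Fin 2 → Fin 2 → ℝ) →L[ℝ] (Fin 2 → Fin 2 → ℝ) :=
  LinearMap.toContinuousLinearMap (LinearMap.mulRight ℝ B :
    Matrix (Fin 2) (Fin 2) ℝ →ₗ[ℝ] Matrix (Fin 2) (Fin 2) ℝ)

/-- Multiplication by a matrix on the left. -/
def mulLeftCLM (B : Matrix (Fin 2) (Fin 2) ℝ) :
    (Fin 2 → Fin 2 → ℝ) →L[ℝ] (Fin 2 → Fin 2 → ℝ) :=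
  LinearMap.toContinuousLinearMap (LinearMap.mulLeft ℝ B :
    Matrix (Fin 2) (Fin 2) ℝ →ₗ[ℝ] Matrix (Fin 2) (Fin 2) ℝ)

lemma fieldRelated_entries (X : GroupLieAlgebra 𝓘(ℝ, ℝ × ℝ × ℝ) SL(2, ℝ)) :
    FieldRelated 𝓘(ℝ, ℝ × ℝ × ℝ) 𝓘(ℝ, Fin 2 → Fin 2 → ℝ) entries (mulInvariantVectorField X)
      (fun A => mulRightCLM (toMatrix X) A) := by
  intro A
  have hd : MDifferentiable 𝓘(ℝ, ℝ × ℝ × ℝ) 𝓘(ℝ, Fin 2 → Fin 2 → ℝ) entries :=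
    contMDiff_entries.mdifferentiable (by simp)
  have h1 := mfderiv_chain (E := ℝ × ℝ × ℝ) (E' := ℝ × ℝ × ℝ) (E'' := Fin 2 → Fin 2 → ℝ)
    (I := 𝓘(ℝ, ℝ × ℝ × ℝ)) (J := 𝓘(ℝ, ℝ × ℝ × ℝ)) (K := 𝓘(ℝ, Fin 2 → Fin 2 → ℝ)) (x := (1 : SL(2, ℝ)))
    (f := fun x => A * x) (g := entries) (h := fun x => entries (A * x)) (fun z => rfl) (mul_one A)
    (hd A) (mdifferentiable_leftMul A 1) X
  have h2 := mfderiv_chain (E := ℝ × ℝ × ℝ) (E' := Fin 2 → Fin 2 → ℝ) (E'' := Fin 2 → Fin 2 → ℝ)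
    (I := 𝓘(ℝ, ℝ × ℝ × ℝ)) (J := 𝓘(ℝ, Fin 2 → Fin 2 → ℝ)) (K := 𝓘(ℝ, Fin 2 → Fin 2 → ℝ))
    (x := (1 : SL(2, ℝ)))
    (f := entries) (g := mulLeftCLM (A : Matrix (Fin 2) (Fin 2) ℝ))
    (h := fun x => entries (A * x)) (fun z => by
      exact Matrix.SpecialLinearGroup.coe_mul A z) rfl
    (mulLeftCLM _).mdifferentiableAt (hd 1) X
  rw [ContinuousLinearMap.mfderiv_eq] at h2
  exact h1.symm.trans h2

lemma toMatrix_lie (X Y : GroupLieAlgebra 𝓘(ℝ, ℝ × ℝ × ℝ) SL(2, ℝ)) :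
    toMatrix ⁅X, Y⁆ = toMatrix X * toMatrix Y - toMatrix Y * toMatrix X := by
  have hW : ∀ X, IsSmoothField (I := 𝓘(ℝ, Fin 2 → Fin 2 → ℝ)) (M := Fin 2 → Fin 2 → ℝ)
      (fun A => mulRightCLM (toMatrix X) A) := fun X =>
    contMDiff_vectorSpace_iff_contDiff.2 (mulRightCLM (toMatrix X)).contDiff
  have h1 := (fieldRelated_entries X).mlieBracket contMDiff_entries (fieldRelated_entries Y)
    (contMDiff_leftInvariantField X) (contMDiff_leftInvariantField Y) (hW X) (hW Y) 1
  let e : Matrix (Fin 2) (Fin 2) ℝ := entries 1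
  have he : e = 1 := Matrix.SpecialLinearGroup.coe_one
  have h5 : toMatrix ⁅X, Y⁆ = e * toMatrix X * toMatrix Y - e * toMatrix Y * toMatrix X :=
    Eq.trans h1 (mlieBracket_linear (mulRightCLM (toMatrix X)) (mulRightCLM (toMatrix Y)) (entries 1))
  rw [h5, he, one_mul, one_mul]

lemma toMatrix_entries (X : GroupLieAlgebra 𝓘(ℝ, ℝ × ℝ × ℝ) SL(2, ℝ)) :
    ((toMatrix X 0 0, toMatrix X 0 1, toMatrix X 1 0) : ℝ × ℝ × ℝ) = X := by
  let ev : Fin 2 → Fin 2 → ((Fin 2 → Fin 2 → ℝ) →L[ℝ] ℝ) := fun i j =>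
    (ContinuousLinearMap.proj (R := ℝ) (φ := fun _ : Fin 2 => ℝ) j).comp
      (ContinuousLinearMap.proj (R := ℝ) (φ := fun _ : Fin 2 => Fin 2 → ℝ) i)
  let T : (Fin 2 → Fin 2 → ℝ) →L[ℝ] ℝ × ℝ × ℝ := (ev 0 0).prod ((ev 0 1).prod (ev 1 0))
  have h1 := mfderiv_chain (E := ℝ × ℝ × ℝ) (E' := Fin 2 → Fin 2 → ℝ) (E'' := ℝ × ℝ × ℝ)
    (I := 𝓘(ℝ, ℝ × ℝ × ℝ)) (J := 𝓘(ℝ, Fin 2 → Fin 2 → ℝ)) (K := 𝓘(ℝ, ℝ × ℝ × ℝ))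
    (x := (1 : SL(2, ℝ))) (f := entries) (g := T)
    (h := extChartAt 𝓘(ℝ, ℝ × ℝ × ℝ) (1 : SL(2, ℝ))) (fun z => by
      have e : extChartAt 𝓘(ℝ, ℝ × ℝ × ℝ) (1 : SL(2, ℝ)) z = chart 1 z := rfl
      have e' : chart 1 z = chartOne ((1 : SL(2, ℝ))⁻¹ * z) := rfl
      rw [e, e', inv_one, one_mul]
      rfl) rfl T.mdifferentiableAt (contMDiff_entries.mdifferentiable (by simp) 1) X
  rw [mfderiv_extChartAt_self, ContinuousLinearMap.mfderiv_eq] at h1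
  exact h1.symm

lemma trace_toMatrix (X : GroupLieAlgebra 𝓘(ℝ, ℝ × ℝ × ℝ) SL(2, ℝ)) :
    toMatrix X 0 0 + toMatrix X 1 1 = 0 := by
  let ev : Fin 2 → Fin 2 → ((Fin 2 → Fin 2 → ℝ) →L[ℝ] ℝ) := fun i j =>
    (ContinuousLinearMap.proj (R := ℝ) (φ := fun _ : Fin 2 => ℝ) j).comp
      (ContinuousLinearMap.proj (R := ℝ) (φ := fun _ : Fin 2 => Fin 2 → ℝ) i)
  have hev : ∀ i j A, HasFDerivAt (fun A => ev i j A) (ev i j) A := fun i j A => (ev i j).hasFDerivAt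
  have hdet := (((hev 0 0 (entries 1)).mul (hev 1 1 (entries 1))).sub
    ((hev 0 1 (entries 1)).mul (hev 1 0 (entries 1))))
  have h1 := mfderiv_chain (E := ℝ × ℝ × ℝ) (E' := Fin 2 → Fin 2 → ℝ) (E'' := ℝ)
    (I := 𝓘(ℝ, ℝ × ℝ × ℝ)) (J := 𝓘(ℝ, Fin 2 → Fin 2 → ℝ)) (K := 𝓘(ℝ))
    (x := (1 : SL(2, ℝ))) (f := entries) (h := fun _ => (1 : ℝ)) (fun z => by
      have := z.det_coe
      rw [Matrix.det_fin_two] at this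
      exact this.symm) rfl hdet.hasMFDerivAt.mdifferentiableAt
        (contMDiff_entries.mdifferentiable (by simp) 1) X
  rw [hdet.hasMFDerivAt.mfderiv, mfderiv_const] at h1
  have h2 : (0 : ℝ) = entries 1 0 0 * toMatrix X 1 1 + entries 1 1 1 * toMatrix X 0 0 -
    (entries 1 0 1 * toMatrix X 1 0 + entries 1 1 0 * toMatrix X 0 1) := h1
  have e : ∀ i j, entries 1 i j = (1 : Matrix (Fin 2) (Fin 2) ℝ) i j := fun i j => rfl
  simp only [e, Matrix.one_apply_eq, Matrix.one_apply_ne (show (0 : Fin 2) ≠ 1 by decide),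
    Matrix.one_apply_ne (show (1 : Fin 2) ≠ 0 by decide)] at h2
  linarith

/-- The Lie bracket of the Lie algebra of `SL(2, ℝ)` in the coordinates of the chart at the
identity. -/
lemma lie_eq (X Y : GroupLieAlgebra 𝓘(ℝ, ℝ × ℝ × ℝ) SL(2, ℝ)) (x y z x' y' z' : ℝ)
    (hX : X = ((x, y, z) : ℝ × ℝ × ℝ)) (hY : Y = ((x', y', z') : ℝ × ℝ × ℝ)) :
    (⁅X, Y⁆ : GroupLieAlgebra 𝓘(ℝ, ℝ × ℝ × ℝ) SL(2, ℝ)) =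
      ((y * z' - y' * z, 2 * (x * y' - x' * y), 2 * (z * x' - z' * x)) : ℝ × ℝ × ℝ) := by
  have h := toMatrix_lie X Y
  rw [← toMatrix_entries ⁅X, Y⁆, h]
  have a := (toMatrix_entries X).trans hX
  have b := (toMatrix_entries Y).trans hY
  simp only [Prod.mk.injEq] at a b
  obtain ⟨a1, a2, a3⟩ := a
  obtain ⟨b1, b2, b3⟩ := b
  have a4 : toMatrix X 1 1 = -x := by linarith [trace_toMatrix X]
  have b4 : toMatrix Y 1 1 = -x' := by linarith [trace_toMatrix Y]
  have c1 : (toMatrix X * toMatrix Y - toMatrix Y * toMatrix X) 0 0 = y * z' - y' * z := by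
    simp only [Matrix.sub_apply, Matrix.mul_apply, Fin.sum_univ_two, a1, a2, a3, b1, b2, b3]
    ring
  have c2 : (toMatrix X * toMatrix Y - toMatrix Y * toMatrix X) 0 1 = 2 * (x * y' - x' * y) := by
    simp only [Matrix.sub_apply, Matrix.mul_apply, Fin.sum_univ_two, a1, a2, a4, b1, b2, b4]
    ring
  have c3 : (toMatrix X * toMatrix Y - toMatrix Y * toMatrix X) 1 0 = 2 * (z * x' - z' * x) := by
    simp only [Matrix.sub_apply, Matrix.mul_apply, Fin.sum_univ_two, a1, a3, a4, b1, b3, b4]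
    ring
  rw [c1, c2, c3]

end SLTwo

/-! ### Orthonormal frames for invariant metrics -/

section OrthonormalFrames

section LinearAlgebra

variable {V : Type*} [AddCommGroup V] [Module ℝ V] [FiniteDimensional ℝ V]

lemma exists_basis_orthonormal (B : V →ₗ[ℝ] V →ₗ[ℝ] ℝ) (hs : ∀ x y, B x y = B y x)
    (hp : ∀ x, x ≠ 0 → 0 < B x x) :
    ∃ b : Module.Basis (Fin (Module.finrank ℝ V)) ℝ V,
      ∀ i j, B (b i) (b j) = if i = j then 1 else 0 := by
  obtain ⟨b, hb⟩ := LinearMap.BilinForm.exists_orthogonal_basis (B := B) ⟨hs⟩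
  have hb' : ∀ i j, i ≠ j → B (b i) (b j) = 0 := fun i j hij => hb hij
  have hpos : ∀ i, 0 < B (b i) (b i) := fun i => hp _ (b.ne_zero i)
  have hw : ∀ i, IsUnit (Real.sqrt (B (b i) (b i)))⁻¹ := fun i =>
    (inv_ne_zero (Real.sqrt_pos.2 (hpos i)).ne').isUnit
  refine ⟨b.isUnitSMul hw, fun i j => ?_⟩
  rw [Module.Basis.isUnitSMul_apply, Module.Basis.isUnitSMul_apply, map_smul, map_smul,
    LinearMap.smul_apply, smul_eq_mul, smul_eq_mul]
  split_ifs with h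
  · subst h
    have h1 := Real.mul_self_sqrt (hpos i).le
    have h2 := (Real.sqrt_pos.2 (hpos i)).ne'
    field_simp
    rw [sq, h1]
  · rw [hb' i j h, mul_zero, mul_zero]

/-- An orthonormal family extends to an orthonormal basis. -/
lemma exists_orthonormal_extension {κ : Type*} [Fintype κ] [DecidableEq κ]
    (B : V →ₗ[ℝ] V →ₗ[ℝ] ℝ) (hs : ∀ x y, B x y = B y x) (hp : ∀ x, x ≠ 0 → 0 < B x x) (e : κ → V)
    (he : ∀ i j, B (e i) (e j) = if i = j then 1 else 0) :
    ∃ (m : ℕ) (c : Fin m → V) (b : Module.Basis (κ ⊕ Fin m) ℝ V), (∀ i, b i = Sum.elim e c i) ∧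
      ∀ i j, B (b i) (b j) = if i = j then 1 else 0 := by
  let C : Submodule ℝ V := ⨅ k, LinearMap.ker (B (e k))
  have hC : ∀ x, x ∈ C ↔ ∀ k, B (e k) x = 0 := fun x => by simp [C, Submodule.mem_iInf]
  obtain ⟨c, hc⟩ := exists_basis_orthonormal (V := C) (B.domRestrict₁₂ C C)
    (fun x y => hs x y) (fun x hx => hp x fun h => hx (Subtype.ext h))
  have hc' : ∀ i j, B (c i : V) (c j) = if i = j then 1 else 0 := hc
  have hec : ∀ k j, B (e k) (c j) = 0 := fun k j => (hC _).1 (c j).2 k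
  have horth : ∀ i j, B (Sum.elim e (fun j => (c j : V)) i) (Sum.elim e (fun j => (c j : V)) j) =
      if i = j then 1 else 0 := by
    rintro (i | i) (j | j)
    · simp [he]
    · simp [hec]
    · simp [hs _ (e j), hec]
    · simp [hc']
  have hli : LinearIndependent ℝ (Sum.elim e fun j => (c j : V)) := by
    rw [Fintype.linearIndependent_iff]
    intro a ha i
    have := congrArg (B (Sum.elim e (fun j => (c j : V)) i)) ha
    rw [map_zero, map_sum] at this
    simpa only [map_smul, horth, smul_eq_mul, mul_ite, mul_one, mul_zero, Finset.sum_ite_eq,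
      Finset.mem_univ, if_true] using this
  have hsp : ⊤ ≤ Submodule.span ℝ (Set.range (Sum.elim e fun j => (c j : V))) := by
    intro x _
    have h1 : x - ∑ k, B (e k) x • e k ∈ C := by
      rw [hC]
      intro k
      simp [he]
    have h2 := c.sum_repr ⟨_, h1⟩
    have h3 := congrArg (Subtype.val) h2
    simp only [Submodule.coe_sum, Submodule.coe_smul] at h3
    rw [eq_sub_iff_add_eq] at h3
    rw [← h3]
    refine Submodule.add_mem _ (Submodule.sum_mem _ fun i _ => Submodule.smul_mem _ _ ?_)
      (Submodule.sum_mem _ fun i _ => Submodule.smul_mem _ _ ?_)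
    · exact Submodule.subset_span ⟨Sum.inr i, rfl⟩
    · exact Submodule.subset_span ⟨Sum.inl i, rfl⟩
  refine ⟨_, fun j => c j, Module.Basis.mk hli hsp, fun i => Module.Basis.mk_apply hli hsp i,
    fun i j => ?_⟩
  rw [Module.Basis.mk_apply, Module.Basis.mk_apply, horth]

end LinearAlgebra

variable {E : Type*} [NormedAddCommGroup E] [NormedSpace ℝ E] [FiniteDimensional ℝ E]
  {H : Type*} [TopologicalSpace H] {I : ModelWithCorners ℝ E H} [I.Boundaryless]
  {G : Type*} [TopologicalSpace G] [ChartedSpace H G] [Group G] [LieGroup I ∞ G]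
  {E' : Type*} [NormedAddCommGroup E'] [NormedSpace ℝ E'] [FiniteDimensional ℝ E']
  {H' : Type*} [TopologicalSpace H'] {J : ModelWithCorners ℝ E' H'} [J.Boundaryless]
  {M : Type*} [TopologicalSpace M] [ChartedSpace H' M] [IsManifold J ∞ M]

instance : FiniteDimensional ℝ (GroupLieAlgebra I G) := inferInstanceAs (FiniteDimensional ℝ E)

/-- A form on the model space, as a form on the Lie algebra. -/
def lieForm (I : ModelWithCorners ℝ E H) (G : Type*) [TopologicalSpace G] [ChartedSpace H G]
    [Group G] (q : E →L[ℝ] E →L[ℝ] ℝ) :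
    GroupLieAlgebra I G →ₗ[ℝ] GroupLieAlgebra I G →ₗ[ℝ] ℝ :=
  (q.toBilinForm : E →ₗ[ℝ] E →ₗ[ℝ] ℝ)

namespace IsOrbitMap

variable {g : SmoothMetric J M} {p : G → M} {q : E →L[ℝ] E →L[ℝ] ℝ}
  {K : GroupLieAlgebra I G → (x : M) → TangentSpace J x} {nabla : AffineConnection J M}
  {X Y : GroupLieAlgebra I G} {BX BY : (x : M) → TangentSpace J x}
  {ι : Type*} [Fintype ι] [DecidableEq ι]

lemma mfderiv_eq_zero_of_radical (h : IsOrbitMap g p q K) {x : GroupLieAlgebra I G}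
    (hx : q x x = 0) : (mfderiv I J p 1 x : E') = 0 := by
  by_contra h0
  exact (g.pos (p 1) (mfderiv I J p 1 x) h0).ne' ((h.inner_one x x).trans hx)

lemma isInvariantForm (h : IsOrbitMap g p q K) (U : ι → E) (b : Module.Basis ι ℝ E')
    (hU : ∀ i, mfderiv I J p 1 (U i) = b i) (hq : ∀ i j, q (U i) (U j) = if i = j then 1 else 0) :
    IsInvariantForm (lieForm I G q) (fun i => (U i : GroupLieAlgebra I G)) where
  symm := h.symm_apply
  orthonormal := hq
  span v w := by
    let T : E →L[ℝ] E' := mfderiv I J p 1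
    let B : E' →ₗ[ℝ] E' →ₗ[ℝ] ℝ := (g.inner (p 1)).toBilinForm
    have hBq : ∀ u v : E, B (T u) (T v) = q u v := fun u v => h.inner_one u v
    have hTU : ∀ i, T (U i) = b i := hU
    have hB : ∀ i j, B (b i) (b j) = if i = j then 1 else 0 := fun i j => by
      rw [← hTU, ← hTU, hBq, hq]
    let v' : E := v
    have h1 : T (v' - ∑ i, q v' (U i) • U i) = 0 := by
      rw [map_sub, map_sum, sub_eq_zero]
      refine (b.sum_repr (T v')).symm.trans (Finset.sum_congr rfl fun i _ => ?_)
      rw [map_smul, hTU, repr_eq_of_orthonormal B b hB, ← hTU, hBq]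
    refine (hBq (v' - ∑ i, q v' (U i) • U i) w).symm.trans ?_
    rw [h1, map_zero, LinearMap.zero_apply]
  inv x hx u v := by
    have hw : (mfderiv I J p 1 (mulInvariantVectorField x (1 : G)) : E') = (0 : E') :=
      (mfderiv_one p x).trans (h.mfderiv_eq_zero_of_radical (hx x))
    have h1 := h.mvfderiv_bilin_killing
      (contMDiff_inner_fields (g := g) (h.smooth_killing u) (h.smooth_killing v)) q
      (U := u) (V := v) (fun a => h.inner_killing_killing u v a) x 1 0 hw
    rw [map_zero, adInvE_one, adInvE_one] at h1
    have h2 : -q (lieCLM x (u : E)) v - q u (lieCLM x (v : E)) = 0 := h1.symm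
    have h3 : q (lieCLM x (u : E)) v + q u (lieCLM x (v : E)) = 0 := by linarith
    exact h3

lemma hasRicci (h : IsOrbitMap g p q K) (hg : IsLeviCivita g nabla)
    {R : (x : M) → TangentSpace J x →ₗ[ℝ] TangentSpace J x →ₗ[ℝ] TangentSpace J x →ₗ[ℝ]
      TangentSpace J x} (hR : IsCurvatureTensor nabla R) {c : ℝ}
    (hc : ∀ (x : M) (v w : TangentSpace J x), ricci (R x) v w = c * g.inner x v w)
    (hBX : IsSmoothField BX) (hX : FieldRelated I J p (mulInvariantVectorField X) BX)
    (hBY : IsSmoothField BY) (hY : FieldRelated I J p (mulInvariantVectorField Y) BY)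
    (U : ι → E) (b : Module.Basis ι ℝ E')
    (hU : ∀ i, mfderiv I J p 1 (U i) = b i) (hq : ∀ i j, q (U i) (U j) = if i = j then 1 else 0) :
    HasRicci (lieForm I G q) (fun i => (U i : GroupLieAlgebra I G)) X Y (c * lieForm I G q X Y) := by
  obtain ⟨W, hW, h1⟩ := h.ricci_eq hg hR hBX hX hBY hY U b hU hq
  rw [hc, ← field_one hX, ← field_one hY, h.inner_one] at h1
  exact ⟨W, hW, h1⟩

end IsOrbitMap

end OrthonormalFrames

/-! ### Fixed vectors and products of homogeneous spaces -/

section FixedVectors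

open VectorField Filter Topology

variable {E : Type*} [NormedAddCommGroup E] [NormedSpace ℝ E] [FiniteDimensional ℝ E]
  {H : Type*} [TopologicalSpace H] {I : ModelWithCorners ℝ E H} [I.Boundaryless]
  {G : Type*} [TopologicalSpace G] [ChartedSpace H G] [Group G] [LieGroup I ∞ G]
  {E' : Type*} [NormedAddCommGroup E'] [NormedSpace ℝ E'] [FiniteDimensional ℝ E']
  {H' : Type*} [TopologicalSpace H'] {J : ModelWithCorners ℝ E' H'} [J.Boundaryless]
  {M : Type*} [TopologicalSpace M] [ChartedSpace H' M] [IsManifold J ∞ M]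
  {E₀ : Type*} [NormedAddCommGroup E₀] [NormedSpace ℝ E₀] [FiniteDimensional ℝ E₀]
  {H₀ : Type*} [TopologicalSpace H₀] {I₀ : ModelWithCorners ℝ E₀ H₀} [I₀.Boundaryless]
  {S : Type*} [TopologicalSpace S] [ChartedSpace H₀ S] [Group S] [LieGroup I₀ ∞ S]

lemma adInv_pair (u : GroupLieAlgebra I₀ S) (v : GroupLieAlgebra I G) (a : S × G) :
    adInv (GroupLieAlgebra.pair u v) a = GroupLieAlgebra.pair (adInv u a.1) (adInv v a.2) := by
  have h := mfderiv_prodMap (p := (1 : S × G)) (mdifferentiable_conj (I := I₀) a.1 1)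
    (mdifferentiable_conj (I := I) a.2 1)
  exact congrArg (fun T : E₀ × E →L[ℝ] E₀ × E => T (u, v)) h

lemma adInv_zero (a : G) : adInv (0 : GroupLieAlgebra I G) a = 0 :=
  map_zero (mfderiv I I (fun x => a⁻¹ * x * a) 1)

namespace IsHomogeneousMap

variable {τ : G → M → M} {p : G → M} {g : SmoothMetric J M}

lemma surjective_mfderiv (h : IsHomogeneousMap I J τ p) (a : G) (w : E') :
    ∃ v : E, (mfderiv I J p a v : E') = w := by
  obtain ⟨σ, hσ, hσa, hσp⟩ := h.exists_section a
  have hd : MDifferentiableAt J I σ (p a) := hσ.mdifferentiableAt (by simp)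
  refine ⟨mfderiv J I σ (p a) w, ?_⟩
  have h1 := mfderiv_chain (E := E') (E' := E) (E'' := E') (I := J) (J := I) (K := J)
    (x := p a) (f := σ) (g := p) (h := fun y => p (σ y)) (fun _ => rfl) hσa
    (h.mdifferentiable a) hd w
  have h2 : (fun y => p (σ y)) =ᶠ[𝓝 (p a)] id := hσp
  have h3 : (mfderiv J J (fun y => p (σ y)) (p a) w : E') = mfderiv J J id (p a) w :=
    congrArg (fun T : E' →L[ℝ] E' => T w) h2.mfderiv_eq
  refine h1.symm.trans (h3.trans ?_)
  rw [mfderiv_id]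
  rfl

lemma pullbackForm_adInv_adInv (h : IsHomogeneousMap I J τ p) (hg : ∀ a, PreservesMetric g (τ a))
    (U V : GroupLieAlgebra I G) {s : G} (hs : p s = p 1) :
    pullbackForm (I := I) g p (adInv U s) (adInv V s) = pullbackForm (I := I) g p U V := by
  rw [← h.inner_eq_pullbackForm hg s, h.mfderiv_adInv_of_stabilizer U hs,
    h.mfderiv_adInv_of_stabilizer V hs, hs]
  rfl

/-- A vector whose inner products are invariant under the stabilizer is fixed. -/
lemma isFixed_of_pullbackForm (h : IsHomogeneousMap I J τ p) (hg : ∀ a, PreservesMetric g (τ a))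
    {Y : GroupLieAlgebra I G} (hY : ∀ s, p s = p 1 → ∀ U : GroupLieAlgebra I G,
      pullbackForm (I := I) g p Y (adInv U s) = pullbackForm (I := I) g p Y U) :
    IsFixed I J p Y := by
  intro s hs
  let B : E' →L[ℝ] E' →L[ℝ] ℝ := g.inner (p 1)
  let y₁ : E' := mfderiv I J p s (mulInvariantVectorField Y s)
  let y₂ : E' := mfderiv I J p 1 Y
  have h1 : ∀ w, B y₁ w = B y₂ w := by
    intro w
    obtain ⟨U, rfl⟩ := h.surjective_mfderiv 1 w
    have h2 := h.inner_eq_pullbackForm hg s Y (adInv U s)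
    rw [h.mfderiv_adInv_of_stabilizer U hs, hY s hs U, hs] at h2
    exact h2
  by_contra h3
  have h4 : y₁ - y₂ ≠ 0 := sub_ne_zero.2 h3
  have h5 := g.pos (p 1) (y₁ - y₂ : E') h4
  have h6 : B (y₁ - y₂) (y₁ - y₂) = 0 := by
    have h7 : B (y₁ - y₂) = 0 := by
      rw [map_sub]
      ext w
      exact sub_eq_zero.2 (h1 w)
    rw [h7]
    rfl
  exact h5.ne' h6

/-- The product of a Lie group, acting on itself by translations, and a homogeneous space. -/
lemma prod (h : IsHomogeneousMap I J τ p) :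
    IsHomogeneousMap (I₀.prod I) (I₀.prod J) (fun (a : S × G) x => (a.1 * x.1, τ a.2 x.2))
      (Prod.map id p) where
  smooth := contMDiff_id.prodMap h.smooth
  surjective := Function.surjective_id.prodMap h.surjective
  act a b := Prod.ext rfl (h.act a.2 b.2)
  exists_section a := by
    obtain ⟨σ, hσ, hσa, hσp⟩ := h.exists_section a.2
    refine ⟨Prod.map id σ, contMDiffAt_id.prodMap' hσ, Prod.ext rfl hσa, ?_⟩
    have hc : ContinuousAt (Prod.snd : S × M → M) (Prod.map id p a) := continuous_snd.continuousAt
    filter_upwards [hc.eventually hσp] with y hy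
    exact Prod.ext rfl hy

lemma mfderiv_prod_pair (h : IsHomogeneousMap I J τ p) (a : S × G) (u : E₀) (v : E) :
    (mfderiv (I₀.prod I) (I₀.prod J) (Prod.map id p) a ((u, v) : E₀ × E) : E₀ × E') =
      (u, (mfderiv I J p a.2 v : E')) := by
  have h1 := mfderiv_prodMap (p := a) (mdifferentiableAt_id (I := I₀) (x := a.1))
    (h.mdifferentiable a.2)
  rw [mfderiv_id] at h1
  exact congrArg (fun T : E₀ × E →L[ℝ] E₀ × E' => T (u, v)) h1

/-- The second component of a fixed vector of a product is fixed. -/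
lemma IsFixed.of_prod (h : IsHomogeneousMap I J τ p) {u : GroupLieAlgebra I₀ S}
    {v : GroupLieAlgebra I G} (hu : IsFixed (I₀.prod I) (I₀.prod J) (Prod.map (id : S → S) p)
      (GroupLieAlgebra.pair u v)) : IsFixed I J p v := by
  intro s hs
  have h1 := hu (1, s) (Prod.ext rfl hs)
  rw [GroupLieAlgebra.mulInvariantVectorField_pair] at h1
  let u₁ : E₀ := mulInvariantVectorField u (1 : S)
  let v₁ : E := mulInvariantVectorField v s
  let u₂ : E₀ := u
  let v₂ : E := v
  have h2 := h.mfderiv_prod_pair (I₀ := I₀) ((1, s) : S × G) u₁ v₁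
  have h3 := h.mfderiv_prod_pair (I₀ := I₀) (1 : S × G) u₂ v₂
  exact congrArg Prod.snd (h2.symm.trans (h1.trans h3))

end IsHomogeneousMap

section quotient

variable {E₁ : Type*} [NormedAddCommGroup E₁] [NormedSpace ℝ E₁] [FiniteDimensional ℝ E₁]
  {G₁ : Type*} [TopologicalSpace G₁] [ChartedSpace E₁ G₁] [Group G₁] [LieGroup 𝓘(ℝ, E₁) ∞ G₁]
  {H₁ : Subgroup G₁} {E₂ : Type*} [NormedAddCommGroup E₂] [NormedSpace ℝ E₂]
  [FiniteDimensional ℝ E₂] [ChartedSpace E₂ (G₁ ⧸ H₁)] [IsManifold 𝓘(ℝ, E₂) ∞ (G₁ ⧸ H₁)]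

lemma isHomogeneousMap_mk
    (hπ : Manifold.IsSubmersion 𝓘(ℝ, E₁) 𝓘(ℝ, E₂) ∞ (QuotientGroup.mk : G₁ → G₁ ⧸ H₁)) :
    IsHomogeneousMap 𝓘(ℝ, E₁) 𝓘(ℝ, E₂) (fun (a : G₁) (x : G₁ ⧸ H₁) => a • x)
      (QuotientGroup.mk : G₁ → G₁ ⧸ H₁) where
  smooth := hπ.contMDiff
  surjective := QuotientGroup.mk_surjective
  act _ _ := rfl
  exists_section a := (hπ.isSubmersionAt a).exists_local_section

lemma mk_mul_comm_of_normalizesStabilizer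
    (hN : ∀ a b : Subgroup.normalizer (H₁ : Set G₁) ⧸
      H₁.subgroupOf (Subgroup.normalizer (H₁ : Set G₁)), a * b = b * a) (n m : G₁)
    (hn : IsHomogeneousMap.NormalizesStabilizer (QuotientGroup.mk : G₁ → G₁ ⧸ H₁) n)
    (hm : IsHomogeneousMap.NormalizesStabilizer (QuotientGroup.mk : G₁ → G₁ ⧸ H₁) m) :
    (QuotientGroup.mk (n * m) : G₁ ⧸ H₁) = QuotientGroup.mk (m * n) := by
  have key : ∀ n : G₁,
      IsHomogeneousMap.NormalizesStabilizer (QuotientGroup.mk : G₁ → G₁ ⧸ H₁) n →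
      n ∈ Subgroup.normalizer (H₁ : Set G₁) := by
    intro n hn
    have h1 : ∀ s ∈ H₁, n⁻¹ * s * n ∈ H₁ ∧ n * s * n⁻¹ ∈ H₁ := by
      intro s hs
      obtain ⟨h2, h3⟩ := hn s (QuotientGroup.eq.2 (by simpa using hs))
      have h2 := QuotientGroup.eq.1 h2.symm
      have h3 := QuotientGroup.eq.1 h3.symm
      simp only [inv_inv, ← mul_assoc] at h2 h3
      exact ⟨h2, h3⟩
    rw [Subgroup.mem_normalizer_iff]
    intro s
    refine ⟨fun hs => (h1 s hs).2, fun hs => ?_⟩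
    have := (h1 _ hs).1
    simpa [mul_assoc] using this
  have h1 := hN (QuotientGroup.mk ⟨n, key n hn⟩) (QuotientGroup.mk ⟨m, key m hm⟩)
  have h2 := QuotientGroup.eq.1 h1
  exact QuotientGroup.eq.2 h2

end quotient

end FixedVectors

/-! ### Split frames on the Lie algebra of a product -/

section SplitFrames

variable {E : Type*} [NormedAddCommGroup E] [NormedSpace ℝ E] [FiniteDimensional ℝ E]
  {H : Type*} [TopologicalSpace H] {I : ModelWithCorners ℝ E H} [I.Boundaryless]
  {G : Type*} [TopologicalSpace G] [ChartedSpace H G] [Group G] [LieGroup I ∞ G]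
  {E₀ : Type*} [NormedAddCommGroup E₀] [NormedSpace ℝ E₀] [FiniteDimensional ℝ E₀]
  {H₀ : Type*} [TopologicalSpace H₀] {I₀ : ModelWithCorners ℝ E₀ H₀} [I₀.Boundaryless]
  {S : Type*} [TopologicalSpace S] [ChartedSpace H₀ S] [Group S] [LieGroup I₀ ∞ S]

namespace GroupLieAlgebra

variable (I₀ S I G) in
/-- The inclusion of the first factor. -/
def inl : GroupLieAlgebra I₀ S →ₗ[ℝ] GroupLieAlgebra (I₀.prod I) (S × G) :=
  (LinearMap.inl ℝ E₀ E : E₀ →ₗ[ℝ] E₀ × E)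

variable (I₀ S I G) in
/-- The inclusion of the second factor. -/
def inr : GroupLieAlgebra I G →ₗ[ℝ] GroupLieAlgebra (I₀.prod I) (S × G) :=
  (LinearMap.inr ℝ E₀ E : E →ₗ[ℝ] E₀ × E)

variable (I₀ S I G) in
/-- The projection to the first factor. -/
def fst : GroupLieAlgebra (I₀.prod I) (S × G) →ₗ[ℝ] GroupLieAlgebra I₀ S :=
  (LinearMap.fst ℝ E₀ E : E₀ × E →ₗ[ℝ] E₀)

variable (I₀ S I G) in
/-- The projection to the second factor. -/
def snd : GroupLieAlgebra (I₀.prod I) (S × G) →ₗ[ℝ] GroupLieAlgebra I G :=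
  (LinearMap.snd ℝ E₀ E : E₀ × E →ₗ[ℝ] E)

lemma inl_apply (u : GroupLieAlgebra I₀ S) : inl I G I₀ S u = pair u (0 : GroupLieAlgebra I G) := rfl

lemma inr_apply (v : GroupLieAlgebra I G) : inr I G I₀ S v = pair (0 : GroupLieAlgebra I₀ S) v := rfl

lemma pair_eq (u : GroupLieAlgebra I₀ S) (v : GroupLieAlgebra I G) :
    pair u v = inl I G I₀ S u + inr I G I₀ S v :=
  Prod.ext (add_zero (u : E₀)).symm (zero_add (v : E)).symm

lemma pair_fst_snd (x : GroupLieAlgebra (I₀.prod I) (S × G)) :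
    pair (fst I G I₀ S x) (snd I G I₀ S x) = x := rfl

lemma fst_pair (u : GroupLieAlgebra I₀ S) (v : GroupLieAlgebra I G) :
    fst I G I₀ S (pair u v) = u := rfl

lemma fst_inl (u : GroupLieAlgebra I₀ S) : fst I G I₀ S (inl I G I₀ S u) = u := rfl

lemma fst_inr (v : GroupLieAlgebra I G) : fst I G I₀ S (inr I G I₀ S v) = 0 := rfl

lemma inl_lie_inl (u u' : GroupLieAlgebra I₀ S) :
    ⁅inl I G I₀ S u, inl I G I₀ S u'⁆ = inl I G I₀ S ⁅u, u'⁆ := by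
  rw [inl_apply, inl_apply, pair_lie_pair, lie_self, inl_apply]

lemma inr_lie_inr (v v' : GroupLieAlgebra I G) :
    ⁅inr I G I₀ S v, inr I G I₀ S v'⁆ = inr I G I₀ S ⁅v, v'⁆ := by
  rw [inr_apply, inr_apply, pair_lie_pair, lie_self, inr_apply]

lemma inl_lie_inr (u : GroupLieAlgebra I₀ S) (v : GroupLieAlgebra I G) :
    ⁅inl I G I₀ S u, inr I G I₀ S v⁆ = 0 := by
  rw [inl_apply, inr_apply, pair_lie_pair, lie_zero, zero_lie]
  rfl

lemma fst_lie (x y : GroupLieAlgebra (I₀.prod I) (S × G)) :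
    fst I G I₀ S ⁅x, y⁆ = ⁅fst I G I₀ S x, fst I G I₀ S y⁆ := by
  conv_lhs => rw [← pair_fst_snd x, ← pair_fst_snd y, pair_lie_pair, fst_pair]

lemma eq_inr_of_fst_eq_zero {x : GroupLieAlgebra (I₀.prod I) (S × G)} (hx : fst I G I₀ S x = 0) :
    x = inr I G I₀ S (snd I G I₀ S x) := by
  conv_lhs => rw [← pair_fst_snd x, hx]
  rfl

lemma span_lie_eq_top_prod
    (h₀ : Submodule.span ℝ {m : GroupLieAlgebra I₀ S | ∃ x y : GroupLieAlgebra I₀ S, ⁅x, y⁆ = m} = ⊤)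
    (h : Submodule.span ℝ {m : GroupLieAlgebra I G | ∃ x y : GroupLieAlgebra I G, ⁅x, y⁆ = m} = ⊤) :
    Submodule.span ℝ {m : GroupLieAlgebra (I₀.prod I) (S × G) |
      ∃ x y : GroupLieAlgebra (I₀.prod I) (S × G), ⁅x, y⁆ = m} = ⊤ := by
  rw [eq_top_iff]
  intro z _
  rw [← pair_fst_snd z, pair_eq]
  refine Submodule.add_mem _ ?_ ?_
  · have h1 : Submodule.map (inl I G I₀ S) ⊤ ≤ Submodule.span ℝ
        {m : GroupLieAlgebra (I₀.prod I) (S × G) |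
          ∃ x y : GroupLieAlgebra (I₀.prod I) (S × G), ⁅x, y⁆ = m} := by
      rw [← h₀, Submodule.map_span]
      refine Submodule.span_mono ?_
      rintro _ ⟨_, ⟨x, y, rfl⟩, rfl⟩
      exact ⟨_, _, inl_lie_inl x y⟩
    exact h1 ⟨_, trivial, rfl⟩
  · have h1 : Submodule.map (inr I G I₀ S) ⊤ ≤ Submodule.span ℝ
        {m : GroupLieAlgebra (I₀.prod I) (S × G) |
          ∃ x y : GroupLieAlgebra (I₀.prod I) (S × G), ⁅x, y⁆ = m} := by
      rw [← h, Submodule.map_span]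
      refine Submodule.span_mono ?_
      rintro _ ⟨_, ⟨x, y, rfl⟩, rfl⟩
      exact ⟨_, _, inr_lie_inr x y⟩
    exact h1 ⟨_, trivial, rfl⟩

variable {J : Type*} [Fintype J] [DecidableEq J]

lemma inr_add_sum_repr (ε : Module.Basis (Fin 3) ℝ (GroupLieAlgebra I₀ S))
    (u : GroupLieAlgebra I₀ S) (v : GroupLieAlgebra I G) :
    inr I G I₀ S v + ∑ k, ε.repr u k • inl I G I₀ S (ε k) = pair u v := by
  rw [pair_eq, add_comm]
  conv_rhs => rw [← ε.sum_repr u]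
  simp only [map_sum, map_smul]

/-- The frames used to compute Ricci curvatures on a product. -/
lemma isSplitFrame
    (q : GroupLieAlgebra (I₀.prod I) (S × G) →ₗ[ℝ] GroupLieAlgebra (I₀.prod I) (S × G) →ₗ[ℝ] ℝ)
    (ε : Module.Basis (Fin 3) ℝ (GroupLieAlgebra I₀ S)) (u : J → GroupLieAlgebra I₀ S)
    (v : J → GroupLieAlgebra I G)
    (hq : IsInvariantForm q
      (Sum.elim (fun k => inl I G I₀ S (ε k)) fun j => pair (u j) (v j)))
    (hrad : ∀ x, (∀ y, q x y = 0) → fst I G I₀ S x = 0) :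
    IsSplitFrame q (fun k => inl I G I₀ S (ε k)) (fun j => inr I G I₀ S (v j))
      (fun j k => ε.repr (u j) k) (ε.equivFun.toLinearMap ∘ₗ fst I G I₀ S) where
  form := by simpa only [inr_add_sum_repr] using hq
  coord_e k := by
    simp only [LinearMap.comp_apply, fst_inl, LinearEquiv.coe_coe]
    ext l
    simp [Pi.single_apply, eq_comm]
  coord_V j := by rw [LinearMap.comp_apply, fst_inr, map_zero]
  coord_radical x hx := by rw [LinearMap.comp_apply, hrad x hx, map_zero]
  coord_lie a b hb := by
    rw [LinearMap.comp_apply, LinearEquiv.coe_coe, LinearEquiv.map_eq_zero_iff] at hb ⊢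
    rw [fst_lie, hb, lie_zero]
  lie_eq_zero k b hb := by
    rw [LinearMap.comp_apply, LinearEquiv.coe_coe, LinearEquiv.map_eq_zero_iff] at hb
    rw [eq_inr_of_fst_eq_zero hb, inl_lie_inr]
  lie_e i j := by
    rw [inl_lie_inl]
    conv_lhs => rw [← ε.sum_repr ⁅ε i, ε j⁆]
    simp only [map_sum, map_smul, LinearMap.comp_apply, fst_inl, LinearEquiv.coe_coe,
      Module.Basis.equivFun_apply]

end GroupLieAlgebra

lemma eq_zero_of_sum_repr_lie_eq_zero {L κ : Type*} [LieRing L] [LieAlgebra ℝ L] [Fintype κ]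
    [DecidableEq κ]
    (hperf : Submodule.span ℝ {m : L | ∃ x y : L, ⁅x, y⁆ = m} = ⊤) (ε : Module.Basis κ ℝ L)
    (v : κ → ℝ) (h : ∀ i j, ∑ k, v k * ε.repr ⁅ε i, ε j⁆ k = 0) : v = 0 := by
  let φ : L →ₗ[ℝ] ℝ := ∑ k, v k • ε.coord k
  have hφ : ∀ x, φ x = ∑ k, v k * ε.repr x k := fun x => by simp [φ]
  have h1 : ∀ x y : L, φ ⁅x, y⁆ = 0 := by
    intro x y
    have h0 : ∀ i j, φ ⁅ε i, ε j⁆ = 0 := fun i j => (hφ _).trans (h i j)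
    rw [← ε.sum_repr x, ← ε.sum_repr y]
    simp only [sum_lie, lie_sum, smul_lie, lie_smul, map_sum, map_smul, h0, smul_zero,
      Finset.sum_const_zero]
  have h2 : Submodule.span ℝ {m : L | ∃ x y : L, ⁅x, y⁆ = m} ≤ LinearMap.ker φ := by
    rw [Submodule.span_le]
    rintro _ ⟨x, y, rfl⟩
    exact h1 x y
  rw [hperf] at h2
  funext k
  have h3 : φ (ε k) = 0 := h2 trivial
  rw [hφ] at h3
  simpa [Finsupp.single_apply] using h3

end SplitFrames

namespace SLTwo

lemma span_lie_eq_top :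
    Submodule.span ℝ {m : GroupLieAlgebra 𝓘(ℝ, ℝ × ℝ × ℝ) SL(2, ℝ) |
      ∃ x y : GroupLieAlgebra 𝓘(ℝ, ℝ × ℝ × ℝ) SL(2, ℝ), ⁅x, y⁆ = m} = ⊤ := by
  rw [eq_top_iff]
  rintro ⟨a, b, c⟩ _
  have h1 := lie_eq _ _ 0 a 0 0 0 1 rfl rfl
  have h2 := lie_eq _ _ (1 / 2) 0 0 0 b 0 rfl rfl
  have h3 := lie_eq _ _ (-1 / 2) 0 0 0 0 c rfl rfl
  have h4 := Submodule.add_mem _ (Submodule.subset_span (R := ℝ) (s := {m | ∃ x y :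
    GroupLieAlgebra 𝓘(ℝ, ℝ × ℝ × ℝ) SL(2, ℝ), ⁅x, y⁆ = m}) ⟨_, _, h1⟩)
    (Submodule.add_mem _ (Submodule.subset_span ⟨_, _, h2⟩) (Submodule.subset_span ⟨_, _, h3⟩))
  have key : ∀ x y : GroupLieAlgebra 𝓘(ℝ, ℝ × ℝ × ℝ) SL(2, ℝ), x ∈ Submodule.span ℝ {m | ∃ x y :
      GroupLieAlgebra 𝓘(ℝ, ℝ × ℝ × ℝ) SL(2, ℝ), ⁅x, y⁆ = m} → y = x → y ∈ Submodule.span ℝ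
      {m | ∃ x y : GroupLieAlgebra 𝓘(ℝ, ℝ × ℝ × ℝ) SL(2, ℝ), ⁅x, y⁆ = m} := by
    rintro x _ h rfl
    exact h
  refine key _ _ h4 ?_
  refine Prod.ext ?_ (Prod.ext ?_ ?_)
  · change a = (a * 1 - 0 * 0) + ((0 * 0 - b * 0) + (0 * c - 0 * 0))
    ring
  · change b = 2 * (0 * 0 - 0 * a) + (2 * (1 / 2 * b - 0 * 0) + 2 * (-1 / 2 * 0 - 0 * 0))
    ring
  · change c = 2 * (0 * 0 - 1 * 0) + (2 * (0 * 0 - 0 * (1 / 2)) + 2 * (0 * 0 - c * (-1 / 2)))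
    ring

lemma exists_root : ∃ x y : GroupLieAlgebra 𝓘(ℝ, ℝ × ℝ × ℝ) SL(2, ℝ), y ≠ 0 ∧ ⁅x, y⁆ = (2 : ℝ) • y := by
  refine ⟨((1, 0, 0) : ℝ × ℝ × ℝ), ((0, 1, 0) : ℝ × ℝ × ℝ), fun h => ?_, ?_⟩
  · have h1 : ((0, 1, 0) : ℝ × ℝ × ℝ) = 0 := h
    simp at h1
  · refine (lie_eq _ _ 1 0 0 0 1 0 rfl rfl).trans ?_
    have h2 : ((0 * 0 - 1 * 0, 2 * (1 * 1 - 0 * 0), 2 * (0 * 0 - 0 * 1)) : ℝ × ℝ × ℝ) =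
      (2 : ℝ) • ((0, 1, 0) : ℝ × ℝ × ℝ) := by norm_num
    exact h2

end SLTwo

end

theorem mainTheorem10
    -- the semisimple Lie group `G₁`
    {E₁ : Type*} [NormedAddCommGroup E₁] [NormedSpace ℝ E₁] [FiniteDimensional ℝ E₁]
    {G₁ : Type*} [TopologicalSpace G₁] [ChartedSpace E₁ G₁] [Group G₁]
    [LieGroup 𝓘(ℝ, E₁) ∞ G₁] [T2Space G₁]
    (hG₁ : LieAlgebra.IsSemisimple ℝ (GroupLieAlgebra 𝓘(ℝ, E₁) G₁))
    -- the closed subgroup `H`, with `N(H)/H` abelian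
    (H : Subgroup G₁) (hH : IsClosed (H : Set G₁))
    (hN : ∀ a b : Subgroup.normalizer (H : Set G₁) ⧸
      H.subgroupOf (Subgroup.normalizer (H : Set G₁)), a * b = b * a)
    -- the manifold `G₁/H`, with the smooth structure for which the projection is a submersion
    {E₂ : Type*} [NormedAddCommGroup E₂] [NormedSpace ℝ E₂] [FiniteDimensional ℝ E₂]
    [ChartedSpace E₂ (G₁ ⧸ H)] [IsManifold 𝓘(ℝ, E₂) ∞ (G₁ ⧸ H)]
    (hπ : Manifold.IsSubmersion 𝓘(ℝ, E₁) 𝓘(ℝ, E₂) ∞ (QuotientGroup.mk : G₁ → G₁ ⧸ H)) :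
    ¬ ∃ g : SmoothMetric (𝓘(ℝ, ℝ × ℝ × ℝ).prod 𝓘(ℝ, E₂)) (SL(2, ℝ) × (G₁ ⧸ H)),
      (∀ (s : SL(2, ℝ)) (a : G₁), PreservesMetric g (fun p => (s * p.1, a • p.2))) ∧
      IsEinstein g := by
  rintro ⟨g, hg, nabla, hLC, R, hR, c, hc⟩
  have : IsClosed (H : Set G₁) := hH
  have : IsTopologicalGroup G₁ := topologicalGroup_of_lieGroup 𝓘(ℝ, E₁) ∞
  have hhom := isHomogeneousMap_mk hπ
  have hP := hhom.prod (I₀ := 𝓘(ℝ, ℝ × ℝ × ℝ)) (S := SL(2, ℝ))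
  let p : SL(2, ℝ) × G₁ → SL(2, ℝ) × (G₁ ⧸ H) := Prod.map id QuotientGroup.mk
  have hpres : ∀ a : SL(2, ℝ) × G₁, PreservesMetric g
      (fun x : SL(2, ℝ) × (G₁ ⧸ H) => (a.1 * x.1, a.2 • x.2)) := fun a => hg a.1 a.2
  have horb := hP.isOrbitMap hpres
  let B : (ℝ × ℝ × ℝ) × E₂ →ₗ[ℝ] (ℝ × ℝ × ℝ) × E₂ →ₗ[ℝ] ℝ := (g.inner (p 1)).toBilinForm
  have hBs : ∀ x y, B x y = B y x := g.symm (p 1)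
  have hBp : ∀ x, x ≠ 0 → 0 < B x x := g.pos (p 1)
  let ι₀ : ℝ × ℝ × ℝ →ₗ[ℝ] (ℝ × ℝ × ℝ) × E₂ := LinearMap.inl ℝ (ℝ × ℝ × ℝ) E₂
  obtain ⟨ε', hε'⟩ := exists_basis_orthonormal (B.compl₁₂ ι₀ ι₀) (fun x y => hBs _ _)
    (fun x hx => hBp _ fun h => hx (congrArg Prod.fst h))
  have hdim : Module.finrank ℝ (ℝ × ℝ × ℝ) = 3 := by simp
  let ε : Module.Basis (Fin 3) ℝ (ℝ × ℝ × ℝ) := ε'.reindex (finCongr hdim)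
  have hε : ∀ i j, B (ι₀ (ε i)) (ι₀ (ε j)) = if i = j then 1 else 0 := fun i j => by
    have := hε' ((finCongr hdim).symm i) ((finCongr hdim).symm j)
    simpa [ε] using this
  obtain ⟨m, c', b, hb, hbB⟩ := exists_orthonormal_extension B hBs hBp (fun k => ι₀ (ε k)) hε
  choose v hv using fun j => hhom.surjective_mfderiv 1 (c' j).2
  let U : Fin 3 ⊕ Fin m → (ℝ × ℝ × ℝ) × E₁ :=
    Sum.elim (fun k => (ε k, 0)) fun j => ((c' j).1, v j)
  have hT : ∀ (u : ℝ × ℝ × ℝ) (w : E₁), (mfderiv (𝓘(ℝ, ℝ × ℝ × ℝ).prod 𝓘(ℝ, E₁))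
      (𝓘(ℝ, ℝ × ℝ × ℝ).prod 𝓘(ℝ, E₂)) p 1 ((u, w) : (ℝ × ℝ × ℝ) × E₁) : (ℝ × ℝ × ℝ) × E₂) =
      (u, (mfderiv 𝓘(ℝ, E₁) 𝓘(ℝ, E₂) (QuotientGroup.mk : G₁ → G₁ ⧸ H) 1 w : E₂)) := fun u w =>
    hhom.mfderiv_prod_pair 1 u w
  have hU : ∀ i, (mfderiv (𝓘(ℝ, ℝ × ℝ × ℝ).prod 𝓘(ℝ, E₁))
      (𝓘(ℝ, ℝ × ℝ × ℝ).prod 𝓘(ℝ, E₂)) p 1 (U i) : (ℝ × ℝ × ℝ) × E₂) = b i := by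
    rintro (k | j)
    · refine (hT (ε k) 0).trans ((hb (Sum.inl k)).trans ?_).symm
      exact Prod.ext rfl (map_zero (mfderiv 𝓘(ℝ, E₁) 𝓘(ℝ, E₂)
        (QuotientGroup.mk : G₁ → G₁ ⧸ H) 1)).symm
    · refine (hT (c' j).1 (v j)).trans ((hb (Sum.inr j)).trans ?_).symm
      exact Prod.ext rfl (hv j).symm
  let q := IsHomogeneousMap.pullbackForm (I := 𝓘(ℝ, ℝ × ℝ × ℝ).prod 𝓘(ℝ, E₁)) g p
  have hq : ∀ i j, q (U i) (U j) = if i = j then 1 else 0 := fun i j => by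
    refine Eq.trans ?_ (hbB i j)
    rw [← hU, ← hU]
    rfl
  have hform := horb.isInvariantForm U b hU hq
  let Q := lieForm (𝓘(ℝ, ℝ × ℝ × ℝ).prod 𝓘(ℝ, E₁)) (SL(2, ℝ) × G₁) q
  let εL : Module.Basis (Fin 3) ℝ (GroupLieAlgebra 𝓘(ℝ, ℝ × ℝ × ℝ) SL(2, ℝ)) := ε
  let u : Fin m → GroupLieAlgebra 𝓘(ℝ, ℝ × ℝ × ℝ) SL(2, ℝ) := fun j => (c' j).1
  let vL : Fin m → GroupLieAlgebra 𝓘(ℝ, E₁) G₁ := v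
  have hUL : (Sum.elim (fun k => GroupLieAlgebra.inl 𝓘(ℝ, E₁) G₁ 𝓘(ℝ, ℝ × ℝ × ℝ) SL(2, ℝ) (εL k))
      fun j => GroupLieAlgebra.pair (u j) (vL j)) = U := by
    funext i
    rcases i with k | j <;> rfl
  have hrad : ∀ x, (∀ y, Q x y = 0) →
      GroupLieAlgebra.fst 𝓘(ℝ, E₁) G₁ 𝓘(ℝ, ℝ × ℝ × ℝ) SL(2, ℝ) x = 0 := by
    rintro ⟨x₁, x₂⟩ hx
    exact congrArg Prod.fst ((hT x₁ x₂).symm.trans (horb.mfderiv_eq_zero_of_radical (hx _)))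
  have hsplit := GroupLieAlgebra.isSplitFrame Q εL u vL (hUL ▸ hform) hrad
  have hperf := GroupLieAlgebra.span_lie_eq_top_prod SLTwo.span_lie_eq_top hG₁.span_lie_eq_top
  let e : Fin 3 → GroupLieAlgebra (𝓘(ℝ, ℝ × ℝ × ℝ).prod 𝓘(ℝ, E₁)) (SL(2, ℝ) × G₁) :=
    fun k => GroupLieAlgebra.inl 𝓘(ℝ, E₁) G₁ 𝓘(ℝ, ℝ × ℝ × ℝ) SL(2, ℝ) (εL k)
  let V : Fin m → GroupLieAlgebra (𝓘(ℝ, ℝ × ℝ × ℝ).prod 𝓘(ℝ, E₁)) (SL(2, ℝ) × G₁) :=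
    fun j => GroupLieAlgebra.inr 𝓘(ℝ, E₁) G₁ 𝓘(ℝ, ℝ × ℝ × ℝ) SL(2, ℝ) (vL j)
  let ψ : Fin m → Fin 3 → ℝ := fun j k => εL.repr (u j) k
  have hfU : IsSplitFrame.frame e V ψ = U := by
    refine Eq.trans ?_ hUL
    funext i
    rcases i with k | j
    · rfl
    · exact GroupLieAlgebra.inr_add_sum_repr εL (u j) (vL j)
  have hstab : ∀ s : SL(2, ℝ) × G₁, p s = p 1 → s.1 = 1 := fun s hs => congrArg Prod.fst hs
  have hinl : ∀ (w : GroupLieAlgebra 𝓘(ℝ, ℝ × ℝ × ℝ) SL(2, ℝ)) (s : SL(2, ℝ) × G₁), p s = p 1 →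
      adInv (GroupLieAlgebra.inl 𝓘(ℝ, E₁) G₁ 𝓘(ℝ, ℝ × ℝ × ℝ) SL(2, ℝ) w) s =
        GroupLieAlgebra.inl 𝓘(ℝ, E₁) G₁ 𝓘(ℝ, ℝ × ℝ × ℝ) SL(2, ℝ) w := by
    intro w s hs
    rw [GroupLieAlgebra.inl_apply, adInv_pair, hstab s hs, adInv_one, adInv_zero]
  have hfe : ∀ k, IsHomogeneousMap.IsFixed (𝓘(ℝ, ℝ × ℝ × ℝ).prod 𝓘(ℝ, E₁))
      (𝓘(ℝ, ℝ × ℝ × ℝ).prod 𝓘(ℝ, E₂)) p (e k) := fun k => hP.isFixed_of_adInv (hinl (εL k))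
  have hQY : ∀ k x, Q (IsSplitFrame.dualVec e V ψ k) x =
      -Q (e k) (GroupLieAlgebra.inr 𝓘(ℝ, E₁) G₁ 𝓘(ℝ, ℝ × ℝ × ℝ) SL(2, ℝ)
        (GroupLieAlgebra.snd 𝓘(ℝ, E₁) G₁ 𝓘(ℝ, ℝ × ℝ × ℝ) SL(2, ℝ) x)) := by
    intro k x
    have h1 : Q (IsSplitFrame.dualVec e V ψ k)
        (GroupLieAlgebra.inl 𝓘(ℝ, E₁) G₁ 𝓘(ℝ, ℝ × ℝ × ℝ) SL(2, ℝ)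
        (GroupLieAlgebra.fst 𝓘(ℝ, E₁) G₁ 𝓘(ℝ, ℝ × ℝ × ℝ) SL(2, ℝ) x)) = 0 := by
      rw [← εL.sum_repr (GroupLieAlgebra.fst 𝓘(ℝ, E₁) G₁ 𝓘(ℝ, ℝ × ℝ × ℝ) SL(2, ℝ) x)]
      simp only [map_sum, map_smul]
      refine Finset.sum_eq_zero fun l _ => ?_
      rw [hsplit.q_dualVec_e k l, smul_zero]
    have h2 := hsplit.q_dualVec_of_coord_eq_zero k
      (u := GroupLieAlgebra.inr 𝓘(ℝ, E₁) G₁ 𝓘(ℝ, ℝ × ℝ × ℝ) SL(2, ℝ)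
        (GroupLieAlgebra.snd 𝓘(ℝ, E₁) G₁ 𝓘(ℝ, ℝ × ℝ × ℝ) SL(2, ℝ) x)) (map_zero εL.equivFun)
    conv_lhs => rw [← GroupLieAlgebra.pair_fst_snd x, GroupLieAlgebra.pair_eq, map_add]
    rw [h1, h2, zero_add]
  have hfY : ∀ k, IsHomogeneousMap.IsFixed (𝓘(ℝ, ℝ × ℝ × ℝ).prod 𝓘(ℝ, E₁))
      (𝓘(ℝ, ℝ × ℝ × ℝ).prod 𝓘(ℝ, E₂)) p (IsSplitFrame.dualVec e V ψ k) := by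
    intro k
    refine hP.isFixed_of_pullbackForm hpres fun s hs x => ?_
    refine (hQY k (adInv x s)).trans (Eq.trans ?_ (hQY k x).symm)
    have h1 : GroupLieAlgebra.inr 𝓘(ℝ, E₁) G₁ 𝓘(ℝ, ℝ × ℝ × ℝ) SL(2, ℝ)
        (GroupLieAlgebra.snd 𝓘(ℝ, E₁) G₁ 𝓘(ℝ, ℝ × ℝ × ℝ) SL(2, ℝ) (adInv x s)) =
        adInv (GroupLieAlgebra.inr 𝓘(ℝ, E₁) G₁ 𝓘(ℝ, ℝ × ℝ × ℝ) SL(2, ℝ)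
        (GroupLieAlgebra.snd 𝓘(ℝ, E₁) G₁ 𝓘(ℝ, ℝ × ℝ × ℝ) SL(2, ℝ) x)) s := by
      conv_lhs => rw [← GroupLieAlgebra.pair_fst_snd x, adInv_pair]
      rw [GroupLieAlgebra.inr_apply, GroupLieAlgebra.inr_apply, adInv_pair, adInv_zero]
      rfl
    have h2 := hP.pullbackForm_adInv_adInv hpres (e k)
      (GroupLieAlgebra.inr 𝓘(ℝ, E₁) G₁ 𝓘(ℝ, ℝ × ℝ × ℝ) SL(2, ℝ)
        (GroupLieAlgebra.snd 𝓘(ℝ, E₁) G₁ 𝓘(ℝ, ℝ × ℝ × ℝ) SL(2, ℝ) x)) hs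
    rw [hinl (εL k) s hs] at h2
    rw [h1]
    exact congrArg Neg.neg h2
  have hfv : ∀ k, IsHomogeneousMap.IsFixed 𝓘(ℝ, E₁) 𝓘(ℝ, E₂) (QuotientGroup.mk : G₁ → G₁ ⧸ H)
      (∑ j, ψ j k • vL j) := by
    intro k
    have h1 : GroupLieAlgebra.snd 𝓘(ℝ, E₁) G₁ 𝓘(ℝ, ℝ × ℝ × ℝ) SL(2, ℝ)
        (IsSplitFrame.dualVec e V ψ k) = ∑ j, ψ j k • vL j := by
      rw [IsSplitFrame.dualVec, map_sum]
      refine Finset.sum_congr rfl fun j _ => ?_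
      rw [map_smul]
      refine congrArg (ψ j k • ·) ?_
      exact congrArg (GroupLieAlgebra.snd 𝓘(ℝ, E₁) G₁ 𝓘(ℝ, ℝ × ℝ × ℝ) SL(2, ℝ))
        (GroupLieAlgebra.inr_add_sum_repr εL (u j) (vL j))
    rw [← h1]
    exact IsHomogeneousMap.IsFixed.of_prod hhom (hfY k)
  have hbr : ∀ k l w, Q ⁅∑ j, ψ j k • V j, ∑ j, ψ j l • V j⁆ w = 0 := by
    intro k l w
    have h1 : ∀ k, ∑ j, ψ j k • V j = GroupLieAlgebra.inr 𝓘(ℝ, E₁) G₁ 𝓘(ℝ, ℝ × ℝ × ℝ) SL(2, ℝ)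
        (∑ j, ψ j k • vL j) := fun k => by
      rw [map_sum]
      exact Finset.sum_congr rfl fun j _ => (map_smul _ _ _).symm
    rw [h1, h1, GroupLieAlgebra.inr_lie_inr]
    have h2 := hhom.mfderiv_lie_eq_zero (mk_mul_comm_of_normalizesStabilizer hN) (hfv k) (hfv l)
    have h3 : (mfderiv (𝓘(ℝ, ℝ × ℝ × ℝ).prod 𝓘(ℝ, E₁)) (𝓘(ℝ, ℝ × ℝ × ℝ).prod 𝓘(ℝ, E₂)) p 1
        (GroupLieAlgebra.inr 𝓘(ℝ, E₁) G₁ 𝓘(ℝ, ℝ × ℝ × ℝ) SL(2, ℝ)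
          ⁅∑ j, ψ j k • vL j, ∑ j, ψ j l • vL j⁆) : (ℝ × ℝ × ℝ) × E₂) = 0 :=
      (hT 0 (⁅∑ j, ψ j k • vL j, ∑ j, ψ j l • vL j⁆ : GroupLieAlgebra 𝓘(ℝ, E₁) G₁)).trans
        (congrArg (fun z : E₂ => ((0 : ℝ × ℝ × ℝ), z)) h2)
    refine Eq.trans (congrArg (fun x => B x (mfderiv (𝓘(ℝ, ℝ × ℝ × ℝ).prod 𝓘(ℝ, E₁))
      (𝓘(ℝ, ℝ × ℝ × ℝ).prod 𝓘(ℝ, E₂)) p 1 w)) h3) ?_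
    exact LinearMap.congr_fun (map_zero B) _
  have hric : ∀ X Y : GroupLieAlgebra (𝓘(ℝ, ℝ × ℝ × ℝ).prod 𝓘(ℝ, E₁)) (SL(2, ℝ) × G₁),
      IsHomogeneousMap.IsFixed (𝓘(ℝ, ℝ × ℝ × ℝ).prod 𝓘(ℝ, E₁))
        (𝓘(ℝ, ℝ × ℝ × ℝ).prod 𝓘(ℝ, E₂)) p X →
      IsHomogeneousMap.IsFixed (𝓘(ℝ, ℝ × ℝ × ℝ).prod 𝓘(ℝ, E₁))
        (𝓘(ℝ, ℝ × ℝ × ℝ).prod 𝓘(ℝ, E₂)) p Y →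
      HasRicci Q (IsSplitFrame.frame e V ψ) X Y (c * Q X Y) := by
    intro X Y hX hY
    rw [hfU]
    exact horb.hasRicci hLC hR hc (hP.isSmoothField_invariantField hX)
      (hP.related_invariantField hX) (hP.isSmoothField_invariantField hY)
      (hP.related_invariantField hY) U b hU hq
  refine hsplit.not_einstein hperf hbr (fun w hw => ?_) ?_ c
    (fun k => hric _ _ (hfe k) (hfY k)) (fun k l => hric _ _ (hfe k) (hfe l))
  · refine eq_zero_of_sum_repr_lie_eq_zero SLTwo.span_lie_eq_top εL w fun i j => ?_
    have := hw i j
    rw [GroupLieAlgebra.inl_lie_inl] at this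
    exact this
  · obtain ⟨x, y, hy, hxy⟩ := SLTwo.exists_root
    have h1 : ∀ z : GroupLieAlgebra 𝓘(ℝ, ℝ × ℝ × ℝ) SL(2, ℝ), ∑ i, εL.repr z i • e i =
        GroupLieAlgebra.inl 𝓘(ℝ, E₁) G₁ 𝓘(ℝ, ℝ × ℝ × ℝ) SL(2, ℝ) z := fun z => by
      conv_rhs => rw [← εL.sum_repr z, map_sum]
      exact Finset.sum_congr rfl fun i _ => (map_smul _ _ _).symm
    refine ⟨εL.repr x, εL.repr y, fun h0 => hy ?_, ?_⟩
    · exact εL.repr.map_eq_zero_iff.1 (DFunLike.coe_injective h0)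
    · exact (congrArg₂ (fun a b => ⁅a, b⁆) (h1 x) (h1 y)).trans
        ((GroupLieAlgebra.inl_lie_inl x y).trans ((congrArg _ hxy).trans
          ((map_smul _ _ _).trans (congrArg ((2 : ℝ) • ·) (h1 y).symm))))
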